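/- Consider the class of equations $$u_{tt}=f(x,u_x)\,u_{xx}+g(x,u_x),$$ where $(f,g)$ are real-valued smooth functions of $(x,u_x)$ on an open set, $f$ has no zeros, and the equation is nonlinear in the sense that the pair $(f_{u_x},g_{u_xu_x})$ does not vanish identically on any nonempty open subset of the domain of $(f,g)$. All considerations are local (transformations are taken in a neighbourhood of a first-order jet $(t,x,u,u_t,u_x)$ with $(x,u_x)$ in the domain of $(f,g)$, and may be restricted to smaller neighbourhoods). For $\theta=(f,g)$ let $\mathcal L_\theta$ be the corresponding submanifold of the second-order jet space, and let $\mathrm T(\theta,\tilde\theta)$ be the set of local point transformations (local diffeomorphisms) $\varphi$ of the space of $(t,x,u)$ whose second prolongation is defined near the jet considered and maps $\mathcal L_\theta$ to $\mathcal L_{\tilde\theta}$; the point symmetry pseudogroup of $\mathcal L_\theta$ is $G_\theta=\mathrm T(\theta,\theta)$. The equivalence (pseudo)group $G^\sim$ of the class consists of the local point transformations $\Phi$ of the space of $(t,x,u,u_t,u_x,u_{tt},u_{tx},u_{xx},f,g)$ that project to the jet space as the second prolongation of a point transformation $\Phi|_{(t,x,u)}$ and that, together with their inverses, preserve the class: wherever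 the graph of an element $\theta$ of the class meets the domain of $\Phi$, it is mapped locally to the graph of an element $\Phi\theta$ of the class, and $\Phi|_{(t,x,u)}\in\mathrm T(\theta,\Phi\theta)$. Then: (1) The class is semi-normalized: for all elements $\theta,\tilde\theta$ of the class and every $\varphi\in\mathrm T(\theta,\tilde\theta)$ near a first-order jet there exist $\Phi\in G^\sim$ and $\tilde\varphi\in G_\theta$ such that, locally, $\tilde\theta=\Phi\theta$ and $\varphi=\Phi|_{(t,x,u)}\circ\tilde\varphi$. (2) Consequently, group classification of the class up to $G^\sim$-equivalence coincides with group classification up to general point equivalence. That is, for two equations of the class, each considered near a first-order jet, there is a point transformation mapping one equation to the other and its jet to the other jet if and only if there is such a transformation induced by $G^\sim$; and hence a family of sets of such localized equations solves the group classification problem up to $G^\sim$-equivalence if and only if it solves it up to general point equivalence. Here a family $(\mathcal S_\gamma)_{\gamma\in\Gamma}$ solves the group classification problem up to an equivalence relation if each listed equation has a maximal Lie invariance algebra $\mathfrak g_\theta$ different from the kernel algebra $\mathfrak g^\cap=\bigcap_\theta\mathfrak g_\theta$ of the class, the algebras $\mathfrak g_\theta$ of the equations in the same $\mathcal S_\gamma$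 have the same dimension, every equation of the class with $\mathfrak g_\theta\ne\mathfrak g^\cap$ is equivalent to a listed one, and distinct listed equations are inequivalent. (All Lie algebras are algebras of germs of smooth vector fields in $(t,x,u)$ and intersections are taken over all elements of the class defined near the given jet.) -/

import Mathlib

open scoped ContDiff Topology

/-! ## Jet coordinates

One dependent variable `u` and two independent variables `t`, `x`. -/

/-- Points `(t, x, u)`. -/
abbrev J0 : Type := ℝ × ℝ × ℝ

/-- First-order jets `((t, x, u), (u_t, u_x))`. -/
abbrev J1 : Type := J0 × (ℝ × ℝ)

/-- Second-order jets `(((t, x, u), (u_t, u_x)), (u_tt, u_tx, u_xx))`. -/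
abbrev J2 : Type := J1 × (ℝ × ℝ × ℝ)

/-- The pair `(x, u_x)`, the argument of the arbitrary elements. -/
def jetArg (j : J1) : ℝ × ℝ := (j.1.2.1, j.2.2)

/-- The second-order jets whose underlying first-order jet is near `j`
(with no restriction on the second-order derivatives). -/
def nearJet (j : J1) : Filter J2 := (𝓝 j).comap Prod.fst

/-! ## Total derivatives and prolongation of point transformations -/

/-- The total derivative `D_t F` of a function `F (t, x, u)`. -/
noncomputable def totalT (F : J0 → ℝ) (j : J1) : ℝ := fderiv ℝ F j.1 (1, 0, j.2.1)

/-- The total derivative `D_x F` of a function `F (t, x, u)`. -/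
noncomputable def totalX (F : J0 → ℝ) (j : J1) : ℝ := fderiv ℝ F j.1 (0, 1, j.2.2)

/-- The total derivative `D_t F` of a function `F` of the first-order jet. -/
noncomputable def totalT' (F : J1 → ℝ) (k : J2) : ℝ :=
  fderiv ℝ F k.1 ((1, 0, k.1.2.1), (k.2.1, k.2.2.1))

/-- The total derivative `D_x F` of a function `F` of the first-order jet. -/
noncomputable def totalX' (F : J1 → ℝ) (k : J2) : ℝ :=
  fderiv ℝ F k.1 ((0, 1, k.1.2.2), (k.2.2.1, k.2.2.2))

section Prolongation

variable (φ : J0 → J0)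

/-- The component `T` of `(t, x, u) ↦ (T, X, U)`. -/
def compT (z : J0) : ℝ := (φ z).1

/-- The component `X` of `(t, x, u) ↦ (T, X, U)`. -/
def compX (z : J0) : ℝ := (φ z).2.1

/-- The component `U` of `(t, x, u) ↦ (T, X, U)`. -/
def compU (z : J0) : ℝ := (φ z).2.2

/-- The total Jacobian `D_t T · D_x X - D_x T · D_t X`; the prolongation of `φ` is defined at the
jets where it does not vanish. -/
noncomputable def totalJac (j : J1) : ℝ :=
  totalT (compT φ) j * totalX (compX φ) j - totalX (compT φ) j * totalT (compX φ) j

/-- The derivative with respect to the new variable `t̃ = T` of a function with total derivatives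
`a = D_t F`, `b = D_x F`. -/
noncomputable def newDerivT (j : J1) (a b : ℝ) : ℝ :=
  (a * totalX (compX φ) j - b * totalT (compX φ) j) / totalJac φ j

/-- The derivative with respect to the new variable `x̃ = X` of a function with total derivatives
`a = D_t F`, `b = D_x F`. -/
noncomputable def newDerivX (j : J1) (a b : ℝ) : ℝ :=
  (b * totalT (compT φ) j - a * totalX (compT φ) j) / totalJac φ j

/-- The transformed derivative `ũ_t̃`. -/
noncomputable def newUt (j : J1) : ℝ := newDerivT φ j (totalT (compU φ) j) (totalX (compU φ) j)

/-- The transformed derivative `ũ_x̃`. -/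
noncomputable def newUx (j : J1) : ℝ := newDerivX φ j (totalT (compU φ) j) (totalX (compU φ) j)

/-- The first prolongation of `φ`. -/
noncomputable def prolong1 (j : J1) : J1 := (φ j.1, (newUt φ j, newUx φ j))

/-- The second prolongation of `φ`. -/
noncomputable def prolong2 (k : J2) : J2 :=
  (prolong1 φ k.1,
    (newDerivT φ k.1 (totalT' (newUt φ) k) (totalX' (newUt φ) k),
     newDerivX φ k.1 (totalT' (newUt φ) k) (totalX' (newUt φ) k),
     newDerivX φ k.1 (totalT' (newUx φ) k) (totalX' (newUx φ) k)))

end Prolongation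

/-- A (local) point transformation in the space `E`: a smooth invertible map between open subsets
of `E` with smooth inverse. -/
structure PointTransformation (E : Type) [NormedAddCommGroup E] [NormedSpace ℝ E] extends
    OpenPartialHomeomorph E E where
  smooth_toFun : ContDiffOn ℝ ∞ toFun source
  smooth_invFun : ContDiffOn ℝ ∞ invFun target

/-- The inverse point transformation. -/
def PointTransformation.inverse {E : Type} [NormedAddCommGroup E] [NormedSpace ℝ E]
    (φ : PointTransformation E) : PointTransformation E where
  toOpenPartialHomeomorph := φ.toOpenPartialHomeomorph.symm
  smooth_toFun := φ.smooth_invFun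
  smooth_invFun := φ.smooth_toFun

/-! ## Equations `u_tt = f(x, u_x) u_xx + g(x, u_x)` -/

/-- A pair of arbitrary elements `θ = (f, g)`: smooth functions of `(x, u_x)` on an open set. -/
structure ArbElem where
  dom : Set (ℝ × ℝ)
  isOpen_dom : IsOpen dom
  f : ℝ × ℝ → ℝ
  g : ℝ × ℝ → ℝ
  smooth_f : ContDiffOn ℝ ∞ f dom
  smooth_g : ContDiffOn ℝ ∞ g dom

/-- The value `(f, g)` of the arbitrary elements at a jet. -/
def ArbElem.val (θ : ArbElem) (j : J1) : ℝ × ℝ := (θ.f (jetArg j), θ.g (jetArg j))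

/-- The equation `u_tt = f(x, u_x) u_xx + g(x, u_x)` as a submanifold of the second-order jets. -/
def ArbElem.eqn (θ : ArbElem) : Set J2 :=
  {k | jetArg k.1 ∈ θ.dom ∧ k.2.1 = θ.f (jetArg k.1) * k.2.2.2 + θ.g (jetArg k.1)}

/-- Partial derivative with respect to `u_x` of a function of `(x, u_x)`. -/
noncomputable def partialUx (F : ℝ × ℝ → ℝ) (b : ℝ × ℝ) : ℝ := fderiv ℝ F b (0, 1)

/-- The class of nonlinear equations `u_tt = f(x, u_x) u_xx + g(x, u_x)`: `f` has no zeros and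
`(f_{u_x}, g_{u_x u_x})` does not vanish identically on any nonempty open subset of the domain,
i.e. the equation is not linear on any piece of its domain. -/
def waveClass : Set ArbElem :=
  {θ | (∀ b ∈ θ.dom, θ.f b ≠ 0) ∧
    ∀ V : Set (ℝ × ℝ), IsOpen V → V.Nonempty → V ⊆ θ.dom →
      ∃ b ∈ V, (partialUx θ.f b, partialUx (partialUx θ.g) b) ≠ (0, 0)}

/-! ## Admissible transformations, equivalence group, semi-normalization -/

/-- `φ ∈ T(θ, θ')` near the first-order jet `j`: the prolongation of the point transformation `φ`
is defined near `j` and maps the equation with arbitrary elements `θ` to the equation with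
arbitrary elements `θ'`. For `θ' = θ` this says that `φ` belongs to the maximal point symmetry
pseudogroup `G_θ`. -/
def AdmissibleAt (θ θ' : ArbElem) (φ : PointTransformation J0) (j : J1) : Prop :=
  j.1 ∈ φ.source ∧ jetArg j ∈ θ.dom ∧ totalJac φ.toFun j ≠ 0 ∧
    ∀ᶠ k in nearJet j, k ∈ θ.eqn ↔ prolong2 φ.toFun k ∈ θ'.eqn

/-- `θ' = Φ θ` along the filter `l` of jets: the transformation `Φ` of the space of
`(t, x, u_(2), f, g)`, whose restriction to the space of `(t, x, u)` is `φ`, maps the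
graph of `θ` to the graph of `θ'`. -/
def Transforms (Φ : PointTransformation (J2 × (ℝ × ℝ))) (φ : PointTransformation J0)
    (θ θ' : ArbElem) (l : Filter J2) : Prop :=
  ∀ᶠ k in l, (k, θ.val k.1) ∈ Φ.source ∧ jetArg (prolong1 φ.toFun k.1) ∈ θ'.dom ∧
    Φ.toFun (k, θ.val k.1) = (prolong2 φ.toFun k, θ'.val (prolong1 φ.toFun k.1))

/-- `Φ` preserves the class `S`: wherever the graph of some `θ ∈ S` meets the domain of `Φ`, it is
mapped to the graph of some `θ' ∈ S`, and `(θ, θ', φ)` is an admissible transformation. -/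
def PreservesClass (S : Set ArbElem) (Φ : PointTransformation (J2 × (ℝ × ℝ)))
    (φ : PointTransformation J0) : Prop :=
  ∀ θ ∈ S, ∀ k : J2, jetArg k.1 ∈ θ.dom → (k, θ.val k.1) ∈ Φ.source →
    ∃ θ' ∈ S, Transforms Φ φ θ θ' (𝓝 k) ∧ AdmissibleAt θ θ' φ k.1

/-- `Φ` belongs to the usual equivalence pseudogroup of the class `S`, and `φ` is its restriction
to the space of `(t, x, u)`: `Φ` is a point transformation in the space of
`(t, x, u_(2), f, g)` that projects to the space of jets as the second prolongation of `φ` (hence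
also to the spaces of lower-order jets), and `Φ` and its inverse preserve the class. -/
structure IsEquivTransformation (S : Set ArbElem) (Φ : PointTransformation (J2 × (ℝ × ℝ)))
    (φ : PointTransformation J0) : Prop where
  prolongs : ∀ w ∈ Φ.source, w.1.1.1 ∈ φ.source ∧ totalJac φ.toFun w.1.1 ≠ 0 ∧
    (Φ.toFun w).1 = prolong2 φ.toFun w.1
  preserves : PreservesClass S Φ φ
  preserves_inverse : PreservesClass S Φ.inverse φ.inverse

/-- The class `S` is semi-normalized: every admissible transformation `(θ, θ', φ)` is (locally)
of the form `φ = Φ|_(t,x,u) ∘ σ` with `σ` in the point symmetry pseudogroup of the equation with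
arbitrary elements `θ`, and `Φ` in the equivalence pseudogroup with `θ' = Φ θ`. -/
def SemiNormalized (S : Set ArbElem) : Prop :=
  ∀ θ ∈ S, ∀ θ' ∈ S, ∀ (φ : PointTransformation J0) (j : J1), AdmissibleAt θ θ' φ j →
    ∃ (Φ : PointTransformation (J2 × (ℝ × ℝ))) (φΦ σ : PointTransformation J0),
      IsEquivTransformation S Φ φΦ ∧
      AdmissibleAt θ θ σ j ∧
      Transforms Φ φΦ θ θ' (nearJet (prolong1 σ.toFun j)) ∧
      ∀ᶠ z in 𝓝 j.1, φ.toFun z = φΦ.toFun (σ.toFun z)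

/-! ## Lie symmetries -/

section LieSymmetries

variable (Q : J0 → J0)

/-- The coefficient of `∂_{u_t}` in the prolongation of the vector field
`Q = τ ∂_t + ξ ∂_x + η ∂_u`. -/
noncomputable def coefT (j : J1) : ℝ :=
  totalT (compU Q) j - j.2.1 * totalT (compT Q) j - j.2.2 * totalT (compX Q) j

/-- The coefficient of `∂_{u_x}`. -/
noncomputable def coefX (j : J1) : ℝ :=
  totalX (compU Q) j - j.2.1 * totalX (compT Q) j - j.2.2 * totalX (compX Q) j

/-- The coefficient of `∂_{u_tt}`. -/
noncomputable def coefTT (k : J2) : ℝ :=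
  totalT' (coefT Q) k - k.2.1 * totalT (compT Q) k.1 - k.2.2.1 * totalT (compX Q) k.1

/-- The coefficient of `∂_{u_xx}`. -/
noncomputable def coefXX (k : J2) : ℝ :=
  totalX' (coefX Q) k - k.2.2.1 * totalX (compT Q) k.1 - k.2.2.2 * totalX (compX Q) k.1

/-- The second prolongation of `Q` applied to `u_tt - f u_xx - g`. -/
noncomputable def prolongedAction (θ : ArbElem) (k : J2) : ℝ :=
  coefTT Q k
    - fderiv ℝ θ.f (jetArg k.1) (compX Q k.1.1, coefX Q k.1) * k.2.2.2
    - θ.f (jetArg k.1) * coefXX Q k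
    - fderiv ℝ θ.g (jetArg k.1) (compX Q k.1.1, coefX Q k.1)

end LieSymmetries


lemma smooth_comps {Q : J0 → J0} {z : J0} (hQ : ContDiffAt ℝ ∞ Q z) :
    ContDiffAt ℝ ∞ (compT Q) z ∧ ContDiffAt ℝ ∞ (compX Q) z ∧ ContDiffAt ℝ ∞ (compU Q) z := by
  unfold compT compX compU
  exact ⟨hQ.fst, hQ.snd.fst, hQ.snd.snd⟩

lemma differentiableAt_totalT {F : J0 → ℝ} {j : J1} (hF : ContDiffAt ℝ ∞ F j.1) :
    DifferentiableAt ℝ (totalT F) j := by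
  have h1 : DifferentiableAt ℝ (fderiv ℝ F) j.1 :=
    (hF.fderiv_right (m := 1) (by norm_cast)).differentiableAt (by norm_num)
  have h2 : DifferentiableAt ℝ (fun j : J1 => fderiv ℝ F j.1) j :=
    DifferentiableAt.comp (g := fderiv ℝ F) j h1 differentiableAt_fst
  unfold totalT
  exact h2.clm_apply (by fun_prop)

lemma differentiableAt_totalX {F : J0 → ℝ} {j : J1} (hF : ContDiffAt ℝ ∞ F j.1) :
    DifferentiableAt ℝ (totalX F) j := by
  have h1 : DifferentiableAt ℝ (fderiv ℝ F) j.1 :=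
    (hF.fderiv_right (m := 1) (by norm_cast)).differentiableAt (by norm_num)
  have h2 : DifferentiableAt ℝ (fun j : J1 => fderiv ℝ F j.1) j :=
    DifferentiableAt.comp (g := fderiv ℝ F) j h1 differentiableAt_fst
  unfold totalX
  exact h2.clm_apply (by fun_prop)

lemma differentiableAt_coefs {Q : J0 → J0} {j : J1} (hQ : ContDiffAt ℝ ∞ Q j.1) :
    DifferentiableAt ℝ (coefT Q) j ∧ DifferentiableAt ℝ (coefX Q) j := by
  obtain ⟨h1, h2, h3⟩ := smooth_comps hQ
  have a1 := differentiableAt_totalT h1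
  have a2 := differentiableAt_totalT h2
  have a3 := differentiableAt_totalT h3
  have b1 := differentiableAt_totalX h1
  have b2 := differentiableAt_totalX h2
  have b3 := differentiableAt_totalX h3
  unfold coefT coefX
  constructor <;> fun_prop

lemma totals_lin {F G : J0 → ℝ} {j : J1} (a b : ℝ) (hF : DifferentiableAt ℝ F j.1)
    (hG : DifferentiableAt ℝ G j.1) :
    totalT (a • F + b • G) j = a * totalT F j + b * totalT G j ∧
      totalX (a • F + b • G) j = a * totalX F j + b * totalX G j := by
  unfold totalT totalX
  rw [fderiv_add (hF.const_smul a) (hG.const_smul b), fderiv_const_smul hF, fderiv_const_smul hG]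
  simp

lemma coefs_lin {Q R : J0 → J0} {j : J1} (a b : ℝ) (hQ : ContDiffAt ℝ ∞ Q j.1)
    (hR : ContDiffAt ℝ ∞ R j.1) :
    coefT (a • Q + b • R) j = a * coefT Q j + b * coefT R j ∧
      coefX (a • Q + b • R) j = a * coefX Q j + b * coefX R j := by
  obtain ⟨h1, h2, h3⟩ := smooth_comps hQ
  obtain ⟨k1, k2, k3⟩ := smooth_comps hR
  have e : (∞ : WithTop ℕ∞) ≠ 0 := by simp
  have l1 := totals_lin a b (h1.differentiableAt e) (k1.differentiableAt e)
  have l2 := totals_lin a b (h2.differentiableAt e) (k2.differentiableAt e)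
  have l3 := totals_lin a b (h3.differentiableAt e) (k3.differentiableAt e)
  have c1 : compT (a • Q + b • R) = a • compT Q + b • compT R := by ext z; simp [compT]
  have c2 : compX (a • Q + b • R) = a • compX Q + b • compX R := by ext z; simp [compX]
  have c3 : compU (a • Q + b • R) = a • compU Q + b • compU R := by ext z; simp [compU]
  unfold coefT coefX
  rw [c1, c2, c3, l1.1, l1.2, l2.1, l2.2, l3.1, l3.2]
  constructor <;> ring

lemma prolongedAction_lin {Q R : J0 → J0} (θ : ArbElem) {k : J2} (a b : ℝ)
    (hQ : ∀ᶠ z in 𝓝 k.1.1, ContDiffAt ℝ ∞ Q z) (hR : ∀ᶠ z in 𝓝 k.1.1, ContDiffAt ℝ ∞ R z) :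
    prolongedAction (a • Q + b • R) θ k = a * prolongedAction Q θ k + b * prolongedAction R θ k := by
  have hQ0 := hQ.self_of_nhds
  have hR0 := hR.self_of_nhds
  have t1 : Filter.Tendsto (fun j : J1 => j.1) (𝓝 k.1) (𝓝 k.1.1) := continuous_fst.tendsto _
  have eT : coefT (a • Q + b • R) =ᶠ[𝓝 k.1] a • coefT Q + b • coefT R := by
    filter_upwards [t1.eventually hQ, t1.eventually hR] with j h1 h2
    simpa using (coefs_lin a b h1 h2).1
  have eX : coefX (a • Q + b • R) =ᶠ[𝓝 k.1] a • coefX Q + b • coefX R := by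
    filter_upwards [t1.eventually hQ, t1.eventually hR] with j h1 h2
    simpa using (coefs_lin a b h1 h2).2
  obtain ⟨dQ1, dQ2⟩ := differentiableAt_coefs hQ0
  obtain ⟨dR1, dR2⟩ := differentiableAt_coefs hR0
  have fT : fderiv ℝ (coefT (a • Q + b • R)) k.1
      = a • fderiv ℝ (coefT Q) k.1 + b • fderiv ℝ (coefT R) k.1 := by
    rw [eT.fderiv_eq, fderiv_add (dQ1.const_smul a) (dR1.const_smul b), fderiv_const_smul dQ1,
      fderiv_const_smul dR1]
  have fX : fderiv ℝ (coefX (a • Q + b • R)) k.1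
      = a • fderiv ℝ (coefX Q) k.1 + b • fderiv ℝ (coefX R) k.1 := by
    rw [eX.fderiv_eq, fderiv_add (dQ2.const_smul a) (dR2.const_smul b), fderiv_const_smul dQ2,
      fderiv_const_smul dR2]
  obtain ⟨h1, h2, h3⟩ := smooth_comps hQ0
  obtain ⟨k1, k2, k3⟩ := smooth_comps hR0
  have e : (∞ : WithTop ℕ∞) ≠ 0 := by simp
  have l1 := totals_lin a b (h1.differentiableAt e) (k1.differentiableAt e)
  have l2 := totals_lin a b (h2.differentiableAt e) (k2.differentiableAt e)
  have c1 : compT (a • Q + b • R) = a • compT Q + b • compT R := by ext z; simp [compT]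
  have c2 : compX (a • Q + b • R) = a • compX Q + b • compX R := by ext z; simp [compX]
  have v : ((compX (a • Q + b • R) k.1.1, coefX (a • Q + b • R) k.1) : ℝ × ℝ)
      = a • (compX Q k.1.1, coefX Q k.1) + b • (compX R k.1.1, coefX R k.1) := by
    rw [c2, (coefs_lin a b hQ0 hR0).2]
    simp
  unfold prolongedAction coefTT coefXX totalT' totalX'
  rw [v, fT, fX, c1, c2, l1.1, l1.2, l2.1, l2.2]
  simp only [map_add, map_smul, add_apply, smul_apply, smul_eq_mul]
  ring

/-- The maximal Lie invariance algebra of the equation with arbitrary elements `θ` near the jet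
`j`, as a space of germs of smooth vector fields at the base point of `j`, given by the
infinitesimal invariance criterion. -/
noncomputable def lieAlg (θ : ArbElem) (j : J1) : Submodule ℝ ((𝓝 j.1).Germ J0) where
  carrier := {q | ∃ Q : J0 → J0, (Q : (𝓝 j.1).Germ J0) = q ∧
    (∀ᶠ z in 𝓝 j.1, ContDiffAt ℝ ∞ Q z) ∧
    ∀ᶠ k in nearJet j, k ∈ θ.eqn → prolongedAction Q θ k = 0}
  zero_mem' := by
    refine ⟨0, rfl, Filter.Eventually.of_forall fun z => contDiffAt_const,
      Filter.Eventually.of_forall fun k _ => ?_⟩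
    have h : ∀ᶠ z in 𝓝 k.1.1, ContDiffAt ℝ ∞ (0 : J0 → J0) z :=
      Filter.Eventually.of_forall fun z => contDiffAt_const
    simpa using prolongedAction_lin θ 0 0 h h
  add_mem' := by
    rintro _ _ ⟨Q, rfl, hQ, iQ⟩ ⟨R, rfl, hR, iR⟩
    refine ⟨Q + R, rfl, ?_, ?_⟩
    · filter_upwards [hQ, hR] with z h1 h2 using h1.add h2
    · have t : Filter.Tendsto (fun k : J2 => k.1.1) (nearJet j) (𝓝 j.1) :=
        (continuous_fst.tendsto j).comp Filter.tendsto_comap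
      filter_upwards [iQ, iR, t.eventually hQ.eventually_nhds, t.eventually hR.eventually_nhds]
        with k h1 h2 h3 h4 hk
      simpa [h1 hk, h2 hk] using prolongedAction_lin θ 1 1 h3 h4
  smul_mem' := by
    rintro c _ ⟨Q, rfl, hQ, iQ⟩
    refine ⟨c • Q, rfl, ?_, ?_⟩
    · filter_upwards [hQ] with z h1 using h1.const_smul c
    · have t : Filter.Tendsto (fun k : J2 => k.1.1) (nearJet j) (𝓝 j.1) :=
        (continuous_fst.tendsto j).comp Filter.tendsto_comap
      filter_upwards [iQ, t.eventually hQ.eventually_nhds] with k h1 h3 hk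
      simpa [h1 hk] using prolongedAction_lin θ c 0 h3 h3

/-- The kernel of the maximal Lie invariance algebras of the equations of the class `S`, near the
jet `j`. -/
noncomputable def kernelAlg (S : Set ArbElem) (j : J1) : Submodule ℝ ((𝓝 j.1).Germ J0) :=
  ⨅ θ ∈ {θ ∈ S | jetArg j ∈ θ.dom}, lieAlg θ j

/-! ## Group classification -/

/-- An equation of the class `S` considered near a first-order jet. -/
structure LocalElem (S : Set ArbElem) where
  elem : ArbElem
  mem : elem ∈ S
  jet : J1
  jet_mem : jetArg jet ∈ elem.dom

/-- General point equivalence: a point transformation maps one equation to the other one. -/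
def PointEquiv {S : Set ArbElem} (a b : LocalElem S) : Prop :=
  ∃ φ : PointTransformation J0, AdmissibleAt a.elem b.elem φ a.jet ∧
    prolong1 φ.toFun a.jet = b.jet

/-- Equivalence with respect to the usual equivalence group of the class. -/
def GroupEquiv {S : Set ArbElem} (a b : LocalElem S) : Prop :=
  ∃ (Φ : PointTransformation (J2 × (ℝ × ℝ))) (φ : PointTransformation J0),
    IsEquivTransformation S Φ φ ∧ Transforms Φ φ a.elem b.elem (nearJet a.jet) ∧
    prolong1 φ.toFun a.jet = b.jet

/-- The equation admits a proper extension of the kernel algebra. -/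
def HasExtension {S : Set ArbElem} (a : LocalElem S) : Prop :=
  lieAlg a.elem a.jet ≠ kernelAlg S a.jet

/-- The family `𝒮` of subsets of the class is a solution of the group classification problem up
to the equivalence `R`: it consists of equations with extensions of Lie symmetry, with algebras
of the same dimension within each member of the family; every equation with an extension is
equivalent to a listed one; and different listed equations are inequivalent. -/
structure IsClassificationList {S : Set ArbElem} (R : LocalElem S → LocalElem S → Prop)
    {Γ : Type*} (𝒮 : Γ → Set (LocalElem S)) : Prop where
  extension : ∀ γ, ∀ a ∈ 𝒮 γ, HasExtension a
  dimension : ∀ γ, ∀ a ∈ 𝒮 γ, ∀ b ∈ 𝒮 γ,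
    Module.rank ℝ (lieAlg a.elem a.jet) = Module.rank ℝ (lieAlg b.elem b.jet)
  complete : ∀ a, HasExtension a → ∃ γ, ∃ b ∈ 𝒮 γ, R a b
  inequivalent : ∀ a ∈ ⋃ γ, 𝒮 γ, ∀ b ∈ ⋃ γ, 𝒮 γ, R a b → a = b

/-! On the source equation `u_tx` and `u_xx` are free, so for an admissible φ = (T, X, U) the
transformed equation becomes an affine identity in them. The factor `contactFactor` multiplying the
second derivatives never vanishes, so the coefficients yield `DeterminingEqs`: relations between f,
the new f' and the total Jacobian matrix of (T, X), plus one relation carrying g and g'.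

These relations force T = T(t) and X = X(x). As f does not involve `u_t`, splitting in `u_t` removes
T_u and X_u (`dU_compT_compX`). If X_t ≠ 0, the new slope ũ_x̃ is affine in (u_t, u_x) and genuinely
depends on `u_t`. A function of `u_x` alone can match a function of that slope only if f does not
depend on `u_x` and g is quadratic in `u_x`, with leading coefficient proportional to U_uu
(`relations_of_dT_compX_ne_zero`). Moving u with `u_x` and ũ_x̃ held fixed shows U_uu = 0
(`dU_dU_of_dT_compX_ne_zero`). The equation would then be linear on an open set, which the class
forbids.

The same mechanism with u in the role of `u_t` gives U_xu = 0 (`FibreEqs.dX_dU_compU`), while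
splitting in `u_t` gives U_uu = 0 and 2 U_tu = (T_tt/T_t) U_u. T need not be affine: the remaining
conditions allow fractional linear T, for instance when f = u_x⁻⁴. This is why symmetries of the
individual equation must be factored out.

The decisive fact is that `accelU`, that is U_tt − (T_tt/T_t) U_t, depends on t only
(`FibreEqs.dU_accelU`, `FibreEqs.dX_accelU`). Now freeze t and u at the base point. The determining
equations become exactly the rule by which t̃ = c₁t + c₀, x̃ = X(x), ũ = c₂u + c₄t² + c₃t + ψ(x)
acts on (f, g), with c₁ = T_t, c₂ = U_u and 2c₄ = `accelU` there; the remaining data are chosen so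
that the first-order jets agree (`EquivData.exists_equivData`). Such maps lie in the equivalence
pseudogroup (`EquivData.IsInverse.isEquivTransformation`).

So φ and an equivalence transformation Φ carry θ to the same θ' and the jet to the same jet, and Φ⁻¹
∘ φ is a symmetry of θ fixing that jet (`AdmissibleAt.symmetry`). Because the target jets agree as
well, Φ alone realizes any given point equivalence. The two equivalence relations are therefore
equal, and so are their classification lists. -/

/-! ## Directional derivatives of functions of `(t, x, u)` -/

/-- The derivative of `F` in the direction `v`. -/
noncomputable def dirDeriv (v : J0) (F : J0 → ℝ) (z : J0) : ℝ := fderiv ℝ F z v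

/-- `∂F/∂t`. -/
notation "dT" => dirDeriv ((1, 0, 0) : J0)

/-- `∂F/∂x`. -/
notation "dX" => dirDeriv ((0, 1, 0) : J0)

/-- `∂F/∂u`. -/
notation "dU" => dirDeriv ((0, 0, 1) : J0)

lemma infty_ne_zero : (∞ : WithTop ℕ∞) ≠ 0 := by simp

lemma ContDiffAt.dirDeriv {F : J0 → ℝ} {z : J0} (hF : ContDiffAt ℝ ∞ F z) (v : J0) :
    ContDiffAt ℝ ∞ (dirDeriv v F) z :=
  (hF.fderiv_right (m := ∞) (by norm_cast)).clm_apply contDiffAt_const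

lemma ContDiffAt.diffAt {E G : Type*} [NormedAddCommGroup E] [NormedSpace ℝ E]
    [NormedAddCommGroup G] [NormedSpace ℝ G] {F : E → G} {z : E}
    (hF : ContDiffAt ℝ ∞ F z) : DifferentiableAt ℝ F z :=
  hF.differentiableAt infty_ne_zero

lemma dirDeriv_dirDeriv {F : J0 → ℝ} {z : J0} (hF : ContDiffAt ℝ ∞ F z) (v w : J0) :
    dirDeriv v (dirDeriv w F) z = fderiv ℝ (fderiv ℝ F) z v w := by
  have h1 : DifferentiableAt ℝ (fderiv ℝ F) z :=
    (hF.fderiv_right (m := 1) (by norm_cast)).differentiableAt (by norm_num)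
  have h : dirDeriv w F = fun y => fderiv ℝ F y w := rfl
  rw [h]
  unfold dirDeriv
  rw [fderiv_clm_apply h1 (differentiableAt_const w)]
  simp

lemma dirDeriv_comm {F : J0 → ℝ} {z : J0} (hF : ContDiffAt ℝ ∞ F z) (v w : J0) :
    dirDeriv v (dirDeriv w F) z = dirDeriv w (dirDeriv v F) z := by
  rw [dirDeriv_dirDeriv hF, dirDeriv_dirDeriv hF]
  have : minSmoothness ℝ 2 ≤ (∞ : WithTop ℕ∞) := by
    simp only [minSmoothness_of_isRCLikeNormedField]
    norm_cast
  exact hF.isSymmSndFDerivAt this v w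

lemma dirDeriv_add_dir (F : J0 → ℝ) (z v w : J0) :
    dirDeriv (v + w) F z = dirDeriv v F z + dirDeriv w F z := map_add _ _ _

lemma dirDeriv_smul_dir (F : J0 → ℝ) (z v : J0) (c : ℝ) :
    dirDeriv (c • v) F z = c * dirDeriv v F z := by
  simp [dirDeriv]

lemma dirDeriv_coords (F : J0 → ℝ) (z : J0) (a b c : ℝ) :
    dirDeriv (a, b, c) F z = a * dT F z + b * dX F z + c * dU F z := by
  have : ((a, b, c) : J0) = a • (1, 0, 0) + b • (0, 1, 0) + c • (0, 0, 1) := by simp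
  rw [this, dirDeriv_add_dir, dirDeriv_add_dir, dirDeriv_smul_dir, dirDeriv_smul_dir,
    dirDeriv_smul_dir]

/-- The horizontal direction `∂_t + u_t ∂_u`. -/
def horT (j : J1) : J0 := (1, 0, j.2.1)

/-- The horizontal direction `∂_x + u_x ∂_u`. -/
def horX (j : J1) : J0 := (0, 1, j.2.2)

lemma totalT_eq (F : J0 → ℝ) (j : J1) : totalT F j = dT F j.1 + j.2.1 * dU F j.1 := by
  have := dirDeriv_coords F j.1 1 0 j.2.1
  simpa [totalT, dirDeriv] using this

lemma totalX_eq (F : J0 → ℝ) (j : J1) : totalX F j = dX F j.1 + j.2.2 * dU F j.1 := by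
  have := dirDeriv_coords F j.1 0 1 j.2.2
  simpa [totalX, dirDeriv] using this

/-- The Hessian of `F`. -/
noncomputable def hess (F : J0 → ℝ) (z v w : J0) : ℝ := fderiv ℝ (fderiv ℝ F) z v w

lemma hess_comm {F : J0 → ℝ} {z : J0} (hF : ContDiffAt ℝ ∞ F z) (v w : J0) :
    hess F z v w = hess F z w v := by
  have := dirDeriv_comm hF v w
  rwa [dirDeriv_dirDeriv hF, dirDeriv_dirDeriv hF] at this

lemma differentiableAt_fderiv {F : J0 → ℝ} {z : J0} (hF : ContDiffAt ℝ ∞ F z) :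
    DifferentiableAt ℝ (fderiv ℝ F) z :=
  (hF.fderiv_right (m := 1) (by norm_cast)).differentiableAt (by norm_num)

lemma fderiv_totalT {F : J0 → ℝ} {j : J1} (hF : ContDiffAt ℝ ∞ F j.1) (v : J0) (a b : ℝ) :
    fderiv ℝ (totalT F) j (v, (a, b)) = hess F j.1 v (horT j) + a * dU F j.1 := by
  have h2 : HasFDerivAt (fun j : J1 => fderiv ℝ F j.1)
      ((fderiv ℝ (fderiv ℝ F) j.1).comp (ContinuousLinearMap.fst ℝ J0 (ℝ × ℝ))) j :=
    (differentiableAt_fderiv hF).hasFDerivAt.comp j hasFDerivAt_fst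
  have h3 : HasFDerivAt (fun j : J1 => ((1, 0, j.2.1) : J0))
      (ContinuousLinearMap.prod 0 (ContinuousLinearMap.prod 0
        ((ContinuousLinearMap.fst ℝ ℝ ℝ).comp (ContinuousLinearMap.snd ℝ J0 (ℝ × ℝ))))) j :=
    (hasFDerivAt_const _ _).prodMk ((hasFDerivAt_const _ _).prodMk
      (hasFDerivAt_fst.comp j hasFDerivAt_snd))
  have h4 := (h2.clm_apply h3).fderiv
  have e : totalT F = fun j : J1 => fderiv ℝ F j.1 ((1, 0, j.2.1) : J0) := rfl
  rw [e, h4]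
  have := dirDeriv_coords F j.1 0 0 a
  simp only [dirDeriv] at this
  simp [hess, horT, this, dirDeriv]
  ring

lemma fderiv_totalX {F : J0 → ℝ} {j : J1} (hF : ContDiffAt ℝ ∞ F j.1) (v : J0) (a b : ℝ) :
    fderiv ℝ (totalX F) j (v, (a, b)) = hess F j.1 v (horX j) + b * dU F j.1 := by
  have h2 : HasFDerivAt (fun j : J1 => fderiv ℝ F j.1)
      ((fderiv ℝ (fderiv ℝ F) j.1).comp (ContinuousLinearMap.fst ℝ J0 (ℝ × ℝ))) j :=
    (differentiableAt_fderiv hF).hasFDerivAt.comp j hasFDerivAt_fst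
  have h3 : HasFDerivAt (fun j : J1 => ((0, 1, j.2.2) : J0))
      (ContinuousLinearMap.prod 0 (ContinuousLinearMap.prod 0
        ((ContinuousLinearMap.snd ℝ ℝ ℝ).comp (ContinuousLinearMap.snd ℝ J0 (ℝ × ℝ))))) j :=
    (hasFDerivAt_const _ _).prodMk ((hasFDerivAt_const _ _).prodMk
      (hasFDerivAt_snd.comp j hasFDerivAt_snd))
  have h4 := (h2.clm_apply h3).fderiv
  have e : totalX F = fun j : J1 => fderiv ℝ F j.1 ((0, 1, j.2.2) : J0) := rfl
  rw [e, h4]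
  have := dirDeriv_coords F j.1 0 0 b
  simp only [dirDeriv] at this
  simp [hess, horX, this, dirDeriv]
  ring

/-! ## The first prolongation and its derivatives -/

/-- Cramer's rule: the new slopes solve this 2 × 2 system, which says that dU − ũ_t̃ dT − ũ_x̃ dX
annihilates both horizontal directions. -/
lemma newUt_newUx_spec {φ : J0 → J0} {j : J1} (hJ : totalJac φ j ≠ 0) :
    totalT (compU φ) j = newUt φ j * totalT (compT φ) j + newUx φ j * totalT (compX φ) j ∧
      totalX (compU φ) j = newUt φ j * totalX (compT φ) j + newUx φ j * totalX (compX φ) j := by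
  unfold newUt newUx newDerivT newDerivX
  constructor <;> field_simp <;> unfold totalJac <;> ring

lemma differentiableAt_totalJac {φ : J0 → J0} {j : J1} (hφ : ContDiffAt ℝ ∞ φ j.1) :
    DifferentiableAt ℝ (totalJac φ) j := by
  obtain ⟨h1, h2, -⟩ := smooth_comps hφ
  have a1 := differentiableAt_totalT h1
  have a2 := differentiableAt_totalT h2
  have b1 := differentiableAt_totalX h1
  have b2 := differentiableAt_totalX h2
  unfold totalJac
  fun_prop

lemma DifferentiableAt.quotient {E : Type*} [NormedAddCommGroup E] [NormedSpace ℝ E]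
    {P Q : E → ℝ} {j : E} (hP : DifferentiableAt ℝ P j) (hQ : DifferentiableAt ℝ Q j)
    (h0 : Q j ≠ 0) : DifferentiableAt ℝ (fun j => P j / Q j) j := by
  simp only [div_eq_mul_inv]
  exact hP.mul (hQ.inv h0)

lemma differentiableAt_newUt {φ : J0 → J0} {j : J1} (hφ : ContDiffAt ℝ ∞ φ j.1)
    (hJ : totalJac φ j ≠ 0) : DifferentiableAt ℝ (newUt φ) j := by
  obtain ⟨h1, h2, h3⟩ := smooth_comps hφ
  have a2 := differentiableAt_totalT h2
  have a3 := differentiableAt_totalT h3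
  have b2 := differentiableAt_totalX h2
  have b3 := differentiableAt_totalX h3
  exact ((a3.mul b2).sub (b3.mul a2)).quotient (differentiableAt_totalJac hφ) hJ

lemma differentiableAt_newUx {φ : J0 → J0} {j : J1} (hφ : ContDiffAt ℝ ∞ φ j.1)
    (hJ : totalJac φ j ≠ 0) : DifferentiableAt ℝ (newUx φ) j := by
  obtain ⟨h1, h2, h3⟩ := smooth_comps hφ
  have a1 := differentiableAt_totalT h1
  have a3 := differentiableAt_totalT h3
  have b1 := differentiableAt_totalX h1
  have b3 := differentiableAt_totalX h3
  exact ((b3.mul a1).sub (a3.mul b1)).quotient (differentiableAt_totalJac hφ) hJ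

lemma hasDerivAt_line {E : Type*} [NormedAddCommGroup E] [NormedSpace ℝ E] {F : E → ℝ} {j : E}
    (hF : DifferentiableAt ℝ F j) (v : E) :
    HasDerivAt (fun s : ℝ => F (j + s • v)) (fderiv ℝ F j v) 0 := by
  have h1 : HasDerivAt (fun s : ℝ => j + s • v) v 0 := by
    simpa using ((hasDerivAt_id (0 : ℝ)).smul_const v).const_add j
  have h2 : HasFDerivAt F (fderiv ℝ F j) (j + (0 : ℝ) • v) := by simpa using hF.hasFDerivAt
  exact h2.comp_hasDerivAt 0 h1

/-- Restriction to a line reduces this to the one-variable quotient rule. The quotient itself is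
kept as a factor on the right, so that it can be read as `newUt` or `newUx` afterwards. -/
lemma fderiv_div_line {E : Type*} [NormedAddCommGroup E] [NormedSpace ℝ E] {P Q R S J : E → ℝ}
    {j : E} (hP : DifferentiableAt ℝ P j) (hQ : DifferentiableAt ℝ Q j)
    (hR : DifferentiableAt ℝ R j) (hS : DifferentiableAt ℝ S j) (hJ : DifferentiableAt ℝ J j)
    (h0 : J j ≠ 0) (v : E) :
    fderiv ℝ (fun j => (P j * Q j - R j * S j) / J j) j v =
      (fderiv ℝ P j v * Q j + P j * fderiv ℝ Q j v - fderiv ℝ R j v * S j - R j * fderiv ℝ S j v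
        - (P j * Q j - R j * S j) / J j * fderiv ℝ J j v) / J j := by
  have h1 := hasDerivAt_line
    (((hP.mul hQ).sub (hR.mul hS)).quotient hJ h0 : DifferentiableAt ℝ (fun j =>
      (P j * Q j - R j * S j) / J j) j) v
  have h2 := ((((hasDerivAt_line hP v).mul (hasDerivAt_line hQ v)).sub
    ((hasDerivAt_line hR v).mul (hasDerivAt_line hS v))).div (hasDerivAt_line hJ v)
      (by simpa using h0))
  refine (h1.unique h2).trans ?_
  simp
  field_simp
  ring

lemma fderiv_totalJac {φ : J0 → J0} {j : J1} (hφ : ContDiffAt ℝ ∞ φ j.1) (v : J1) :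
    fderiv ℝ (totalJac φ) j v =
      fderiv ℝ (totalT (compT φ)) j v * totalX (compX φ) j
      + totalT (compT φ) j * fderiv ℝ (totalX (compX φ)) j v
      - fderiv ℝ (totalX (compT φ)) j v * totalT (compX φ) j
      - totalX (compT φ) j * fderiv ℝ (totalT (compX φ)) j v := by
  obtain ⟨h1, h2, -⟩ := smooth_comps hφ
  have := fderiv_div_line (differentiableAt_totalT h1) (differentiableAt_totalX h2)
    (differentiableAt_totalX h1) (differentiableAt_totalT h2)
    (differentiableAt_const (1 : ℝ) : DifferentiableAt ℝ (fun _ : J1 => (1 : ℝ)) j) one_ne_zero v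
  simp only [div_one, fderiv_fun_const, Pi.zero_apply, zero_apply, mul_zero,
    sub_zero] at this
  exact this

/-- This is implicit differentiation of the system in `newUt_newUx_spec`: the right-hand sides are
derivatives of the total derivatives of U − ũ_t̃ T − ũ_x̃ X with the two slopes frozen. -/
lemma fderiv_newUt {φ : J0 → J0} {j : J1} (hφ : ContDiffAt ℝ ∞ φ j.1) (hJ : totalJac φ j ≠ 0)
    (v : J1) :
    fderiv ℝ (newUt φ) j v =
      (totalX (compX φ) j * (fderiv ℝ (totalT (compU φ)) j v
          - newUt φ j * fderiv ℝ (totalT (compT φ)) j v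
          - newUx φ j * fderiv ℝ (totalT (compX φ)) j v)
        - totalT (compX φ) j * (fderiv ℝ (totalX (compU φ)) j v
          - newUt φ j * fderiv ℝ (totalX (compT φ)) j v
          - newUx φ j * fderiv ℝ (totalX (compX φ)) j v)) / totalJac φ j := by
  obtain ⟨h1, h2, h3⟩ := smooth_comps hφ
  have := fderiv_div_line (differentiableAt_totalT h3) (differentiableAt_totalX h2)
    (differentiableAt_totalX h3) (differentiableAt_totalT h2) (differentiableAt_totalJac hφ) hJ v
  obtain ⟨s1, s2⟩ := newUt_newUx_spec hJ
  have e' : (totalT (compU φ) j * totalX (compX φ) j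
      - totalX (compU φ) j * totalT (compX φ) j) / totalJac φ j = newUt φ j := rfl
  rw [e', fderiv_totalJac hφ, s1, s2] at this
  refine Eq.trans this ?_
  congr 1
  ring

lemma fderiv_newUx {φ : J0 → J0} {j : J1} (hφ : ContDiffAt ℝ ∞ φ j.1) (hJ : totalJac φ j ≠ 0)
    (v : J1) :
    fderiv ℝ (newUx φ) j v =
      (totalT (compT φ) j * (fderiv ℝ (totalX (compU φ)) j v
          - newUt φ j * fderiv ℝ (totalX (compT φ)) j v
          - newUx φ j * fderiv ℝ (totalX (compX φ)) j v)
        - totalX (compT φ) j * (fderiv ℝ (totalT (compU φ)) j v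
          - newUt φ j * fderiv ℝ (totalT (compT φ)) j v
          - newUx φ j * fderiv ℝ (totalT (compX φ)) j v)) / totalJac φ j := by
  obtain ⟨h1, h2, h3⟩ := smooth_comps hφ
  have := fderiv_div_line (differentiableAt_totalX h3) (differentiableAt_totalT h1)
    (differentiableAt_totalT h3) (differentiableAt_totalX h1) (differentiableAt_totalJac hφ) hJ v
  obtain ⟨s1, s2⟩ := newUt_newUx_spec hJ
  have e' : (totalX (compU φ) j * totalT (compT φ) j
      - totalT (compU φ) j * totalX (compT φ) j) / totalJac φ j = newUx φ j := rfl
  rw [e', fderiv_totalJac hφ, s1, s2] at this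
  refine Eq.trans this ?_
  congr 1
  ring

/-! ## The second prolongation -/

/-- The factor `U_u - ũ_t̃ T_u - ũ_x̃ X_u`. -/
noncomputable def contactFactor (φ : J0 → J0) (j : J1) : ℝ :=
  dU (compU φ) j.1 - newUt φ j * dU (compT φ) j.1 - newUx φ j * dU (compX φ) j.1

/-- The Hessian of `U - ũ_t̃ T - ũ_x̃ X` with `ũ_t̃`, `ũ_x̃` kept fixed. -/
noncomputable def contactHess (φ : J0 → J0) (j : J1) (v w : J0) : ℝ :=
  hess (compU φ) j.1 v w - newUt φ j * hess (compT φ) j.1 v w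
    - newUx φ j * hess (compX φ) j.1 v w

noncomputable def contactTT (φ : J0 → J0) (k : J2) : ℝ :=
  contactHess φ k.1 (horT k.1) (horT k.1) + k.2.1 * contactFactor φ k.1

noncomputable def contactTX (φ : J0 → J0) (k : J2) : ℝ :=
  contactHess φ k.1 (horT k.1) (horX k.1) + k.2.2.1 * contactFactor φ k.1

noncomputable def contactXX (φ : J0 → J0) (k : J2) : ℝ :=
  contactHess φ k.1 (horX k.1) (horX k.1) + k.2.2.2 * contactFactor φ k.1

lemma contactHess_comm {φ : J0 → J0} {j : J1} (hφ : ContDiffAt ℝ ∞ φ j.1) (v w : J0) :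
    contactHess φ j v w = contactHess φ j w v := by
  obtain ⟨h1, h2, h3⟩ := smooth_comps hφ
  unfold contactHess
  rw [hess_comm h1, hess_comm h2, hess_comm h3]

lemma total_newU {φ : J0 → J0} {k : J2} (hφ : ContDiffAt ℝ ∞ φ k.1.1)
    (hJ : totalJac φ k.1 ≠ 0) :
    (totalT' (newUt φ) k = (totalX (compX φ) k.1 * contactTT φ k
      - totalT (compX φ) k.1 * contactTX φ k) / totalJac φ k.1 ∧
    totalX' (newUt φ) k = (totalX (compX φ) k.1 * contactTX φ k
      - totalT (compX φ) k.1 * contactXX φ k) / totalJac φ k.1) ∧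
    totalT' (newUx φ) k = (totalT (compT φ) k.1 * contactTX φ k
      - totalX (compT φ) k.1 * contactTT φ k) / totalJac φ k.1 ∧
    totalX' (newUx φ) k = (totalT (compT φ) k.1 * contactXX φ k
      - totalX (compT φ) k.1 * contactTX φ k) / totalJac φ k.1 := by
  obtain ⟨h1, h2, h3⟩ := smooth_comps hφ
  have e1 : ((1, 0, k.1.2.1) : J0) = horT k.1 := rfl
  have e2 : ((0, 1, k.1.2.2) : J0) = horX k.1 := rfl
  -- The mixed entry arises in both orders of differentiation; symmetry of the Hessian merges them
  -- into `contactTX`.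
  have c := contactHess_comm hφ (horX k.1) (horT k.1)
  unfold totalT' totalX'
  simp only [fderiv_newUt hφ hJ, fderiv_newUx hφ hJ, e1, e2, fderiv_totalT h1, fderiv_totalT h2,
    fderiv_totalT h3, fderiv_totalX h1, fderiv_totalX h2, fderiv_totalX h3]
  unfold contactTT contactTX contactXX
  unfold contactHess at c ⊢
  unfold contactFactor
  refine ⟨⟨?_, ?_⟩, ?_, ?_⟩ <;> congr 1
  · ring
  · linear_combination totalX (compX φ) k.1 * c
  · ring
  · linear_combination - totalX (compT φ) k.1 * c

lemma prolong2_tt {φ : J0 → J0} {k : J2} (hφ : ContDiffAt ℝ ∞ φ k.1.1)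
    (hJ : totalJac φ k.1 ≠ 0) :
    (prolong2 φ k).2.1 = (totalX (compX φ) k.1 ^ 2 * contactTT φ k
      - 2 * totalX (compX φ) k.1 * totalT (compX φ) k.1 * contactTX φ k
      + totalT (compX φ) k.1 ^ 2 * contactXX φ k) / totalJac φ k.1 ^ 2 := by
  obtain ⟨⟨h1, h2⟩, -⟩ := total_newU hφ hJ
  simp only [prolong2, newDerivT, h1, h2]
  field_simp
  ring

/-- `prolong2` computes the mixed derivative from ũ_t̃; computing it from ũ_x̃ gives the same result
because the matrix of `contactTT`, `contactTX`, `contactXX` is symmetric. The composition law needs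
both readings. -/
lemma prolong2_tx {φ : J0 → J0} {k : J2} (hφ : ContDiffAt ℝ ∞ φ k.1.1)
    (hJ : totalJac φ k.1 ≠ 0) :
    (prolong2 φ k).2.2.1 = newDerivT φ k.1 (totalT' (newUx φ) k) (totalX' (newUx φ) k) := by
  obtain ⟨⟨h1, h2⟩, h3, h4⟩ := total_newU hφ hJ
  simp only [prolong2, newDerivT, newDerivX, h1, h2, h3, h4]
  field_simp
  ring

lemma prolong2_xx {φ : J0 → J0} {k : J2} (hφ : ContDiffAt ℝ ∞ φ k.1.1)
    (hJ : totalJac φ k.1 ≠ 0) :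
    (prolong2 φ k).2.2.2 = (totalX (compT φ) k.1 ^ 2 * contactTT φ k
      - 2 * totalX (compT φ) k.1 * totalT (compT φ) k.1 * contactTX φ k
      + totalT (compT φ) k.1 ^ 2 * contactXX φ k) / totalJac φ k.1 ^ 2 := by
  obtain ⟨-, h1, h2⟩ := total_newU hφ hJ
  simp only [prolong2, newDerivX, h1, h2]
  field_simp
  ring

/-- The covector dU − ũ_t̃ dT − ũ_x̃ dX kills both horizontal directions. If it also killed ∂_u it
would vanish, yet it equals 1 on a vector that dφ sends to (0, 0, 1). -/
lemma contactFactor_ne_zero {φ : J0 → J0} {j : J1} (hφ : ContDiffAt ℝ ∞ φ j.1)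
    (hsurj : Function.Surjective (fderiv ℝ φ j.1)) (hJ : totalJac φ j ≠ 0) :
    contactFactor φ j ≠ 0 := by
  intro h0
  have hd := hφ.differentiableAt infty_ne_zero
  have cT : ∀ v, dirDeriv v (compT φ) j.1 = (fderiv ℝ φ j.1 v).1 := fun v => by
    have : HasFDerivAt (compT φ) _ j.1 := hasFDerivAt_fst.comp j.1 hd.hasFDerivAt
    simp [dirDeriv, this.fderiv]
  have cX : ∀ v, dirDeriv v (compX φ) j.1 = (fderiv ℝ φ j.1 v).2.1 := fun v => by
    have : HasFDerivAt (compX φ) _ j.1 :=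
      (hasFDerivAt_fst.comp (φ j.1) hasFDerivAt_snd).comp j.1 hd.hasFDerivAt
    simp [dirDeriv, this.fderiv]
  have cU : ∀ v, dirDeriv v (compU φ) j.1 = (fderiv ℝ φ j.1 v).2.2 := fun v => by
    have : HasFDerivAt (compU φ) _ j.1 :=
      (hasFDerivAt_snd.comp (φ j.1) hasFDerivAt_snd).comp j.1 hd.hasFDerivAt
    simp [dirDeriv, this.fderiv]
  obtain ⟨⟨a, b, c⟩, hv⟩ := hsurj (0, 0, 1)
  have k1 := cT (a, b, c)
  have k2 := cX (a, b, c)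
  have k3 := cU (a, b, c)
  rw [hv, dirDeriv_coords] at k1 k2 k3
  simp only at k1 k2 k3
  obtain ⟨s1, s2⟩ := newUt_newUx_spec hJ
  simp only [totalT_eq, totalX_eq] at s1 s2
  unfold contactFactor at h0
  have : (1 : ℝ) = 0 := by
    linear_combination (-1 : ℝ) * k3 + newUt φ j * k1 + newUx φ j * k2 + a * s1 + b * s2
      + (c - a * j.2.1 - b * j.2.2) * h0
  exact one_ne_zero this

/-! ## Functoriality of the prolongation -/

lemma fderiv_comps {φ : J0 → J0} {z : J0} (hφ : DifferentiableAt ℝ φ z) (v : J0) :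
    fderiv ℝ φ z v = (dirDeriv v (compT φ) z, dirDeriv v (compX φ) z, dirDeriv v (compU φ) z) := by
  have h1 : HasFDerivAt (compT φ) _ z := hasFDerivAt_fst.comp z hφ.hasFDerivAt
  have h2 : HasFDerivAt (compX φ) _ z :=
    (hasFDerivAt_fst.comp (φ z) hasFDerivAt_snd).comp z hφ.hasFDerivAt
  have h3 : HasFDerivAt (compU φ) _ z :=
    (hasFDerivAt_snd.comp (φ z) hasFDerivAt_snd).comp z hφ.hasFDerivAt
  simp [dirDeriv, h1.fderiv, h2.fderiv, h3.fderiv]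

/-- A prolonged map respects contact planes: dφ sends the horizontal plane of a jet into that of the
image jet. This and `fderiv_horX` turn the chain rule into a rule for total derivatives. -/
lemma fderiv_horT {φ : J0 → J0} {j : J1} (hφ : DifferentiableAt ℝ φ j.1)
    (hJ : totalJac φ j ≠ 0) :
    fderiv ℝ φ j.1 (horT j) = totalT (compT φ) j • horT (prolong1 φ j)
      + totalT (compX φ) j • horX (prolong1 φ j) := by
  rw [fderiv_comps hφ]
  have := (newUt_newUx_spec hJ).1
  ext
  · simp [horT, horX, totalT, dirDeriv]
  · simp [horT, horX, totalT, dirDeriv]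
  · simp only [horT, horX, prolong1, Prod.smul_mk, Prod.mk_add_mk, smul_eq_mul]
    change totalT (compU φ) j = _
    rw [this]; ring

lemma fderiv_horX {φ : J0 → J0} {j : J1} (hφ : DifferentiableAt ℝ φ j.1)
    (hJ : totalJac φ j ≠ 0) :
    fderiv ℝ φ j.1 (horX j) = totalX (compT φ) j • horT (prolong1 φ j)
      + totalX (compX φ) j • horX (prolong1 φ j) := by
  rw [fderiv_comps hφ]
  have := (newUt_newUx_spec hJ).2
  ext
  · simp [horT, horX, totalX, dirDeriv]
  · simp [horT, horX, totalX, dirDeriv]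
  · simp only [horT, horX, prolong1, Prod.smul_mk, Prod.mk_add_mk, smul_eq_mul]
    change totalX (compU φ) j = _
    rw [this]; ring

lemma total_comp {F : J0 → ℝ} {φ : J0 → J0} {j : J1} (hF : DifferentiableAt ℝ F (φ j.1))
    (hφ : DifferentiableAt ℝ φ j.1) (hJ : totalJac φ j ≠ 0) :
    totalT (F ∘ φ) j = totalT (compT φ) j * totalT F (prolong1 φ j)
        + totalT (compX φ) j * totalX F (prolong1 φ j) ∧
      totalX (F ∘ φ) j = totalX (compT φ) j * totalT F (prolong1 φ j)
        + totalX (compX φ) j * totalX F (prolong1 φ j) := by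
  constructor
  · change fderiv ℝ (F ∘ φ) j.1 (horT j) = _
    rw [fderiv_comp j.1 hF hφ, ContinuousLinearMap.comp_apply, fderiv_horT hφ hJ, map_add,
      map_smul, map_smul]
    rfl
  · change fderiv ℝ (F ∘ φ) j.1 (horX j) = _
    rw [fderiv_comp j.1 hF hφ, ContinuousLinearMap.comp_apply, fderiv_horX hφ hJ, map_add,
      map_smul, map_smul]
    rfl

section Composition

variable {φ ψ : J0 → J0} {j : J1}

lemma totalJac_comp (hφ : ContDiffAt ℝ ∞ φ j.1) (hψ : ContDiffAt ℝ ∞ ψ (φ j.1))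
    (hJ : totalJac φ j ≠ 0) :
    totalJac (ψ ∘ φ) j = totalJac ψ (prolong1 φ j) * totalJac φ j := by
  obtain ⟨h1, h2, -⟩ := smooth_comps hψ
  obtain ⟨t1, t2⟩ := total_comp h1.diffAt hφ.diffAt hJ
  obtain ⟨x1, x2⟩ := total_comp h2.diffAt hφ.diffAt hJ
  change totalT (compT ψ ∘ φ) j * totalX (compX ψ ∘ φ) j
    - totalX (compT ψ ∘ φ) j * totalT (compX ψ ∘ φ) j = _
  rw [t1, t2, x1, x2]
  unfold totalJac
  ring

/-- The new derivatives invert a total Jacobian matrix; for ψ ∘ φ that matrix is a product, and the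
factor belonging to φ cancels. -/
lemma newDeriv_comp (hφ : ContDiffAt ℝ ∞ φ j.1) (hψ : ContDiffAt ℝ ∞ ψ (φ j.1))
    (hJ : totalJac φ j ≠ 0) (a b : ℝ) :
    newDerivT (ψ ∘ φ) j (totalT (compT φ) j * a + totalT (compX φ) j * b)
        (totalX (compT φ) j * a + totalX (compX φ) j * b) = newDerivT ψ (prolong1 φ j) a b ∧
      newDerivX (ψ ∘ φ) j (totalT (compT φ) j * a + totalT (compX φ) j * b)
        (totalX (compT φ) j * a + totalX (compX φ) j * b) = newDerivX ψ (prolong1 φ j) a b := by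
  obtain ⟨h1, h2, -⟩ := smooth_comps hψ
  obtain ⟨t1, t2⟩ := total_comp h1.diffAt hφ.diffAt hJ
  obtain ⟨x1, x2⟩ := total_comp h2.diffAt hφ.diffAt hJ
  unfold newDerivT newDerivX
  rw [totalJac_comp hφ hψ hJ]
  change (_ * totalX (compX ψ ∘ φ) j - _ * totalT (compX ψ ∘ φ) j) / _ = _ ∧
    (_ * totalT (compT ψ ∘ φ) j - _ * totalX (compT ψ ∘ φ) j) / _ = _
  rw [t1, t2, x1, x2]
  constructor
  · rw [mul_comm (totalJac ψ _), ← div_div]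
    congr 1
    rw [div_eq_iff hJ]
    unfold totalJac
    ring
  · rw [mul_comm (totalJac ψ _), ← div_div]
    congr 1
    rw [div_eq_iff hJ]
    unfold totalJac
    ring

lemma newU_comp (hφ : ContDiffAt ℝ ∞ φ j.1) (hψ : ContDiffAt ℝ ∞ ψ (φ j.1))
    (hJ : totalJac φ j ≠ 0) :
    newUt (ψ ∘ φ) j = newUt ψ (prolong1 φ j) ∧ newUx (ψ ∘ φ) j = newUx ψ (prolong1 φ j) := by
  obtain ⟨-, -, h3⟩ := smooth_comps hψ
  obtain ⟨u1, u2⟩ := total_comp h3.diffAt hφ.diffAt hJ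
  have := newDeriv_comp hφ hψ hJ (totalT (compU ψ) (prolong1 φ j))
    (totalX (compU ψ) (prolong1 φ j))
  rw [← u1, ← u2] at this
  exact this

lemma prolong1_comp (hφ : ContDiffAt ℝ ∞ φ j.1) (hψ : ContDiffAt ℝ ∞ ψ (φ j.1))
    (hJ : totalJac φ j ≠ 0) :
    prolong1 (ψ ∘ φ) j = prolong1 ψ (prolong1 φ j) := by
  obtain ⟨h1, h2⟩ := newU_comp hφ hψ hJ
  simp only [prolong1] at h1 h2 ⊢
  rw [h1, h2]
  rfl

lemma differentiableAt_prolong1 (hφ : ContDiffAt ℝ ∞ φ j.1) (hJ : totalJac φ j ≠ 0) :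
    DifferentiableAt ℝ (prolong1 φ) j := by
  have h1 : DifferentiableAt ℝ (fun j : J1 => φ j.1) j :=
    DifferentiableAt.comp (g := φ) j hφ.diffAt differentiableAt_fst
  exact h1.prodMk ((differentiableAt_newUt hφ hJ).prodMk (differentiableAt_newUx hφ hJ))

lemma fderiv_prolong1 (hφ : ContDiffAt ℝ ∞ φ j.1) (hJ : totalJac φ j ≠ 0) (v : J1) :
    fderiv ℝ (prolong1 φ) j v =
      (fderiv ℝ φ j.1 v.1, (fderiv ℝ (newUt φ) j v, fderiv ℝ (newUx φ) j v)) := by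
  have h1 : HasFDerivAt (fun j : J1 => φ j.1) _ j :=
    hφ.diffAt.hasFDerivAt.comp j hasFDerivAt_fst
  have := h1.prodMk ((differentiableAt_newUt hφ hJ).hasFDerivAt.prodMk
    (differentiableAt_newUx hφ hJ).hasFDerivAt)
  have e : HasFDerivAt (prolong1 φ) _ j := this
  rw [e.fderiv]
  simp

/-- One order higher, the differential of `prolong1` sends horizontal vectors at a second-order jet
to combinations of those at the image jet; `prolong2_tx` makes the mixed components match. -/
lemma total_comp' {G : J1 → ℝ} {k : J2} (hφ : ContDiffAt ℝ ∞ φ k.1.1)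
    (hJ : totalJac φ k.1 ≠ 0) (hG : DifferentiableAt ℝ G (prolong1 φ k.1)) :
    totalT' (G ∘ prolong1 φ) k = totalT (compT φ) k.1 * totalT' G (prolong2 φ k)
        + totalT (compX φ) k.1 * totalX' G (prolong2 φ k) ∧
      totalX' (G ∘ prolong1 φ) k = totalX (compT φ) k.1 * totalT' G (prolong2 φ k)
        + totalX (compX φ) k.1 * totalX' G (prolong2 φ k) := by
  have hp := differentiableAt_prolong1 hφ hJ
  have htx := prolong2_tx hφ hJ
  have s : ∀ a b : ℝ, a = totalT (compT φ) k.1 * newDerivT φ k.1 a b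
      + totalT (compX φ) k.1 * newDerivX φ k.1 a b ∧
      b = totalX (compT φ) k.1 * newDerivT φ k.1 a b
      + totalX (compX φ) k.1 * newDerivX φ k.1 a b := by
    intro a b
    unfold newDerivT newDerivX
    constructor <;> field_simp <;> unfold totalJac <;> ring
  have hT : fderiv ℝ (prolong1 φ) k.1 (horT k.1, (k.2.1, k.2.2.1)) =
      totalT (compT φ) k.1 • (horT (prolong1 φ k.1), ((prolong2 φ k).2.1, (prolong2 φ k).2.2.1))
      + totalT (compX φ) k.1 •
        (horX (prolong1 φ k.1), ((prolong2 φ k).2.2.1, (prolong2 φ k).2.2.2)) := by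
    rw [fderiv_prolong1 hφ hJ, fderiv_horT hφ.diffAt hJ]
    ext1
    · simp
    ext1
    · exact (s (totalT' (newUt φ) k) (totalX' (newUt φ) k)).1
    · have := (s (totalT' (newUx φ) k) (totalX' (newUx φ) k)).1
      rw [← htx] at this
      exact this
  have hX : fderiv ℝ (prolong1 φ) k.1 (horX k.1, (k.2.2.1, k.2.2.2)) =
      totalX (compT φ) k.1 • (horT (prolong1 φ k.1), ((prolong2 φ k).2.1, (prolong2 φ k).2.2.1))
      + totalX (compX φ) k.1 •
        (horX (prolong1 φ k.1), ((prolong2 φ k).2.2.1, (prolong2 φ k).2.2.2)) := by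
    rw [fderiv_prolong1 hφ hJ, fderiv_horX hφ.diffAt hJ]
    ext1
    · simp
    ext1
    · exact (s (totalT' (newUt φ) k) (totalX' (newUt φ) k)).2
    · have := (s (totalT' (newUx φ) k) (totalX' (newUx φ) k)).2
      rw [← htx] at this
      exact this
  constructor
  · change fderiv ℝ (G ∘ prolong1 φ) k.1 (horT k.1, (k.2.1, k.2.2.1)) = _
    rw [fderiv_comp k.1 hG hp, ContinuousLinearMap.comp_apply, hT, map_add, map_smul, map_smul]
    rfl
  · change fderiv ℝ (G ∘ prolong1 φ) k.1 (horX k.1, (k.2.2.1, k.2.2.2)) = _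
    rw [fderiv_comp k.1 hG hp, ContinuousLinearMap.comp_apply, hX, map_add, map_smul, map_smul]
    rfl

lemma prolong2_comp {k : J2} (hφ : ∀ᶠ z in 𝓝 k.1.1, ContDiffAt ℝ ∞ φ z)
    (hψ : ∀ᶠ z in 𝓝 (φ k.1.1), ContDiffAt ℝ ∞ ψ z)
    (hJ : totalJac φ k.1 ≠ 0) (hJ' : totalJac ψ (prolong1 φ k.1) ≠ 0) :
    prolong2 (ψ ∘ φ) k = prolong2 ψ (prolong2 φ k) := by
  have hφ0 := hφ.self_of_nhds
  have hψ0 := hψ.self_of_nhds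
  have c1 : ContinuousAt (fun j : J1 => j.1) k.1 := continuousAt_fst
  have e1 := c1.eventually hφ
  have c2 : ContinuousAt (fun j : J1 => φ j.1) k.1 :=
    ContinuousAt.comp (g := φ) hφ0.continuousAt c1
  have e2 := c2.eventually hψ
  have e3 := (differentiableAt_totalJac hφ0).continuousAt.eventually_ne hJ
  have et : newUt (ψ ∘ φ) =ᶠ[𝓝 k.1] newUt ψ ∘ prolong1 φ := by
    filter_upwards [e1, e2, e3] with j h1 h2 h3 using (newU_comp h1 h2 h3).1
  have ex : newUx (ψ ∘ φ) =ᶠ[𝓝 k.1] newUx ψ ∘ prolong1 φ := by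
    filter_upwards [e1, e2, e3] with j h1 h2 h3 using (newU_comp h1 h2 h3).2
  have t := total_comp' hφ0 hJ (differentiableAt_newUt (j := prolong1 φ k.1) hψ0 hJ')
  have x := total_comp' hφ0 hJ (differentiableAt_newUx (j := prolong1 φ k.1) hψ0 hJ')
  have nt := newDeriv_comp hφ0 hψ0 hJ
    (totalT' (newUt ψ) (prolong2 φ k)) (totalX' (newUt ψ) (prolong2 φ k))
  have nx := newDeriv_comp hφ0 hψ0 hJ
    (totalT' (newUx ψ) (prolong2 φ k)) (totalX' (newUx ψ) (prolong2 φ k))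
  rw [← t.1, ← t.2] at nt
  rw [← x.1, ← x.2] at nx
  unfold prolong2
  rw [prolong1_comp hφ0 hψ0 hJ]
  unfold totalT' totalX' at nt nx ⊢
  rw [et.fderiv_eq, ex.fderiv_eq, nt.1, nt.2, nx.2]
  rfl

lemma total_congr (h : φ =ᶠ[𝓝 j.1] ψ) :
    (totalT (compT φ) j = totalT (compT ψ) j ∧ totalT (compX φ) j = totalT (compX ψ) j ∧
      totalT (compU φ) j = totalT (compU ψ) j) ∧
    totalX (compT φ) j = totalX (compT ψ) j ∧ totalX (compX φ) j = totalX (compX ψ) j ∧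
      totalX (compU φ) j = totalX (compU ψ) j := by
  have h1 : compT φ =ᶠ[𝓝 j.1] compT ψ := h.mono fun z hz => by simp [compT, hz]
  have h2 : compX φ =ᶠ[𝓝 j.1] compX ψ := h.mono fun z hz => by simp [compX, hz]
  have h3 : compU φ =ᶠ[𝓝 j.1] compU ψ := h.mono fun z hz => by simp [compU, hz]
  unfold totalT totalX
  rw [h1.fderiv_eq, h2.fderiv_eq, h3.fderiv_eq]
  simp

lemma totalJac_congr (h : φ =ᶠ[𝓝 j.1] ψ) : totalJac φ j = totalJac ψ j := by
  obtain ⟨⟨t1, t2, -⟩, x1, x2, -⟩ := total_congr h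
  unfold totalJac
  rw [t1, t2, x1, x2]

lemma newDeriv_congr (h : φ =ᶠ[𝓝 j.1] ψ) (a b : ℝ) :
    newDerivT φ j a b = newDerivT ψ j a b ∧ newDerivX φ j a b = newDerivX ψ j a b := by
  obtain ⟨⟨t1, t2, -⟩, x1, x2, -⟩ := total_congr h
  unfold newDerivT newDerivX
  rw [t1, t2, x1, x2, totalJac_congr h]
  simp

lemma newU_congr (h : φ =ᶠ[𝓝 j.1] ψ) : newUt φ j = newUt ψ j ∧ newUx φ j = newUx ψ j := by
  obtain ⟨⟨-, -, t3⟩, -, -, x3⟩ := total_congr h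
  unfold newUt newUx
  rw [t3, x3, (newDeriv_congr h _ _).1, (newDeriv_congr h _ _).2]
  simp

lemma prolong1_congr (h : φ =ᶠ[𝓝 j.1] ψ) : prolong1 φ j = prolong1 ψ j := by
  unfold prolong1
  rw [(newU_congr h).1, (newU_congr h).2, h.self_of_nhds]

lemma prolong2_congr {k : J2} (h : φ =ᶠ[𝓝 k.1.1] ψ) : prolong2 φ k = prolong2 ψ k := by
  have c1 : Filter.Tendsto (fun j : J1 => j.1) (𝓝 k.1) (𝓝 k.1.1) := continuousAt_fst
  have e := c1.eventually h.eventually_nhds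
  have et : newUt φ =ᶠ[𝓝 k.1] newUt ψ := e.mono fun j hj => (newU_congr hj).1
  have ex : newUx φ =ᶠ[𝓝 k.1] newUx ψ := e.mono fun j hj => (newU_congr hj).2
  unfold prolong2 totalT' totalX'
  rw [prolong1_congr h, et.fderiv_eq, ex.fderiv_eq, (newDeriv_congr h _ _).1,
    (newDeriv_congr h _ _).2, (newDeriv_congr h _ _).2]

end Composition

/-! ## Point transformations -/

lemma PointTransformation.contDiffAt {E : Type} [NormedAddCommGroup E] [NormedSpace ℝ E]
    (φ : PointTransformation E) {z : E} (hz : z ∈ φ.source) : ContDiffAt ℝ ∞ φ.toFun z :=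
  φ.smooth_toFun.contDiffAt (φ.open_source.mem_nhds hz)

lemma PointTransformation.fderiv_surjective {E : Type} [NormedAddCommGroup E] [NormedSpace ℝ E]
    (φ : PointTransformation E) {z : E} (hz : z ∈ φ.source) :
    Function.Surjective (fderiv ℝ φ.toFun z) := by
  have hw : φ.toFun z ∈ φ.target := φ.map_source' hz
  have h1 : DifferentiableAt ℝ φ.toFun z := (φ.contDiffAt hz).differentiableAt infty_ne_zero
  have h2 : DifferentiableAt ℝ φ.invFun (φ.toFun z) :=
    (φ.inverse.contDiffAt hw).differentiableAt infty_ne_zero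
  have e : φ.invFun (φ.toFun z) = z := φ.left_inv' hz
  have h3 : DifferentiableAt ℝ φ.toFun (φ.invFun (φ.toFun z)) := by rwa [e]
  have h4 : φ.toFun ∘ φ.invFun =ᶠ[𝓝 (φ.toFun z)] id := by
    filter_upwards [φ.open_target.mem_nhds hw] with y hy using φ.right_inv' hy
  have h5 := h4.fderiv_eq (𝕜 := ℝ)
  rw [fderiv_comp _ h3 h2, fderiv_id, e] at h5
  intro v
  exact ⟨fderiv ℝ φ.invFun (φ.toFun z) v, by
    rw [← ContinuousLinearMap.comp_apply, h5]; rfl⟩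

/-! ## Determining equations for admissible transformations -/

/-- The determining equations for an admissible transformation `φ` between the equations with
arbitrary elements `θ` and `θ'`, at the first-order jet `j`. -/
structure DeterminingEqs (θ θ' : ArbElem) (φ : PointTransformation J0) (j : J1) : Prop where
  mem_source : j.1 ∈ φ.source
  mem_dom : jetArg j ∈ θ.dom
  mem_dom' : jetArg (prolong1 φ.toFun j) ∈ θ'.dom
  jac : totalJac φ.toFun j ≠ 0
  eq1 : totalX (compX φ.toFun) j * totalT (compX φ.toFun) j
    = θ'.f (jetArg (prolong1 φ.toFun j)) * totalT (compT φ.toFun) j * totalX (compT φ.toFun) j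
  eq2 : totalT (compT φ.toFun) j * totalT (compX φ.toFun) j
    = θ.f (jetArg j) * totalX (compT φ.toFun) j * totalX (compX φ.toFun) j
  eq3 : totalT (compX φ.toFun) j ^ 2
    = θ.f (jetArg j) * θ'.f (jetArg (prolong1 φ.toFun j)) * totalX (compT φ.toFun) j ^ 2
  eq4 : θ'.f (jetArg (prolong1 φ.toFun j)) * totalT (compT φ.toFun) j ^ 2
    = θ.f (jetArg j) * totalX (compX φ.toFun) j ^ 2
  eq5 : (totalX (compX φ.toFun) j ^ 2
      - θ'.f (jetArg (prolong1 φ.toFun j)) * totalX (compT φ.toFun) j ^ 2)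
    * (contactFactor φ.toFun j * θ.g (jetArg j) + contactHess φ.toFun j (horT j) (horT j)
      - θ.f (jetArg j) * contactHess φ.toFun j (horX j) (horX j))
    = totalJac φ.toFun j ^ 2 * θ'.g (jetArg (prolong1 φ.toFun j))

/-- Two coefficient equations yield four relations thanks to invertibility. The Jacobian times AC −
fBD is a combination of the two equations; after that, f'A² − fD² is annihilated by both A and B,
which cannot vanish together. -/
lemma symbol_relations {A B C D f f' Δ : ℝ} (hJ : A * D - B * C ≠ 0) (hΔ : Δ ≠ 0)
    (hb : Δ * (D * C - f' * A * B) = 0)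
    (hc : Δ * (D ^ 2 * f + C ^ 2 - f' * (B ^ 2 * f + A ^ 2)) = 0) :
    D * C = f' * A * B ∧ A * C = f * B * D ∧ C ^ 2 = f * f' * B ^ 2 ∧ f' * A ^ 2 = f * D ^ 2 := by
  have e1 : D * C - f' * A * B = 0 := (mul_eq_zero.mp hb).resolve_left hΔ
  have e2 : D ^ 2 * f + C ^ 2 - f' * (B ^ 2 * f + A ^ 2) = 0 := (mul_eq_zero.mp hc).resolve_left hΔ
  have w : (A * D - B * C) * (A * C - f * B * D) = 0 := by
    linear_combination (A ^ 2 + f * B ^ 2) * e1 - A * B * e2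
  have w0 : A * C - f * B * D = 0 := (mul_eq_zero.mp w).resolve_left hJ
  have k1 : B * (f' * A ^ 2 - f * D ^ 2) = 0 := by linear_combination D * w0 - A * e1
  have k2 : A * (f' * A ^ 2 - f * D ^ 2) = 0 := by
    linear_combination C * w0 + f * B * e1 - A * e2
  have k0 : f' * A ^ 2 - f * D ^ 2 = 0 := by
    by_contra h
    apply hJ
    rw [(mul_eq_zero.mp k1).resolve_right h, (mul_eq_zero.mp k2).resolve_right h]
    ring
  refine ⟨by linear_combination e1, by linear_combination w0, ?_, by linear_combination k0⟩
  linear_combination e2 + k0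

/-- `nearJet` leaves the second derivatives unrestricted, so any values may be substituted for them.
-/
lemma tendsto_nearJet {j : J1} {p : J2 → Prop} (h : ∀ᶠ k in nearJet j, p k) :
    ∀ᶠ j' in 𝓝 j, ∀ s, p (j', s) := by
  obtain ⟨S, hS, hp⟩ := Filter.mem_comap.mp h
  filter_upwards [hS] with j' hj' s
  exact hp (show (j', s).1 ∈ S from hj')

lemma ArbElem.contDiffAt_f (θ : ArbElem) {b : ℝ × ℝ} (hb : b ∈ θ.dom) : ContDiffAt ℝ ∞ θ.f b :=
  θ.smooth_f.contDiffAt (θ.isOpen_dom.mem_nhds hb)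

lemma ArbElem.contDiffAt_g (θ : ArbElem) {b : ℝ × ℝ} (hb : b ∈ θ.dom) : ContDiffAt ℝ ∞ θ.g b :=
  θ.smooth_g.contDiffAt (θ.isOpen_dom.mem_nhds hb)

lemma continuous_jetArg : Continuous jetArg := by unfold jetArg; fun_prop

lemma AdmissibleAt.determiningEqs {θ θ' : ArbElem} {φ : PointTransformation J0} {j : J1}
    (h : AdmissibleAt θ θ' φ j) : ∀ᶠ j' in 𝓝 j, DeterminingEqs θ θ' φ j' := by
  obtain ⟨h1, h2, h3, h4⟩ := h
  have c1 : ContinuousAt (fun j : J1 => j.1) j := continuousAt_fst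
  filter_upwards [c1.eventually (φ.open_source.mem_nhds h1),
    continuous_jetArg.continuousAt.eventually (θ.isOpen_dom.mem_nhds h2),
    (differentiableAt_totalJac (φ.contDiffAt h1)).continuousAt.eventually_ne h3,
    tendsto_nearJet h4] with i i1 i2 i3 i4
  have hφ := φ.contDiffAt i1
  have hΔ := contactFactor_ne_zero hφ (φ.fderiv_surjective i1) i3
  have key : ∀ b c : ℝ, (i, (θ.f (jetArg i) * c + θ.g (jetArg i), b, c)) ∈ θ.eqn :=
    fun b c => ⟨i2, rfl⟩
  have key' := fun b c => (i4 _).1 (key b c)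
  have m := fun b c => (key' b c).2
  simp only [prolong2_tt (k := (i, _)) hφ i3, prolong2_xx (k := (i, _)) hφ i3] at m
  simp only [contactTT, contactTX, contactXX] at m
  have d' : jetArg (prolong1 φ.toFun i) ∈ θ'.dom := (key' 0 0).1
  have hp : ∀ k : J2, (prolong2 φ.toFun k).1 = prolong1 φ.toFun k.1 := fun k => rfl
  simp only [hp] at m
  set f := θ.f (jetArg i)
  set g := θ.g (jetArg i)
  set f' := θ'.f (jetArg (prolong1 φ.toFun i))
  set g' := θ'.g (jetArg (prolong1 φ.toFun i))
  set A := totalT (compT φ.toFun) i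
  set B := totalX (compT φ.toFun) i
  set C := totalT (compX φ.toFun) i
  set D := totalX (compX φ.toFun) i
  set Δ := contactFactor φ.toFun i
  have hJ : totalJac φ.toFun i = A * D - B * C := rfl
  set J := totalJac φ.toFun i
  have m' : ∀ b c : ℝ, _ = _ * J ^ 2 := fun b c =>
    (div_eq_iff (pow_ne_zero 2 i3)).1 (m b c)
  have m2 := fun b c : ℝ => (m' b c).trans (by
    rw [add_mul, mul_assoc, div_mul_cancel₀ _ (pow_ne_zero 2 i3)])
  -- The identity is affine in (u_tx, u_xx), so three sample points determine all its coefficients.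
  have m00 := m2 0 0
  have m10 := m2 1 0
  have m01 := m2 0 1
  have hb : Δ * (D * C - f' * A * B) = 0 := by linear_combination (m00 - m10) / 2
  have hc : Δ * (D ^ 2 * f + C ^ 2 - f' * (B ^ 2 * f + A ^ 2)) = 0 := by
    linear_combination m01 - m00
  obtain ⟨r1, r2, r3, r4⟩ := symbol_relations (hJ ▸ i3) hΔ hb hc
  refine ⟨i1, i2, d', i3, r1, r2, r3, r4, ?_⟩
  -- The mixed Hessian term drops out by `r1`, and `r4 - r3` rewrites its xx-coefficient C² − f'A²
  -- as −f(D² − f'B²), making D² − f'B² a common factor.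
  linear_combination m00 + 2 * contactHess φ.toFun i (horT i) (horX i) * r1
    + contactHess φ.toFun i (horX i) (horX i) * (r4 - r3)

/-! ## Elementary facts on functions of one or two real variables -/

lemma quadratic_eventually_zero {a b c s₀ : ℝ} (h : ∀ᶠ s in 𝓝 s₀, a * s ^ 2 + b * s + c = 0) :
    a = 0 ∧ b = 0 ∧ c = 0 := by
  obtain ⟨ε, hε, hs⟩ := Metric.eventually_nhds_iff.mp h
  have h0 := hs (y := s₀) (by simpa using hε)
  have h1 := hs (y := s₀ + ε / 2) (by simp [abs_of_pos hε]; linarith)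
  have h2 := hs (y := s₀ - ε / 2) (by simp [abs_of_pos hε]; linarith)
  have ha : a * ε ^ 2 = 0 := by linear_combination 2 * h1 + 2 * h2 - 4 * h0
  have ha : a = 0 := (mul_eq_zero.mp ha).resolve_right (by positivity)
  subst ha
  have hb : b * ε = 0 := by linear_combination h1 - h2
  have hb : b = 0 := (mul_eq_zero.mp hb).resolve_right (by positivity)
  subst hb
  exact ⟨rfl, rfl, by linear_combination h0⟩

lemma affine_eventually_zero {b c s₀ : ℝ} (h : ∀ᶠ s in 𝓝 s₀, b * s + c = 0) : b = 0 ∧ c = 0 := by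
  have := quadratic_eventually_zero (a := 0) (b := b) (c := c) (s₀ := s₀)
    (h.mono fun s hs => by linear_combination hs)
  exact this.2

lemma deriv_deriv_quadratic {g : ℝ → ℝ} {a b c r₀ : ℝ}
    (h : ∀ᶠ r in 𝓝 r₀, g r = a * r ^ 2 + b * r + c) : deriv (deriv g) r₀ = 2 * a := by
  have h1 : ∀ r, HasDerivAt (fun r : ℝ => a * r ^ 2 + b * r + c) (2 * a * r + b) r := fun r => by
    have := (((hasDerivAt_pow 2 r).const_mul a).add ((hasDerivAt_id r).const_mul b)).add_const c
    refine (this.congr_deriv ?_)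
    simp
    ring
  have h2 : ∀ r, HasDerivAt (fun r : ℝ => 2 * a * r + b) (2 * a) r := fun r => by
    simpa using ((hasDerivAt_id r).const_mul (2 * a)).add_const b
  have e1 : deriv g =ᶠ[𝓝 r₀] fun r => 2 * a * r + b :=
    (Filter.EventuallyEq.deriv h).trans (.of_forall fun r => (h1 r).deriv)
  rw [e1.deriv_eq, (h2 r₀).deriv]

lemma eventually_const_of_deriv {g : ℝ → ℝ} {s₀ : ℝ} (h : ∀ᶠ s in 𝓝 s₀, HasDerivAt g 0 s) :
    ∀ᶠ s in 𝓝 s₀, g s = g s₀ := by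
  obtain ⟨ε, hε, hs⟩ := Metric.eventually_nhds_iff_ball.mp h
  filter_upwards [Metric.ball_mem_nhds s₀ hε] with s h1
  refine Metric.isOpen_ball.is_const_of_deriv_eq_zero
    (convex_ball s₀ ε).isPreconnected (f := g) ?_ ?_ h1 (Metric.mem_ball_self hε)
  · exact fun x hx => (hs x hx).differentiableAt.differentiableWithinAt
  · exact fun x hx => (hs x hx).deriv

section AffineArgument

variable {f f' g g' : ℝ → ℝ} {α β γ s₀ r₀ : ℝ}

lemma tendsto_level_line :
    Filter.Tendsto (fun r : ℝ => ((s₀ - β / γ * (r - r₀), r) : ℝ × ℝ)) (𝓝 r₀) (𝓝 (s₀, r₀)) := by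
  have : ContinuousAt (fun r : ℝ => ((s₀ - β / γ * (r - r₀), r) : ℝ × ℝ)) r₀ := by fun_prop
  simpa [ContinuousAt] using this

lemma tendsto_cross_line (hγ : γ ≠ 0) :
    Filter.Tendsto (fun p : ℝ => ((s₀ + (p - (α + β * r₀ + γ * s₀)) / γ, r₀) : ℝ × ℝ))
      (𝓝 (α + β * r₀ + γ * s₀)) (𝓝 (s₀, r₀)) := by
  have : ContinuousAt (fun p : ℝ => ((s₀ + (p - (α + β * r₀ + γ * s₀)) / γ, r₀) : ℝ × ℝ))
    (α + β * r₀ + γ * s₀) := by fun_prop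
  simpa [ContinuousAt] using this

/-- With γ ≠ 0 the variables r and α + βr + γs are independent. Varying r along a level line of the
second isolates f; varying the second with r fixed isolates f'. Both values are nonzero because c
is, so they may be cancelled. -/
lemma const_of_product_const {c : ℝ} (hγ : γ ≠ 0) (hc : c ≠ 0)
    (h : ∀ᶠ q in 𝓝 ((s₀, r₀) : ℝ × ℝ), f q.2 * f' (α + β * q.2 + γ * q.1) = c) :
    (∀ᶠ r in 𝓝 r₀, f r = f r₀) ∧
      ∀ᶠ p in 𝓝 (α + β * r₀ + γ * s₀), f' p = f' (α + β * r₀ + γ * s₀) := by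
  have h0 := h.self_of_nhds
  simp only at h0
  constructor
  · filter_upwards [(tendsto_level_line (β := β) (γ := γ)).eventually h] with r hr
    have e : α + β * r + γ * (s₀ - β / γ * (r - r₀)) = α + β * r₀ + γ * s₀ := by
      field_simp; ring
    simp only [e] at hr
    refine mul_right_cancel₀ (b := f' (α + β * r₀ + γ * s₀)) ?_ (hr.trans h0.symm)
    rintro e
    exact hc (by rw [← h0, e, mul_zero])
  · filter_upwards [(tendsto_cross_line (α := α) (β := β) hγ).eventually h] with p hp
    have e : α + β * r₀ + γ * (s₀ + (p - (α + β * r₀ + γ * s₀)) / γ) = p := by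
      field_simp; ring
    simp only [e] at hp
    refine mul_left_cancel₀ (a := f r₀) ?_ (hp.trans h0.symm)
    rintro e
    exact hc (by rw [← h0, e, zero_mul])

/-- On a level line of the argument the right-hand side is constant, so g is quadratic; on the line
r = r₀ it is g' that becomes quadratic. Comparing parallel level lines excludes βκ ≠ 0. In the
applications s is `u_t` or u, r is `u_x`, and κ is U_uu or 0. -/
lemma quadratic_of_affine_argument {M N L φ κ a₀ a₁ a₂ b₀ b₁ b₂ : ℝ} (hγ : γ ≠ 0) (hM : M ≠ 0)
    (hN : N ≠ 0) (hL : L ≠ 0)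
    (h : ∀ᶠ q in 𝓝 ((s₀, r₀) : ℝ × ℝ),
      M * (L * g q.2 + (a₀ + a₁ * q.1 + a₂ * q.2 + κ * q.1 ^ 2)
        - φ * (b₀ + b₁ * q.1 + b₂ * q.2 + κ * q.2 ^ 2)) = N * g' (α + β * q.2 + γ * q.1)) :
    β * κ = 0 ∧ L * deriv (deriv g) r₀ = 2 * φ * κ ∧
      N * γ ^ 2 * deriv (deriv g') (α + β * r₀ + γ * s₀) = 2 * M * κ := by
  have h0 := h.self_of_nhds
  simp only at h0
  have hg := (tendsto_level_line (β := β) (γ := γ)).eventually h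
  have hg' := (tendsto_cross_line (α := α) (β := β) hγ).eventually h
  have cross : β * κ = 0 := by
    obtain ⟨ε, hε, hb⟩ := Metric.eventually_nhds_iff.mp h
    have key : ∀ x y : ℝ, |x| < ε → |y| < ε → M * (L * g (r₀ + y)
        + (a₀ + a₁ * (s₀ + x) + a₂ * (r₀ + y) + κ * (s₀ + x) ^ 2)
        - φ * (b₀ + b₁ * (s₀ + x) + b₂ * (r₀ + y) + κ * (r₀ + y) ^ 2))
        = N * g' (α + β * (r₀ + y) + γ * (s₀ + x)) := fun x y hx hy =>
      hb (y := (s₀ + x, r₀ + y)) (by simp [Prod.dist_eq, hx, hy])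
    by_contra hne
    have hβ : β ≠ 0 := left_ne_zero_of_mul hne
    -- moving along a level line of the argument doubles the quadratic term
    set η : ℝ := ε / 2 / (1 + |β / γ|) with hη
    have hpos : 0 < 1 + |β / γ| := by positivity
    have η0 : 0 < η := by positivity
    have η1 : |η| < ε := by
      rw [abs_of_pos η0, hη, div_lt_iff₀ hpos]
      nlinarith [abs_nonneg (β / γ)]
    have η2 : |β / γ * η| < ε := by
      rw [abs_mul, abs_of_pos η0, hη, mul_div_assoc', div_lt_iff₀ hpos]
      nlinarith [abs_nonneg (β / γ)]
    have z : |(0 : ℝ)| < ε := by simpa using hε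
    have k1 := key (β / γ * η) η η2 η1
    have k2 := key (β / γ * η) 0 η2 z
    have k3 := key 0 η z η1
    have k4 := key 0 0 z z
    have k5 := key (-(β / γ * η)) 0 (by rwa [abs_neg]) z
    have k6 := key (-(β / γ * η)) η (by rwa [abs_neg]) η1
    have e2 : α + β * (r₀ + 0) + γ * (s₀ + β / γ * η) = α + β * (r₀ + η) + γ * (s₀ + 0) := by
      field_simp; ring
    have e6 : α + β * (r₀ + η) + γ * (s₀ + -(β / γ * η)) = α + β * (r₀ + 0) + γ * (s₀ + 0) := by
      field_simp; ring
    rw [e2] at k2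
    rw [e6] at k6
    -- The pairs behind `k2`, `k3` and behind `k6`, `k4` share a value of the argument. Adding the
    -- two differences cancels g, g', the affine terms and the squares of r, leaving the second
    -- difference of κs².
    have : M * κ * (2 * (β / γ * η) ^ 2) = 0 := by
      linear_combination k2 - k3 - k4 + k6
    have hκ : κ = 0 := by
      have h2 : 2 * (β / γ * η) ^ 2 ≠ 0 := by positivity
      exact (mul_eq_zero.mp ((mul_eq_zero.mp this).resolve_right h2)).resolve_left hM
    exact hne (by rw [hκ, mul_zero])
  refine ⟨cross, ?_, ?_⟩
  · have := deriv_deriv_quadratic (g := g) (r₀ := r₀) (a := φ * κ / L)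
      (b := (φ * (b₂ - b₁ * (β / γ)) - a₂ + a₁ * (β / γ)) / L)
      (c := (N * g' (α + β * r₀ + γ * s₀) / M - (a₀ + a₁ * (s₀ + β / γ * r₀) + κ * s₀ ^ 2)
        + φ * (b₀ + b₁ * (s₀ + β / γ * r₀))) / L) (by
        filter_upwards [hg] with r hr
        have e : α + β * r + γ * (s₀ - β / γ * (r - r₀)) = α + β * r₀ + γ * s₀ := by
          field_simp; ring
        simp only [e] at hr
        rw [← hr]
        -- Since βκ = 0, the term κs² is constant along the level line, so only −φκr² contributes to
        -- the curvature of g.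
        have c1 : κ * (s₀ - β / γ * (r - r₀)) ^ 2 = κ * s₀ ^ 2 := by
          linear_combination (-2 * s₀ / γ * (r - r₀) + β / γ ^ 2 * (r - r₀) ^ 2) * cross
        rw [c1]
        field_simp
        ring)
    rw [this]
    field_simp
  · have := deriv_deriv_quadratic (g := g') (r₀ := α + β * r₀ + γ * s₀) (a := M * κ / (N * γ ^ 2))
      (b := M * (a₁ - φ * b₁ - 2 * κ * (α + β * r₀) / γ) / (N * γ))
      (c := M * (L * g r₀ + (a₀ + a₂ * r₀) - φ * (b₀ + b₂ * r₀ + κ * r₀ ^ 2)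
        - (a₁ - φ * b₁) * (α + β * r₀) / γ + κ * (α + β * r₀) ^ 2 / γ ^ 2) / N) (by
        filter_upwards [hg'] with p hp
        have e : α + β * r₀ + γ * (s₀ + (p - (α + β * r₀ + γ * s₀)) / γ) = p := by
          field_simp; ring
        have e' : s₀ + (p - (α + β * r₀ + γ * s₀)) / γ = (p - (α + β * r₀)) / γ := by
          field_simp; ring
        simp only [e] at hp
        rw [e'] at hp
        have : g' p = N * g' p / N := by field_simp
        rw [this, ← hp]
        field_simp
        ring)
    rw [this]
    field_simp

end AffineArgument

/-! ## Partial derivatives in coordinates -/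

lemma hasDerivAt_comp_snd {F : ℝ × ℝ → ℝ} {a p : ℝ → ℝ} {s p' : ℝ}
    (hF : DifferentiableAt ℝ F (a s, p s)) (ha : HasDerivAt a 0 s) (hp : HasDerivAt p p' s) :
    HasDerivAt (fun s => F (a s, p s)) (p' * partialUx F (a s, p s)) s := by
  have h := hF.hasFDerivAt.comp_hasDerivAt s (ha.prodMk hp)
  have e : ((0, p') : ℝ × ℝ) = p' • (0, 1) := by simp
  rw [e, map_smul] at h
  exact h

lemma hasDerivAt_snd {F : ℝ × ℝ → ℝ} {b : ℝ × ℝ} (hF : DifferentiableAt ℝ F b) :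
    HasDerivAt (fun r => F (b.1, r)) (partialUx F b) b.2 := by
  have := hasDerivAt_comp_snd (a := fun _ => b.1) (p := fun r => r) (s := b.2) hF
    (hasDerivAt_const _ _) (hasDerivAt_id _)
  simpa using this

lemma ContDiffAt.partialUx {F : ℝ × ℝ → ℝ} {b : ℝ × ℝ} (hF : ContDiffAt ℝ ∞ F b) :
    ContDiffAt ℝ ∞ (partialUx F) b :=
  (hF.fderiv_right (m := ∞) (by norm_cast)).clm_apply contDiffAt_const

lemma partialUx_partialUx {F : ℝ × ℝ → ℝ} {b : ℝ × ℝ} (hF : ∀ᶠ c in 𝓝 b, ContDiffAt ℝ ∞ F c) :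
    partialUx (partialUx F) b = deriv (deriv fun r => F (b.1, r)) b.2 := by
  have c : ContinuousAt (fun r : ℝ => ((b.1, r) : ℝ × ℝ)) b.2 := by fun_prop
  have e : deriv (fun r => F (b.1, r)) =ᶠ[𝓝 b.2] fun r => partialUx F (b.1, r) := by
    filter_upwards [c.eventually hF] with r hr
    exact (hasDerivAt_snd (b := (b.1, r)) hr.diffAt).deriv
  rw [e.deriv_eq, (hasDerivAt_snd hF.self_of_nhds.partialUx.diffAt).deriv]

lemma ArbElem.eventually_contDiffAt (θ : ArbElem) {b : ℝ × ℝ} (hb : b ∈ θ.dom) :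
    ∀ᶠ c in 𝓝 b, ContDiffAt ℝ ∞ θ.f c ∧ ContDiffAt ℝ ∞ θ.g c := by
  filter_upwards [θ.isOpen_dom.mem_nhds hb] with c hc
  exact ⟨θ.contDiffAt_f hc, θ.contDiffAt_g hc⟩

/-- The form in which nonlinearity is used: an open set of jets contains an open slice in (x, u_x),
on which the pair of derivatives cannot vanish identically. -/
lemma waveClass_not_linear {θ : ArbElem} (hθ : θ ∈ waveClass) {j : J1}
    (h : ∀ᶠ i in 𝓝 j, jetArg i ∈ θ.dom ∧ partialUx θ.f (jetArg i) = 0 ∧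
      partialUx (partialUx θ.g) (jetArg i) = 0) : False := by
  obtain ⟨O, hO, hopen, hj⟩ := mem_nhds_iff.mp h
  let ι : ℝ × ℝ → J1 := fun b => ((j.1.1, b.1, j.1.2.2), (j.2.1, b.2))
  have hι : Continuous ι := by fun_prop
  obtain ⟨b, hb, hne⟩ := hθ.2 (ι ⁻¹' O) (hopen.preimage hι) ⟨jetArg j, hj⟩
    (fun b hb => (hO hb).1)
  apply hne
  have := hO hb
  exact Prod.ext this.2.1 this.2.2

lemma hess_eq {F : J0 → ℝ} {z : J0} (hF : ContDiffAt ℝ ∞ F z) (v w : J0) :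
    hess F z v w = dirDeriv v (dirDeriv w F) z := (dirDeriv_dirDeriv hF v w).symm

lemma hess_horT {F : J0 → ℝ} {j : J1} (hF : ContDiffAt ℝ ∞ F j.1) :
    hess F j.1 (horT j) (horT j) =
      dT (dT F) j.1 + 2 * j.2.1 * dT (dU F) j.1 + j.2.1 ^ 2 * dU (dU F) j.1 := by
  have e : horT j = (1, 0, 0) + j.2.1 • (0, 0, 1) := by simp [horT]
  have c := dirDeriv_comm hF (0, 0, 1) (1, 0, 0)
  simp only [← hess_eq hF] at c ⊢
  unfold hess at c ⊢
  rw [e]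
  simp only [map_add, map_smul, add_apply, smul_apply, smul_eq_mul]
  rw [c]
  ring

lemma hess_horX {F : J0 → ℝ} {j : J1} (hF : ContDiffAt ℝ ∞ F j.1) :
    hess F j.1 (horX j) (horX j) =
      dX (dX F) j.1 + 2 * j.2.2 * dX (dU F) j.1 + j.2.2 ^ 2 * dU (dU F) j.1 := by
  have e : horX j = (0, 1, 0) + j.2.2 • (0, 0, 1) := by simp [horX]
  have c := dirDeriv_comm hF (0, 0, 1) (0, 1, 0)
  simp only [← hess_eq hF] at c ⊢
  unfold hess at c ⊢
  rw [e]
  simp only [map_add, map_smul, add_apply, smul_apply, smul_eq_mul]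
  rw [c]
  ring

lemma dirDeriv_eq_zero {F : J0 → ℝ} {z : J0} (h : ∀ᶠ y in 𝓝 z, F y = 0) (v : J0) :
    dirDeriv v F z = 0 := by
  have : F =ᶠ[𝓝 z] fun _ => 0 := h
  unfold dirDeriv
  rw [this.fderiv_eq]
  simp

lemma hasDerivAt_dU {F : J0 → ℝ} {z : J0} (hF : DifferentiableAt ℝ F z) :
    HasDerivAt (fun s => F (z.1, z.2.1, s)) (dU F z) z.2.2 :=
  hF.hasFDerivAt.comp_hasDerivAt z.2.2
    ((hasDerivAt_const _ _).prodMk ((hasDerivAt_const _ _).prodMk (hasDerivAt_id _)))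

lemma hasDerivAt_dX {F : J0 → ℝ} {z : J0} (hF : DifferentiableAt ℝ F z) :
    HasDerivAt (fun s => F (z.1, s, z.2.2)) (dX F z) z.2.1 :=
  hF.hasFDerivAt.comp_hasDerivAt z.2.1
    ((hasDerivAt_const _ _).prodMk ((hasDerivAt_id _).prodMk (hasDerivAt_const _ _)))

lemma hasDerivAt_dT {F : J0 → ℝ} {z : J0} (hF : DifferentiableAt ℝ F z) :
    HasDerivAt (fun s => F (s, z.2.1, z.2.2)) (dT F z) z.1 :=
  hF.hasFDerivAt.comp_hasDerivAt z.1
    ((hasDerivAt_id _).prodMk ((hasDerivAt_const _ _).prodMk (hasDerivAt_const _ _)))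

/-! ## Admissible transformations are fibre-preserving -/

section Fibre

variable {θ θ' : ArbElem} {φ : PointTransformation J0} {j : J1}

/-- The relation `eq2` is polynomial in `u_t`, since f depends only on (x, u_x); its coefficients
give T_u X_u = 0 and T_t X_u + T_u X_t = 0. If T_u or X_u were nonzero, varying `u_x` in what
remains would make the total Jacobian vanish. -/
lemma dU_compT_compX (hθ : θ ∈ waveClass) (h : ∀ᶠ i in 𝓝 j, DeterminingEqs θ θ' φ i) :
    dU (compT φ.toFun) j.1 = 0 ∧ dU (compX φ.toFun) j.1 = 0 := by
  have h0 := h.self_of_nhds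
  have hf := hθ.1 _ h0.mem_dom
  have c1 : Filter.Tendsto (fun s : ℝ => ((j.1, (s, j.2.2)) : J1)) (𝓝 j.2.1) (𝓝 j) :=
    (by fun_prop : Continuous (fun s : ℝ => ((j.1, (s, j.2.2)) : J1))).tendsto j.2.1
  have c2 : Filter.Tendsto (fun s : ℝ => ((j.1, (j.2.1, s)) : J1)) (𝓝 j.2.2) (𝓝 j) :=
    (by fun_prop : Continuous (fun s : ℝ => ((j.1, (j.2.1, s)) : J1))).tendsto j.2.2
  have hJ := h0.jac
  have e := h0.eq2
  unfold totalJac at hJ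
  simp only [totalT_eq, totalX_eq] at hJ e
  set Tt := dT (compT φ.toFun) j.1
  set Tx := dX (compT φ.toFun) j.1
  set Tu := dU (compT φ.toFun) j.1
  set Xt := dT (compX φ.toFun) j.1
  set Xx := dX (compX φ.toFun) j.1
  set Xu := dU (compX φ.toFun) j.1
  set f := θ.f (jetArg j)
  obtain ⟨q1, q2, -⟩ := quadratic_eventually_zero (s₀ := j.2.1) (a := Tu * Xu)
    (b := Tt * Xu + Tu * Xt) (c := Tt * Xt - f * (Tx + j.2.2 * Tu) * (Xx + j.2.2 * Xu)) (by
      filter_upwards [c1.eventually h] with s hs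
      have := hs.eq2
      simp only [totalT_eq, totalX_eq] at this
      have e : θ.f (jetArg (j.1, (s, j.2.2))) = f := rfl
      rw [e] at this
      linear_combination this)
  have q3 : ∀ᶠ s in 𝓝 j.2.2, θ.f (jetArg (j.1, (j.2.1, s))) ≠ 0 ∧ Tt * Xt
      = θ.f (jetArg (j.1, (j.2.1, s))) * (Tx + s * Tu) * (Xx + s * Xu) := by
    filter_upwards [c2.eventually h] with s hs
    have := hs.eq2
    simp only [totalT_eq, totalX_eq] at this
    exact ⟨hθ.1 _ hs.mem_dom, by linear_combination this - j.2.1 ^ 2 * q1 - j.2.1 * q2⟩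
  have tu : Tu = 0 := by
    by_contra hT
    have x1 : Xu = 0 := (mul_eq_zero.mp q1).resolve_left hT
    have x2 : Xt = 0 := by
      rw [x1, mul_zero, zero_add] at q2
      exact (mul_eq_zero.mp q2).resolve_left hT
    obtain ⟨x3, -⟩ := affine_eventually_zero (s₀ := j.2.2) (b := Tu * Xx) (c := Tx * Xx) (by
      filter_upwards [q3] with s ⟨hs, hs'⟩
      rw [x1, x2] at hs'
      have : θ.f (jetArg (j.1, (j.2.1, s))) * (Tu * Xx * s + Tx * Xx) = 0 := by
        linear_combination -hs'
      exact (mul_eq_zero.mp this).resolve_left hs)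
    have x4 : Xx = 0 := (mul_eq_zero.mp x3).resolve_left hT
    apply hJ
    rw [x1, x2, x4]
    ring
  refine ⟨tu, ?_⟩
  by_contra hX
  have t2 : Tt = 0 := by
    rw [tu, zero_mul, add_zero] at q2
    exact (mul_eq_zero.mp q2).resolve_right hX
  obtain ⟨x3, -⟩ := affine_eventually_zero (s₀ := j.2.2) (b := Tx * Xu) (c := Tx * Xx) (by
    filter_upwards [q3] with s ⟨hs, hs'⟩
    rw [tu, t2] at hs'
    have : θ.f (jetArg (j.1, (j.2.1, s))) * (Tx * Xu * s + Tx * Xx) = 0 := by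
      linear_combination -hs'
    exact (mul_eq_zero.mp this).resolve_left hs)
  have x4 : Tx = 0 := (mul_eq_zero.mp x3).resolve_right hX
  apply hJ
  rw [tu, t2, x4]
  ring

lemma eventually_base {p : J0 → Prop} (h : ∀ᶠ i in 𝓝 j, p i.1) : ∀ᶠ z in 𝓝 j.1, p z := by
  have c : Filter.Tendsto (fun z : J0 => ((z, j.2) : J1)) (𝓝 j.1) (𝓝 j) :=
    (by fun_prop : Continuous (fun z : J0 => ((z, j.2) : J1))).tendsto j.1
  exact c.eventually h

lemma eventually_base_ne {F : J0 → ℝ} (hF : ContDiffAt ℝ ∞ F j.1) (h0 : F j.1 ≠ 0) :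
    ∀ᶠ i : J1 in 𝓝 j, F i.1 ≠ 0 := by
  have c : Filter.Tendsto (fun i : J1 => i.1) (𝓝 j) (𝓝 j.1) := continuousAt_fst
  exact c.eventually (hF.continuousAt.eventually_ne h0)

lemma dU_compT_compX_eventually (hθ : θ ∈ waveClass)
    (h : ∀ᶠ i in 𝓝 j, DeterminingEqs θ θ' φ i) :
    ∀ᶠ z in 𝓝 j.1, dU (compT φ.toFun) z = 0 ∧ dU (compX φ.toFun) z = 0 :=
  eventually_base (h.eventually_nhds.mono fun _ hi => dU_compT_compX hθ hi)

/-- At a jet where `X_t ≠ 0`, the equation is semilinear with at most quadratic `g`, and its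
coefficients are tied to `U_uu`. -/
lemma relations_of_dT_compX_ne_zero (hθ : θ ∈ waveClass)
    (h : ∀ᶠ i in 𝓝 j, DeterminingEqs θ θ' φ i) (hC : dT (compX φ.toFun) j.1 ≠ 0) :
    partialUx θ.f (jetArg j) = 0 ∧
    dU (compU φ.toFun) j.1 * partialUx (partialUx θ.g) (jetArg j)
      = 2 * θ.f (jetArg j) * dU (dU (compU φ.toFun)) j.1 ∧
    dT (compT φ.toFun) j.1 * dU (dU (compU φ.toFun)) j.1 = 0 ∧
    dX (compT φ.toFun) j.1 ^ 2 * dU (compU φ.toFun) j.1 ^ 2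
        * partialUx (partialUx θ'.g) (jetArg (prolong1 φ.toFun j))
      = 2 * (dX (compX φ.toFun) j.1 ^ 2
        - θ'.f (jetArg (prolong1 φ.toFun j)) * dX (compT φ.toFun) j.1 ^ 2)
        * dU (dU (compU φ.toFun)) j.1 ∧
    dU (compU φ.toFun) j.1 ≠ 0 ∧ dX (compT φ.toFun) j.1 ≠ 0 := by
  have h0 := h.self_of_nhds
  have hφ := φ.contDiffAt h0.mem_source
  obtain ⟨sT, sX, sU⟩ := smooth_comps hφ
  have hbase := dU_compT_compX_eventually hθ h
  obtain ⟨tu, xu⟩ := dU_compT_compX hθ h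
  have tz : ∀ v, dirDeriv v (dU (compT φ.toFun)) j.1 = 0 :=
    dirDeriv_eq_zero (hbase.mono fun _ hz => hz.1)
  have xz : ∀ v, dirDeriv v (dU (compX φ.toFun)) j.1 = 0 :=
    dirDeriv_eq_zero (hbase.mono fun _ hz => hz.2)
  have hJ0 := h0.jac
  have hΔ := contactFactor_ne_zero hφ (φ.fderiv_surjective h0.mem_source) h0.jac
  unfold contactFactor at hΔ
  rw [tu, xu, mul_zero, mul_zero, sub_zero, sub_zero] at hΔ
  have hB : dX (compT φ.toFun) j.1 ≠ 0 := by
    intro hB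
    have := h0.eq3
    simp only [totalT_eq, totalX_eq, tu, xu, hB] at this
    exact hC (by simpa using this)
  have hf := hθ.1 _ h0.mem_dom
  -- the values at the jets over the same point
  set z := j.1 with hz
  set A := dT (compT φ.toFun) z with hA
  set B := dX (compT φ.toFun) z with hBdef
  set C := dT (compX φ.toFun) z with hCdef
  set D := dX (compX φ.toFun) z with hD
  set V := dU (compU φ.toFun) z with hV
  set Ut := dT (compU φ.toFun) z
  set Ux := dX (compU φ.toFun) z
  have tot : ∀ s r : ℝ, totalT (compT φ.toFun) (z, (s, r)) = A ∧
      totalX (compT φ.toFun) (z, (s, r)) = B ∧ totalT (compX φ.toFun) (z, (s, r)) = C ∧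
      totalX (compX φ.toFun) (z, (s, r)) = D ∧ totalT (compU φ.toFun) (z, (s, r)) = Ut + s * V ∧
      totalX (compU φ.toFun) (z, (s, r)) = Ux + r * V := fun s r => by
    simp only [totalT_eq, totalX_eq, tu, xu]
    simp [hA, hBdef, hCdef, hD]
    constructor <;> rfl
  set J := A * D - B * C with hJdef
  have jac : ∀ s r : ℝ, totalJac φ.toFun (z, (s, r)) = J := fun s r => by
    obtain ⟨t1, t2, t3, t4, -⟩ := tot s r
    unfold totalJac
    rw [t1, t2, t3, t4]
  have hJ : J ≠ 0 := by rw [← jac j.2.1 j.2.2]; exact hJ0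
  set α := (Ux * A - Ut * B) / J with hα
  set β := V * A / J with hβ
  set γ := -(V * B) / J with hγ
  have hγ0 : γ ≠ 0 := div_ne_zero (neg_ne_zero.2 (mul_ne_zero hΔ hB)) hJ
  have pX : ∀ s r : ℝ, newUx φ.toFun (z, (s, r)) = α + β * r + γ * s := fun s r => by
    obtain ⟨t1, t2, t3, t4, t5, t6⟩ := tot s r
    unfold newUx newDerivX
    rw [t1, t2, t5, t6, jac, hα, hβ, hγ]
    field_simp
    ring
  have pT : ∀ s r : ℝ, newUt φ.toFun (z, (s, r))
      = (Ut * D - Ux * C) / J + (-(V * C) / J) * r + V * D / J * s := fun s r => by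
    obtain ⟨t1, t2, t3, t4, t5, t6⟩ := tot s r
    unfold newUt newDerivT
    rw [t3, t4, t5, t6, jac]
    field_simp
    ring
  have cF : ∀ s r : ℝ, contactFactor φ.toFun (z, (s, r)) = V := fun s r => by
    simp only [contactFactor]
    rw [tu, xu]
    ring
  have sT' : ∀ q : ℝ × ℝ, ContDiffAt ℝ ∞ (compT φ.toFun) ((z, q) : J1).1 := fun _ => sT
  have sX' : ∀ q : ℝ × ℝ, ContDiffAt ℝ ∞ (compX φ.toFun) ((z, q) : J1).1 := fun _ => sX
  have sU' : ∀ q : ℝ × ℝ, ContDiffAt ℝ ∞ (compU φ.toFun) ((z, q) : J1).1 := fun _ => sU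
  have cTT : ∀ s r : ℝ, contactHess φ.toFun (z, (s, r)) (horT (z, (s, r))) (horT (z, (s, r)))
      = dT (dT (compU φ.toFun)) z + 2 * s * dT (dU (compU φ.toFun)) z
        + s ^ 2 * dU (dU (compU φ.toFun)) z
        - newUt φ.toFun (z, (s, r)) * dT (dT (compT φ.toFun)) z
        - newUx φ.toFun (z, (s, r)) * dT (dT (compX φ.toFun)) z := fun s r => by
    unfold contactHess
    rw [hess_horT (sT' _), hess_horT (sX' _), hess_horT (sU' _)]
    simp only [tz, xz]
    ring
  have cXX : ∀ s r : ℝ, contactHess φ.toFun (z, (s, r)) (horX (z, (s, r))) (horX (z, (s, r)))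
      = dX (dX (compU φ.toFun)) z + 2 * r * dX (dU (compU φ.toFun)) z
        + r ^ 2 * dU (dU (compU φ.toFun)) z
        - newUt φ.toFun (z, (s, r)) * dX (dX (compT φ.toFun)) z
        - newUx φ.toFun (z, (s, r)) * dX (dX (compX φ.toFun)) z := fun s r => by
    unfold contactHess
    rw [hess_horX (sT' _), hess_horX (sX' _), hess_horX (sU' _)]
    simp only [tz, xz]
    ring
  have c : Filter.Tendsto (fun q : ℝ × ℝ => ((z, q) : J1)) (𝓝 (j.2.1, j.2.2)) (𝓝 j) :=
    (by fun_prop : Continuous (fun q : ℝ × ℝ => ((z, q) : J1))).tendsto (j.2.1, j.2.2)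
  have hq := c.eventually h
  have p0 : newUx φ.toFun j = α + β * j.2.2 + γ * j.2.1 := pX j.2.1 j.2.2
  have arg' : jetArg (prolong1 φ.toFun j) = (compX φ.toFun z, α + β * j.2.2 + γ * j.2.1) := by
    rw [← p0]; rfl
  have argq : ∀ q : ℝ × ℝ, jetArg (prolong1 φ.toFun (z, q))
      = (compX φ.toFun z, α + β * q.2 + γ * q.1) := fun q => by
    rw [← pX q.1 q.2]; rfl
  -- With T_u = X_u = 0, `eq3` reads f · f' = X_t²/T_x², whose right-hand side does not see `u_t` or
  -- `u_x`.
  obtain ⟨F1, F2⟩ := const_of_product_const (f := fun r => θ.f (z.2.1, r))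
    (f' := fun p => θ'.f (compX φ.toFun z, p)) (c := C ^ 2 / B ^ 2) hγ0
    (div_ne_zero (pow_ne_zero 2 hC) (pow_ne_zero 2 hB)) (by
      filter_upwards [hq] with q hq
      have e := hq.eq3
      rw [argq, (tot q.1 q.2).2.2.1, (tot q.1 q.2).2.1] at e
      rw [eq_div_iff (pow_ne_zero 2 hB), e]
      rfl)
  set M := D ^ 2 - θ'.f (compX φ.toFun z, α + β * j.2.2 + γ * j.2.1) * B ^ 2 with hM
  have hM0 : M ≠ 0 := by
    intro h00
    have e3 := h0.eq3
    have e2 := h0.eq2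
    obtain ⟨t1, t2, t3, t4, -⟩ := tot j.2.1 j.2.2
    have e4 := h0.eq4
    change totalT (compX φ.toFun) (z, (j.2.1, j.2.2)) ^ 2 = _ * _ *
      totalX (compT φ.toFun) (z, (j.2.1, j.2.2)) ^ 2 at e3
    change totalT (compT φ.toFun) (z, (j.2.1, j.2.2)) * totalT (compX φ.toFun) (z, (j.2.1, j.2.2))
      = _ * totalX (compT φ.toFun) (z, (j.2.1, j.2.2))
        * totalX (compX φ.toFun) (z, (j.2.1, j.2.2)) at e2
    rw [t2, t3, arg'] at e3
    rw [t1, t2, t3, t4] at e2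
    -- `f D ^ 2 = C ^ 2` and `A C = f B D` make the Jacobian vanish
    have k : C * (A * D - B * C) = 0 := by
      linear_combination D * e2 + θ.f (jetArg j) * B * h00 - B * e3
    exact (mul_ne_zero hC hJ) k
  -- Here s = u_t, r = u_x. The coefficients collect `eq5` after the slopes ũ_t̃ and ũ_x̃ have been
  -- expanded as affine functions of both.
  have G := quadratic_of_affine_argument (g := fun r => θ.g (z.2.1, r))
    (g' := fun p => θ'.g (compX φ.toFun z, p)) (s₀ := j.2.1) (r₀ := j.2.2)
    (α := α) (β := β) (M := M) (N := J ^ 2) (L := V) (φ := θ.f (jetArg j))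
    (κ := dU (dU (compU φ.toFun)) z)
    (a₀ := dT (dT (compU φ.toFun)) z - (Ut * D - Ux * C) / J * dT (dT (compT φ.toFun)) z
      - α * dT (dT (compX φ.toFun)) z)
    (a₁ := 2 * dT (dU (compU φ.toFun)) z - V * D / J * dT (dT (compT φ.toFun)) z
      - γ * dT (dT (compX φ.toFun)) z)
    (a₂ := V * C / J * dT (dT (compT φ.toFun)) z - β * dT (dT (compX φ.toFun)) z)
    (b₀ := dX (dX (compU φ.toFun)) z - (Ut * D - Ux * C) / J * dX (dX (compT φ.toFun)) z
      - α * dX (dX (compX φ.toFun)) z)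
    (b₁ := - V * D / J * dX (dX (compT φ.toFun)) z - γ * dX (dX (compX φ.toFun)) z)
    (b₂ := 2 * dX (dU (compU φ.toFun)) z + V * C / J * dX (dX (compT φ.toFun)) z
      - β * dX (dX (compX φ.toFun)) z)
    hγ0 hM0 (pow_ne_zero 2 hJ) hΔ (by
      have k1 : Filter.Tendsto (fun q : ℝ × ℝ => q.2) (𝓝 (j.2.1, j.2.2)) (𝓝 j.2.2) :=
        continuousAt_snd
      have k2 : Filter.Tendsto (fun q : ℝ × ℝ => α + β * q.2 + γ * q.1) (𝓝 (j.2.1, j.2.2))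
          (𝓝 (α + β * j.2.2 + γ * j.2.1)) :=
        (by fun_prop : Continuous fun q : ℝ × ℝ => α + β * q.2 + γ * q.1).tendsto (j.2.1, j.2.2)
      filter_upwards [hq, k1.eventually F1, k2.eventually F2] with q hq f1 f2
      have e := hq.eq5
      have ff : θ.f (jetArg (z, q)) = θ.f (jetArg j) := f1
      rw [argq, (tot q.1 q.2).2.2.2.1, (tot q.1 q.2).2.1, f2, ff, jac q.1 q.2, cF q.1 q.2,
        cTT q.1 q.2, cXX q.1 q.2, pX q.1 q.2, pT q.1 q.2] at e
      rw [← e]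
      have : θ.g (jetArg (z, q)) = θ.g (z.2.1, q.2) := rfl
      rw [this]
      ring)
  obtain ⟨G1, G2, G3⟩ := G
  have ev := θ.eventually_contDiffAt h0.mem_dom
  have ev' := θ'.eventually_contDiffAt h0.mem_dom'
  refine ⟨?_, ?_, ?_, ?_, hΔ, hB⟩
  · have d := hasDerivAt_snd (θ.contDiffAt_f h0.mem_dom).diffAt
    have e : (fun r => θ.f ((jetArg j).1, r)) =ᶠ[𝓝 (jetArg j).2] fun _ => θ.f (jetArg j) := F1
    rw [← d.deriv, e.deriv_eq, deriv_const]
  · rw [partialUx_partialUx (ev.mono fun _ h => h.2)]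
    exact G2
  · have : V * (A * dU (dU (compU φ.toFun)) z) = 0 := by
      rw [hβ] at G1
      field_simp at G1
      linear_combination G1
    exact (mul_eq_zero.mp this).resolve_left hΔ
  · rw [partialUx_partialUx (ev'.mono fun _ h => h.2), arg', ← hM, ← G3, hγ]
    field_simp

/-- If U_uu ≠ 0, the relations force T_t = X_x = 0, and they tie U_u and U_uu to values of f, f' and
the second derivatives of g, g'. Along a curve on which (x, u_x) and the new (x̃, ũ_x̃) stay fixed
those values are constant, so U_u is constant in u: a contradiction. -/
lemma dU_dU_of_dT_compX_ne_zero (hθ : θ ∈ waveClass) (hθ' : θ' ∈ waveClass)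
    (h : ∀ᶠ i in 𝓝 j, DeterminingEqs θ θ' φ i) (hC : dT (compX φ.toFun) j.1 ≠ 0) :
    dU (dU (compU φ.toFun)) j.1 = 0 := by
  by_contra hκ
  have h0 := h.self_of_nhds
  have hφ := φ.contDiffAt h0.mem_source
  obtain ⟨sT, sX, sU⟩ := smooth_comps hφ
  have hf := hθ.1 _ h0.mem_dom
  have hf' := hθ'.1 _ h0.mem_dom'
  obtain ⟨-, -, -, -, hV, hB⟩ := relations_of_dT_compX_ne_zero hθ h hC
  have hbase := dU_compT_compX_eventually hθ h
  obtain ⟨tu, xu⟩ := dU_compT_compX hθ h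
  -- the curve over the points `(t, x, u)` with `t`, `x`, `u_x` and `ũ_x̃` fixed
  let pt : ℝ → J0 := fun u => (j.1.1, j.1.2.1, u)
  -- ũ_x̃ is affine in `u_t` with nonzero slope −U_u T_x/J, so fixing it determines `u_t`; this is
  -- the solution of that linear equation.
  let sl : ℝ → ℝ := fun u =>
    ((dX (compU φ.toFun) (pt u) + j.2.2 * dU (compU φ.toFun) (pt u)) * dT (compT φ.toFun) (pt u)
      - newUx φ.toFun j * (dT (compT φ.toFun) (pt u) * dX (compX φ.toFun) (pt u)
        - dX (compT φ.toFun) (pt u) * dT (compX φ.toFun) (pt u)))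
      / (dX (compT φ.toFun) (pt u) * dU (compU φ.toFun) (pt u))
      - dT (compU φ.toFun) (pt u) / dU (compU φ.toFun) (pt u)
  have hpt : ContinuousAt pt j.1.2.2 := by fun_prop
  have co : ∀ {F : J0 → ℝ}, ContDiffAt ℝ ∞ F j.1 → ContinuousAt (fun u => F (pt u)) j.1.2.2 :=
    fun {F} hF => ContinuousAt.comp (g := F) hF.continuousAt hpt
  have hsl : ContinuousAt sl j.1.2.2 := by
    have a1 := co (sU.dirDeriv (0, 1, 0))
    have a2 := co (sU.dirDeriv (0, 0, 1))
    have a3 := co (sU.dirDeriv (1, 0, 0))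
    have b1 := co (sT.dirDeriv (1, 0, 0))
    have b2 := co (sT.dirDeriv (0, 1, 0))
    have c1 := co (sX.dirDeriv (1, 0, 0))
    have c2 := co (sX.dirDeriv (0, 1, 0))
    exact ((((a1.add (continuousAt_const.mul a2)).mul b1).sub
      (continuousAt_const.mul ((b1.mul c2).sub (b2.mul c1)))).div (b2.mul a2)
        (mul_ne_zero hB hV)).sub (a3.div a2 hV)
  have hJ0 := h0.jac
  have spec := newUt_newUx_spec hJ0
  have hsl0 : sl j.1.2.2 = j.2.1 := by
    have e : newUx φ.toFun j * totalJac φ.toFun j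
        = totalX (compU φ.toFun) j * totalT (compT φ.toFun) j
        - totalT (compU φ.toFun) j * totalX (compT φ.toFun) j :=
      div_mul_cancel₀ _ hJ0
    unfold totalJac at e
    simp only [totalT_eq, totalX_eq, tu, xu, mul_zero, add_zero] at e
    have : pt j.1.2.2 = j.1 := rfl
    simp only [sl, this]
    rw [e]
    field_simp
    ring
  let cu : ℝ → J1 := fun u => (pt u, (sl u, j.2.2))
  have hcu : Filter.Tendsto cu (𝓝 j.1.2.2) (𝓝 j) := by
    have : ContinuousAt cu j.1.2.2 := hpt.prodMk (hsl.prodMk continuousAt_const)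
    have e : cu j.1.2.2 = j := by simp only [cu, hsl0]; rfl
    rw [ContinuousAt, e] at this
    exact this
  have hCev : ∀ᶠ i : J1 in 𝓝 j, dT (compX φ.toFun) i.1 ≠ 0 :=
    eventually_base_ne (sX.dirDeriv _) hC
  have hκev : ∀ᶠ i : J1 in 𝓝 j, dU (dU (compU φ.toFun)) i.1 ≠ 0 :=
    eventually_base_ne ((sU.dirDeriv _).dirDeriv _) hκ
  have hXc : ∀ᶠ u in 𝓝 j.1.2.2, compX φ.toFun (pt u) = compX φ.toFun j.1 := by
    refine eventually_const_of_deriv (g := fun u => compX φ.toFun (pt u)) ?_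
    have hs : ∀ᶠ z in 𝓝 j.1, z ∈ φ.source := φ.open_source.mem_nhds h0.mem_source
    have hpt' : Filter.Tendsto pt (𝓝 j.1.2.2) (𝓝 j.1) := hpt
    filter_upwards [hpt'.eventually hbase, hpt'.eventually hs] with u h1 h2
    have := hasDerivAt_dU (smooth_comps (φ.contDiffAt h2)).2.1.diffAt
    rw [h1.2] at this
    exact this
  have rel : ∀ᶠ u in 𝓝 j.1.2.2, dU (compU φ.toFun) (pt u) ≠ 0 ∧
      dU (compU φ.toFun) (pt u) * partialUx (partialUx θ.g) (jetArg j)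
        = 2 * θ.f (jetArg j) * dU (dU (compU φ.toFun)) (pt u) ∧
      dU (compU φ.toFun) (pt u) ^ 2 * partialUx (partialUx θ'.g) (jetArg (prolong1 φ.toFun j))
        = -2 * θ'.f (jetArg (prolong1 φ.toFun j)) * dU (dU (compU φ.toFun)) (pt u) := by
    filter_upwards [hcu.eventually h.eventually_nhds, hcu.eventually hCev, hcu.eventually hκev,
      hXc] with u h1 h2 h3 h4
    obtain ⟨-, r2, r3, r4, r5, r6⟩ := relations_of_dT_compX_ne_zero hθ h1 h2
    have hA := (mul_eq_zero.mp r3).resolve_right h3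
    have d0 := h1.self_of_nhds
    obtain ⟨tu', xu'⟩ := dU_compT_compX hθ h1
    have hD : dX (compX φ.toFun) (cu u).1 = 0 := by
      have := d0.eq1
      simp only [totalT_eq, totalX_eq, tu', xu', hA, mul_zero, zero_mul, add_zero] at this
      exact (mul_eq_zero.mp this).resolve_right h2
    have hp : newUx φ.toFun (cu u) = newUx φ.toFun j := by
      have hJu := d0.jac
      have e : newUx φ.toFun (cu u) * totalJac φ.toFun (cu u)
          = totalX (compU φ.toFun) (cu u) * totalT (compT φ.toFun) (cu u)
          - totalT (compU φ.toFun) (cu u) * totalX (compT φ.toFun) (cu u) :=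
        div_mul_cancel₀ _ hJu
      refine mul_right_cancel₀ hJu (e.trans ?_)
      unfold totalJac
      simp only [totalT_eq, totalX_eq, tu', xu', mul_zero, add_zero]
      change _ - (_ + sl u * _) * _ = _
      simp only [sl, cu] at r5 r6 ⊢
      field_simp
      ring
    have arg : jetArg (prolong1 φ.toFun (cu u)) = jetArg (prolong1 φ.toFun j) := by
      refine Prod.ext ?_ hp
      exact h4
    have arg0 : jetArg (cu u) = jetArg j := rfl
    rw [arg, hD] at r4
    rw [arg0] at r2
    refine ⟨r5, r2, ?_⟩
    refine mul_left_cancel₀ (pow_ne_zero 2 r6) ?_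
    linear_combination r4
  have rel0 := rel.self_of_nhds
  have e0 : pt j.1.2.2 = j.1 := rfl
  rw [e0] at rel0
  set G := partialUx (partialUx θ.g) (jetArg j)
  set G' := partialUx (partialUx θ'.g) (jetArg (prolong1 φ.toFun j))
  set f := θ.f (jetArg j)
  set f' := θ'.f (jetArg (prolong1 φ.toFun j))
  have hG' : G' ≠ 0 := by
    intro e
    have := rel0.2.2
    rw [e, mul_zero] at this
    exact (mul_ne_zero (mul_ne_zero (by norm_num) hf') hκ) this.symm
  -- Eliminating U_uu from the two relations expresses U_u through quantities that are constant
  -- along the curve.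
  have const : ∀ᶠ u in 𝓝 j.1.2.2, dU (compU φ.toFun) (pt u) = dU (compU φ.toFun) j.1 := by
    have key : ∀ V K : ℝ, V ≠ 0 → V * G = 2 * f * K → V ^ 2 * G' = -2 * f' * K →
        V = - f' * G / (f * G') := by
      intro V K hV h1 h2
      rw [eq_div_iff (mul_ne_zero hf hG')]
      refine mul_left_cancel₀ hV ?_
      linear_combination f * h2 + f' * h1
    filter_upwards [rel] with u hu
    rw [key _ _ hu.1 hu.2.1 hu.2.2, key _ _ rel0.1 rel0.2.1 rel0.2.2]
  have hd := hasDerivAt_dU (sU.dirDeriv (0, 0, 1)).diffAt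
  have e : (fun u => dU (compU φ.toFun) (j.1.1, j.1.2.1, u))
    =ᶠ[𝓝 j.1.2.2] fun _ => dU (compU φ.toFun) j.1 := const
  apply hκ
  rw [← hd.deriv, e.deriv_eq, deriv_const]

/-- The components of an admissible transformation have the form `T(t)`, `X(x)`, `U(t, x, u)`. -/
lemma fibre_preserving (hθ : θ ∈ waveClass) (hθ' : θ' ∈ waveClass)
    (h : ∀ᶠ i in 𝓝 j, DeterminingEqs θ θ' φ i) :
    dX (compT φ.toFun) j.1 = 0 ∧ dU (compT φ.toFun) j.1 = 0 ∧
      dT (compX φ.toFun) j.1 = 0 ∧ dU (compX φ.toFun) j.1 = 0 := by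
  have h0 := h.self_of_nhds
  obtain ⟨tu, xu⟩ := dU_compT_compX hθ h
  have hC : dT (compX φ.toFun) j.1 = 0 := by
    by_contra hC
    obtain ⟨-, sX, -⟩ := smooth_comps (φ.contDiffAt h0.mem_source)
    have hCev : ∀ᶠ i : J1 in 𝓝 j, dT (compX φ.toFun) i.1 ≠ 0 :=
      eventually_base_ne (sX.dirDeriv _) hC
    refine waveClass_not_linear hθ (j := j) ?_
    filter_upwards [h.eventually_nhds, hCev] with i h1 h2
    obtain ⟨r1, r2, -, -, r5, -⟩ := relations_of_dT_compX_ne_zero hθ h1 h2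
    refine ⟨h1.self_of_nhds.mem_dom, r1, ?_⟩
    rw [dU_dU_of_dT_compX_ne_zero hθ hθ' h1 h2, mul_zero] at r2
    exact (mul_eq_zero.mp r2).resolve_left r5
  refine ⟨?_, tu, hC, xu⟩
  have e1 := h0.eq1
  have e2 := h0.eq2
  have hJ := h0.jac
  unfold totalJac at hJ
  simp only [totalT_eq, totalX_eq, tu, xu, hC, mul_zero, add_zero, sub_zero] at e1 e2 hJ
  have := (mul_eq_zero.mp e1.symm).resolve_left
    (mul_ne_zero (hθ'.1 _ h0.mem_dom') (left_ne_zero_of_mul hJ))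
  exact this

end Fibre

/-! ## Fibre-preserving maps `(T(t), X(x), U(t, x, u))` -/

/-- `φ` is smooth and of the form `(T(t), X(x), U(t, x, u))` near `z`. -/
def FibreMap (φ : J0 → J0) (z : J0) : Prop :=
  ∀ᶠ y in 𝓝 z, ContDiffAt ℝ ∞ φ y ∧ (dX (compT φ) y = 0 ∧ dU (compT φ) y = 0) ∧
    dT (compX φ) y = 0 ∧ dU (compX φ) y = 0

/-- `T_tt / T_t`. -/
noncomputable def rateT (φ : J0 → J0) (z : J0) : ℝ := dT (dT (compT φ)) z / dT (compT φ) z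

/-- `X_xx / X_x`. -/
noncomputable def rateX (φ : J0 → J0) (z : J0) : ℝ := dX (dX (compX φ)) z / dX (compX φ) z

/-- `U_tt - (T_tt / T_t) U_t`. -/
noncomputable def accelU (φ : J0 → J0) (z : J0) : ℝ :=
  dT (dT (compU φ)) z - rateT φ z * dT (compU φ) z

section FibreMap

variable {φ : J0 → J0} {j : J1}

lemma FibreMap.totals (h : FibreMap φ j.1) :
    totalT (compT φ) j = dT (compT φ) j.1 ∧ totalX (compT φ) j = 0 ∧
      totalT (compX φ) j = 0 ∧ totalX (compX φ) j = dX (compX φ) j.1 := by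
  obtain ⟨-, ⟨h1, h2⟩, h3, h4⟩ := h.self_of_nhds
  simp [totalT_eq, totalX_eq, h1, h2, h3, h4]

lemma FibreMap.totalJac_eq (h : FibreMap φ j.1) :
    totalJac φ j = dT (compT φ) j.1 * dX (compX φ) j.1 := by
  obtain ⟨h1, h2, h3, h4⟩ := h.totals
  simp [totalJac, h1, h2, h3, h4]

lemma FibreMap.newU_eq (h : FibreMap φ j.1) (hJ : totalJac φ j ≠ 0) :
    newUt φ j = (dT (compU φ) j.1 + j.2.1 * dU (compU φ) j.1) / dT (compT φ) j.1 ∧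
      newUx φ j = (dX (compU φ) j.1 + j.2.2 * dU (compU φ) j.1) / dX (compX φ) j.1 := by
  obtain ⟨h1, h2, h3, h4⟩ := h.totals
  rw [h.totalJac_eq] at hJ
  have a := left_ne_zero_of_mul hJ
  have b := right_ne_zero_of_mul hJ
  unfold newUt newUx newDerivT newDerivX
  rw [h.totalJac_eq, h1, h2, h3, h4, totalT_eq, totalX_eq]
  constructor <;> field_simp <;> ring

lemma FibreMap.contactFactor_eq (h : FibreMap φ j.1) :
    contactFactor φ j = dU (compU φ) j.1 := by
  obtain ⟨-, ⟨h1, h2⟩, h3, h4⟩ := h.self_of_nhds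
  simp [contactFactor, h2, h4]

lemma FibreMap.contactHess_eq (h : FibreMap φ j.1) (hJ : totalJac φ j ≠ 0) :
    contactHess φ j (horT j) (horT j) = accelU φ j.1
        + j.2.1 * (2 * dT (dU (compU φ)) j.1 - rateT φ j.1 * dU (compU φ) j.1)
        + j.2.1 ^ 2 * dU (dU (compU φ)) j.1 ∧
      contactHess φ j (horX j) (horX j) = dX (dX (compU φ)) j.1
        - rateX φ j.1 * (dX (compU φ) j.1 + j.2.2 * dU (compU φ) j.1)
        + j.2.2 * (2 * dX (dU (compU φ)) j.1) + j.2.2 ^ 2 * dU (dU (compU φ)) j.1 := by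
  obtain ⟨n1, n2⟩ := h.newU_eq hJ
  obtain ⟨sT, sX, sU⟩ := smooth_comps h.self_of_nhds.1
  have t1 := dirDeriv_eq_zero (h.mono fun _ hz => hz.2.1.1)
  have t2 := dirDeriv_eq_zero (h.mono fun _ hz => hz.2.1.2)
  have x1 := dirDeriv_eq_zero (h.mono fun _ hz => hz.2.2.1)
  have x2 := dirDeriv_eq_zero (h.mono fun _ hz => hz.2.2.2)
  unfold contactHess accelU rateT rateX
  rw [hess_horT sT, hess_horT sX, hess_horT sU, hess_horX sT, hess_horX sX, hess_horX sU, n1, n2]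
  simp only [t1, t2, x1, x2]
  constructor <;> ring

lemma FibreMap.prolong2_eq {k : J2} (h : FibreMap φ k.1.1) (hJ : totalJac φ k.1 ≠ 0) :
    (prolong2 φ k).2.1 = (contactHess φ k.1 (horT k.1) (horT k.1) + k.2.1 * dU (compU φ) k.1.1)
        / dT (compT φ) k.1.1 ^ 2 ∧
      (prolong2 φ k).2.2.1 = (contactHess φ k.1 (horT k.1) (horX k.1)
        + k.2.2.1 * dU (compU φ) k.1.1) / (dT (compT φ) k.1.1 * dX (compX φ) k.1.1) ∧
      (prolong2 φ k).2.2.2 = (contactHess φ k.1 (horX k.1) (horX k.1)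
        + k.2.2.2 * dU (compU φ) k.1.1) / dX (compX φ) k.1.1 ^ 2 := by
  have hφ := h.self_of_nhds.1
  obtain ⟨h1, h2, h3, h4⟩ := h.totals
  have e := h.totalJac_eq
  obtain ⟨-, n3, -⟩ := total_newU hφ hJ
  obtain ⟨-, n3, n4⟩ := total_newU hφ hJ
  rw [prolong2_tt hφ hJ, prolong2_tx hφ hJ, prolong2_xx hφ hJ]
  unfold newDerivT
  rw [n3, n4, h1, h2, h3, h4, e]
  rw [e] at hJ
  have a := left_ne_zero_of_mul hJ
  have b := right_ne_zero_of_mul hJ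
  unfold contactTT contactTX contactXX
  rw [h.contactFactor_eq]
  refine ⟨?_, ?_, ?_⟩ <;> field_simp <;> ring

end FibreMap

/-- `F` is smooth near `z`, and its derivative in the direction `e` vanishes there. -/
def KilledNear (e : J0) (F : J0 → ℝ) (z : J0) : Prop :=
  ∀ᶠ y in 𝓝 z, ContDiffAt ℝ ∞ F y ∧ _root_.dirDeriv e F y = 0

lemma KilledNear.dirDeriv {e : J0} {F : J0 → ℝ} {z : J0} (h : KilledNear e F z) (v : J0) :
    KilledNear e (dirDeriv v F) z := by
  filter_upwards [h.eventually_nhds] with y hy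
  refine ⟨hy.self_of_nhds.1.dirDeriv v, ?_⟩
  rw [dirDeriv_comm hy.self_of_nhds.1]
  exact dirDeriv_eq_zero (hy.mono fun _ h => h.2) v

lemma tendsto_lineU (z : J0) :
    Filter.Tendsto (fun u : ℝ => ((z.1, z.2.1, u) : J0)) (𝓝 z.2.2) (𝓝 z) :=
  (by fun_prop : Continuous (fun u : ℝ => ((z.1, z.2.1, u) : J0))).tendsto z.2.2

lemma tendsto_lineX (z : J0) :
    Filter.Tendsto (fun x : ℝ => ((z.1, x, z.2.2) : J0)) (𝓝 z.2.1) (𝓝 z) :=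
  (by fun_prop : Continuous (fun x : ℝ => ((z.1, x, z.2.2) : J0))).tendsto z.2.1

lemma KilledNear.const_lineU {F : J0 → ℝ} {z : J0} (h : KilledNear (0, 0, 1) F z) :
    ∀ᶠ u in 𝓝 z.2.2, F (z.1, z.2.1, u) = F z := by
  refine eventually_const_of_deriv (g := fun u => F (z.1, z.2.1, u)) ?_
  filter_upwards [(tendsto_lineU z).eventually h] with u hu
  exact hu.2 ▸ hasDerivAt_dU hu.1.diffAt

lemma affine_lineU {F : J0 → ℝ} {z : J0} (hF : ∀ᶠ y in 𝓝 z, ContDiffAt ℝ ∞ F y)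
    (h : KilledNear (0, 0, 1) (dU F) z) :
    ∀ᶠ u in 𝓝 z.2.2, F (z.1, z.2.1, u) = F z + dU F z * (u - z.2.2) := by
  have := eventually_const_of_deriv (g := fun u => F (z.1, z.2.1, u) - dU F z * u) (s₀ := z.2.2) (by
    filter_upwards [(tendsto_lineU z).eventually hF, h.const_lineU] with u h1 h2
    have := (hasDerivAt_dU h1.diffAt).sub ((hasDerivAt_id u).const_mul (dU F z))
    refine this.congr_deriv ?_
    rw [h2]
    ring)
  filter_upwards [this] with u hu
  linear_combination hu

lemma smooth_rateT {φ : J0 → J0} {z : J0} (hφ : ContDiffAt ℝ ∞ φ z)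
    (h : dT (compT φ) z ≠ 0) : ContDiffAt ℝ ∞ (rateT φ) z :=
  ((((smooth_comps hφ).1.dirDeriv _).dirDeriv _).div ((smooth_comps hφ).1.dirDeriv _) h)

lemma smooth_accelU {φ : J0 → J0} {z : J0} (hφ : ContDiffAt ℝ ∞ φ z)
    (h : dT (compT φ) z ≠ 0) : ContDiffAt ℝ ∞ (accelU φ) z :=
  (((smooth_comps hφ).2.2.dirDeriv _).dirDeriv _).sub
    ((smooth_rateT hφ h).mul ((smooth_comps hφ).2.2.dirDeriv _))

lemma dirDeriv_mul {F G : J0 → ℝ} {z : J0} (hF : DifferentiableAt ℝ F z)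
    (hG : DifferentiableAt ℝ G z) (v : J0) :
    dirDeriv v (fun z => F z * G z) z = F z * dirDeriv v G z + dirDeriv v F z * G z := by
  unfold dirDeriv
  rw [fderiv_fun_mul hF hG]
  simp
  ring

lemma dirDeriv_sub {F G : J0 → ℝ} {z : J0} (hF : DifferentiableAt ℝ F z)
    (hG : DifferentiableAt ℝ G z) (v : J0) :
    dirDeriv v (fun z => F z - G z) z = dirDeriv v F z - dirDeriv v G z := by
  unfold dirDeriv
  rw [fderiv_fun_sub hF hG]
  simp

lemma dirDeriv_congr {F G : J0 → ℝ} {z : J0} (h : ∀ᶠ y in 𝓝 z, F y = G y) (v : J0) :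
    dirDeriv v F z = dirDeriv v G z := by
  have : F =ᶠ[𝓝 z] G := h
  unfold dirDeriv
  rw [this.fderiv_eq]

/-- Differentiating T_tt = `rateT` · T_t avoids the quotient rule: every derivative of T in the
killed direction drops out and T_t ≠ 0 remains as a factor. -/
lemma rateT_killed {φ : J0 → J0} {z v : J0} (hφ : ContDiffAt ℝ ∞ φ z)
    (h0 : dT (compT φ) z ≠ 0) (h : KilledNear v (compT φ) z) : dirDeriv v (rateT φ) z = 0 := by
  have s1 := (smooth_comps hφ).1.dirDeriv (1, 0, 0)
  have e : ∀ᶠ y in 𝓝 z, dT (dT (compT φ)) y = rateT φ y * dT (compT φ) y := by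
    filter_upwards [s1.continuousAt.eventually_ne h0] with y hy
    exact (div_mul_cancel₀ _ hy).symm
  have k := dirDeriv_congr e v
  rw [dirDeriv_mul (smooth_rateT hφ h0).diffAt s1.diffAt,
    ((h.dirDeriv _).dirDeriv _).self_of_nhds.2, (h.dirDeriv _).self_of_nhds.2, mul_zero,
    zero_add] at k
  exact (mul_eq_zero.mp k.symm).resolve_right h0

/-! ### Determining equations in the fibre-preserving case. -/

section Fibre

variable {θ θ' : ArbElem} {φ : PointTransformation J0} {j : J1}

lemma fibreMap_of_determiningEqs (hθ : θ ∈ waveClass) (hθ' : θ' ∈ waveClass)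
    (h : ∀ᶠ i in 𝓝 j, DeterminingEqs θ θ' φ i) : FibreMap φ.toFun j.1 := by
  refine eventually_base (h.eventually_nhds.mono fun i hi => ?_)
  obtain ⟨a, b, c, d⟩ := fibre_preserving hθ hθ' hi
  exact ⟨φ.contDiffAt hi.self_of_nhds.mem_source, ⟨a, b⟩, c, d⟩

/-- The determining equations for a transformation `(T(t), X(x), U(t, x, u))`. -/
structure FibreEqs (θ θ' : ArbElem) (φ : J0 → J0) (j : J1) : Prop where
  fibre : FibreMap φ j.1
  mem_dom : jetArg j ∈ θ.dom
  mem_dom' : (compX φ j.1, (dX (compU φ) j.1 + j.2.2 * dU (compU φ) j.1) / dX (compX φ) j.1)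
    ∈ θ'.dom
  Tt : dT (compT φ) j.1 ≠ 0
  Xx : dX (compX φ) j.1 ≠ 0
  Uu : dU (compU φ) j.1 ≠ 0
  eqF : θ'.f (compX φ j.1, (dX (compU φ) j.1 + j.2.2 * dU (compU φ) j.1) / dX (compX φ) j.1)
      * dT (compT φ) j.1 ^ 2 = θ.f (jetArg j) * dX (compX φ) j.1 ^ 2
  eqE : dU (compU φ) j.1 * θ.g (jetArg j)
      + (accelU φ j.1
        + j.2.1 * (2 * dT (dU (compU φ)) j.1 - rateT φ j.1 * dU (compU φ) j.1)
        + j.2.1 ^ 2 * dU (dU (compU φ)) j.1)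
      - θ.f (jetArg j) * (dX (dX (compU φ)) j.1
        - rateX φ j.1 * (dX (compU φ) j.1 + j.2.2 * dU (compU φ) j.1)
        + j.2.2 * (2 * dX (dU (compU φ)) j.1) + j.2.2 ^ 2 * dU (dU (compU φ)) j.1)
      = dT (compT φ) j.1 ^ 2 * θ'.g (compX φ j.1,
        (dX (compU φ) j.1 + j.2.2 * dU (compU φ) j.1) / dX (compX φ) j.1)

lemma fibreEqs_of_determiningEqs (hθ : θ ∈ waveClass) (hθ' : θ' ∈ waveClass)
    (h : ∀ᶠ i in 𝓝 j, DeterminingEqs θ θ' φ i) : FibreEqs θ θ' φ.toFun j := by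
  have hm := fibreMap_of_determiningEqs hθ hθ' h
  have h0 := h.self_of_nhds
  obtain ⟨n1, n2⟩ := hm.newU_eq h0.jac
  obtain ⟨c1, c2⟩ := hm.contactHess_eq h0.jac
  obtain ⟨t1, t2, t3, t4⟩ := hm.totals
  have hJ := h0.jac
  rw [hm.totalJac_eq] at hJ
  have a := left_ne_zero_of_mul hJ
  have b := right_ne_zero_of_mul hJ
  have hV := contactFactor_ne_zero hm.self_of_nhds.1 (φ.fderiv_surjective h0.mem_source) h0.jac
  rw [hm.contactFactor_eq] at hV
  have arg : jetArg (prolong1 φ.toFun j) = (compX φ.toFun j.1,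
      (dX (compU φ.toFun) j.1 + j.2.2 * dU (compU φ.toFun) j.1) / dX (compX φ.toFun) j.1) := by
    rw [← n2]; rfl
  refine ⟨hm, h0.mem_dom, arg ▸ h0.mem_dom', a, b, hV, ?_, ?_⟩
  · have := h0.eq4
    rwa [arg, t1, t4] at this
  · have := h0.eq5
    rw [arg, t2, t4, hm.contactFactor_eq, c1, c2, hm.totalJac_eq] at this
    -- With T_x = X_t = 0 both sides of `eq5` carry the factor X_x².
    refine mul_left_cancel₀ (pow_ne_zero 2 b) ?_
    linear_combination this

end Fibre

/-! ### Splitting with respect to `u_t` and u. -/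

section FibreEqs

variable {θ θ' : ArbElem} {φ : J0 → J0} {j : J1}

lemma tendsto_ut (j : J1) :
    Filter.Tendsto (fun s : ℝ => ((j.1, (s, j.2.2)) : J1)) (𝓝 j.2.1) (𝓝 j) :=
  (by fun_prop : Continuous (fun s : ℝ => ((j.1, (s, j.2.2)) : J1))).tendsto j.2.1

lemma tendsto_ux (j : J1) :
    Filter.Tendsto (fun r : ℝ => ((j.1, (j.2.1, r)) : J1)) (𝓝 j.2.2) (𝓝 j) :=
  (by fun_prop : Continuous (fun r : ℝ => ((j.1, (j.2.1, r)) : J1))).tendsto j.2.2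

lemma tendsto_t (j : J1) :
    Filter.Tendsto (fun t : ℝ => (((t, j.1.2.1, j.1.2.2), j.2) : J1)) (𝓝 j.1.1) (𝓝 j) :=
  (by fun_prop : Continuous (fun t : ℝ => (((t, j.1.2.1, j.1.2.2), j.2) : J1))).tendsto j.1.1

lemma tendsto_u (j : J1) :
    Filter.Tendsto (fun u : ℝ => (((j.1.1, j.1.2.1, u), j.2) : J1)) (𝓝 j.1.2.2) (𝓝 j) :=
  (by fun_prop : Continuous (fun u : ℝ => (((j.1.1, j.1.2.1, u), j.2) : J1))).tendsto j.1.2.2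

lemma tendsto_u_ux (j : J1) :
    Filter.Tendsto (fun q : ℝ × ℝ => (((j.1.1, j.1.2.1, q.1), (j.2.1, q.2)) : J1))
      (𝓝 (j.1.2.2, j.2.2)) (𝓝 j) :=
  (by fun_prop : Continuous (fun q : ℝ × ℝ =>
    (((j.1.1, j.1.2.1, q.1), (j.2.1, q.2)) : J1))).tendsto (j.1.2.2, j.2.2)

/-- In `eqE`, `u_t` enters only through an explicit quadratic polynomial, whose nonconstant
coefficients must vanish. -/
lemma FibreEqs.affine_in_u (h : ∀ᶠ i in 𝓝 j, FibreEqs θ θ' φ i) :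
    dU (dU (compU φ)) j.1 = 0 ∧
      2 * dT (dU (compU φ)) j.1 = rateT φ j.1 * dU (compU φ) j.1 := by
  have h0 := h.self_of_nhds.eqE
  obtain ⟨q1, q2, -⟩ := quadratic_eventually_zero (s₀ := j.2.1) (a := dU (dU (compU φ)) j.1)
    (b := 2 * dT (dU (compU φ)) j.1 - rateT φ j.1 * dU (compU φ) j.1)
    (c := - j.2.1 * (2 * dT (dU (compU φ)) j.1 - rateT φ j.1 * dU (compU φ) j.1)
      - j.2.1 ^ 2 * dU (dU (compU φ)) j.1) (by
      filter_upwards [(tendsto_ut j).eventually h] with s hs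
      have := hs.eqE
      have e : jetArg (j.1, (s, j.2.2)) = jetArg j := rfl
      rw [e] at this
      linear_combination this - h0)
  exact ⟨q1, by linear_combination q2⟩

/-- The coefficient of `u` in an admissible transformation does not depend on `x`. -/
lemma FibreEqs.dX_dU_compU (hθ : θ ∈ waveClass) (hθ' : θ' ∈ waveClass)
    (h : ∀ᶠ i in 𝓝 j, FibreEqs θ θ' φ i) : dX (dU (compU φ)) j.1 = 0 := by
  by_contra hne
  have sU := (smooth_comps h.self_of_nhds.fibre.self_of_nhds.1).2.2
  refine waveClass_not_linear hθ (j := j) ?_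
  filter_upwards [h.eventually_nhds, eventually_base_ne ((sU.dirDeriv _).dirDeriv _) hne]
    with i hi hne
  have i0 := hi.self_of_nhds
  refine ⟨i0.mem_dom, ?_⟩
  have hfib := i0.fibre
  have smooth : ∀ᶠ y in 𝓝 i.1, ContDiffAt ℝ ∞ (compU φ) y :=
    hfib.mono fun y hy => (smooth_comps hy.1).2.2
  have kU : KilledNear (0, 0, 1) (dU (compU φ)) i.1 := by
    have := eventually_base (j := i) (p := fun z => dU (dU (compU φ)) z = 0)
      (hi.eventually_nhds.mono fun _ hk => (affine_in_u hk).1)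
    filter_upwards [this, smooth] with y h1 h2 using ⟨h2.dirDeriv _, h1⟩
  -- second derivatives in `u` of the derivatives of `U` vanish
  have kd : ∀ {F : J0 → ℝ} (v : J0), (∀ᶠ y in 𝓝 i.1, ContDiffAt ℝ ∞ F y) →
      KilledNear (0, 0, 1) (dU F) i.1 → KilledNear (0, 0, 1) (dU (dirDeriv v F)) i.1 := by
    intro F v hF hk
    filter_upwards [hF.eventually_nhds, (hk.dirDeriv v).eventually_nhds] with y h1 h2
    refine ⟨(h1.self_of_nhds.dirDeriv _).dirDeriv _, ?_⟩
    have e : ∀ᶠ w in 𝓝 y, dU (dirDeriv v F) w = dirDeriv v (dU F) w :=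
      h1.mono fun w hw => dirDeriv_comm hw _ _
    exact (dirDeriv_congr e _).trans h2.self_of_nhds.2
  have sd : ∀ {F : J0 → ℝ} (v : J0), (∀ᶠ y in 𝓝 i.1, ContDiffAt ℝ ∞ F y) →
      ∀ᶠ y in 𝓝 i.1, ContDiffAt ℝ ∞ (dirDeriv v F) y :=
    fun v hF => hF.mono fun y hy => hy.dirDeriv v
  have kT : KilledNear (0, 0, 1) (compT φ) i.1 :=
    hfib.mono fun y hy => ⟨(smooth_comps hy.1).1, hy.2.1.2⟩
  have kX : KilledNear (0, 0, 1) (compX φ) i.1 :=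
    hfib.mono fun y hy => ⟨(smooth_comps hy.1).2.1, hy.2.2.2⟩
  -- Along the u-line every ingredient of `eqF` and `eqE` is constant or affine in u, so both take
  -- the form handled by the affine-argument lemmas, with s = u and γ = U_xu/X_x.
  have c1 : Filter.Tendsto (fun q : ℝ × ℝ => q.1) (𝓝 (i.1.2.2, i.2.2)) (𝓝 i.1.2.2) :=
    continuousAt_fst
  have eX := c1.eventually (affine_lineU (sd (0, 1, 0) smooth) (kd (0, 1, 0) smooth kU))
  have eXX := c1.eventually (affine_lineU (sd (0, 1, 0) (sd (0, 1, 0) smooth))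
    (kd (0, 1, 0) (sd (0, 1, 0) smooth) (kd (0, 1, 0) smooth kU)))
  have eT := c1.eventually (affine_lineU (sd (1, 0, 0) smooth) (kd (1, 0, 0) smooth kU))
  have eTT := c1.eventually (affine_lineU (sd (1, 0, 0) (sd (1, 0, 0) smooth))
    (kd (1, 0, 0) (sd (1, 0, 0) smooth) (kd (1, 0, 0) smooth kU)))
  have eV := c1.eventually kU.const_lineU
  have eUx := c1.eventually (kU.dirDeriv (0, 1, 0)).const_lineU
  have eUU := c1.eventually (kU.dirDeriv (0, 0, 1)).const_lineU
  have eTt := c1.eventually (kT.dirDeriv (1, 0, 0)).const_lineU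
  have eTtt := c1.eventually ((kT.dirDeriv (1, 0, 0)).dirDeriv (1, 0, 0)).const_lineU
  have eXx := c1.eventually (kX.dirDeriv (0, 1, 0)).const_lineU
  have eXxx := c1.eventually ((kX.dirDeriv (0, 1, 0)).dirDeriv (0, 1, 0)).const_lineU
  have eX0 := c1.eventually kX.const_lineU
  have hq := (tendsto_u_ux i).eventually hi
  have hT := i0.Tt
  have hX := i0.Xx
  have hV := i0.Uu
  have comm : dU (dX (compU φ)) i.1 = dX (dU (compU φ)) i.1 :=
    dirDeriv_comm smooth.self_of_nhds _ _
  have hγ : dX (dU (compU φ)) i.1 / dX (compX φ) i.1 ≠ 0 := div_ne_zero hne hX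
  have argp : ∀ u r : ℝ, (dX (compU φ) i.1 + dU (dX (compU φ)) i.1 * (u - i.1.2.2)
        + r * dU (compU φ) i.1) / dX (compX φ) i.1
      = (dX (compU φ) i.1 - dX (dU (compU φ)) i.1 * i.1.2.2) / dX (compX φ) i.1
      + dU (compU φ) i.1 / dX (compX φ) i.1 * r
      + dX (dU (compU φ)) i.1 / dX (compX φ) i.1 * u := fun u r => by
    rw [comm]
    field_simp
    ring
  -- Taking the reciprocal of f' turns the ratio in `eqF` into a product.
  obtain ⟨F1, -⟩ := const_of_product_const (f := fun r => θ.f (i.1.2.1, r))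
    (f' := fun p => (θ'.f (compX φ i.1, p))⁻¹) (s₀ := i.1.2.2) (r₀ := i.2.2)
    (α := (dX (compU φ) i.1 - dX (dU (compU φ)) i.1 * i.1.2.2) / dX (compX φ) i.1)
    (β := dU (compU φ) i.1 / dX (compX φ) i.1)
    (c := dT (compT φ) i.1 ^ 2 / dX (compX φ) i.1 ^ 2) hγ
    (div_ne_zero (pow_ne_zero 2 hT) (pow_ne_zero 2 hX)) (by
      filter_upwards [hq, eX, eV, eTt, eXx, eX0] with q hq e1 e2 e3 e4 e5
      have e := hq.eqF
      have hn := hθ'.1 _ hq.mem_dom'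
      dsimp only at e hn
      rw [e1, e2, e3, e4, e5, argp] at e
      rw [e1, e2, e4, e5, argp] at hn
      rw [eq_div_iff (pow_ne_zero 2 hX), mul_right_comm, mul_inv_eq_iff_eq_mul₀ hn]
      change θ.f (i.1.2.1, q.2) * _ = _
      rw [mul_comm (dT (compT φ) i.1 ^ 2)]
      exact e.symm)
  have d := hasDerivAt_snd (θ.contDiffAt_f i0.mem_dom).diffAt
  have e : (fun r => θ.f ((jetArg i).1, r)) =ᶠ[𝓝 (jetArg i).2] fun _ => θ.f (jetArg i) := F1
  refine ⟨by rw [← d.deriv, e.deriv_eq, deriv_const], ?_⟩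
  have c2 : Filter.Tendsto (fun q : ℝ × ℝ => q.2) (𝓝 (i.1.2.2, i.2.2)) (𝓝 i.2.2) :=
    continuousAt_snd
  -- No quadratic terms survive once U_uu = 0, hence κ = 0 and g_{u_x u_x} = 0, making the equation
  -- linear.
  obtain ⟨-, G2, -⟩ := quadratic_of_affine_argument (g := fun r => θ.g (i.1.2.1, r))
    (g' := fun p => θ'.g (compX φ i.1, p)) (s₀ := i.1.2.2) (r₀ := i.2.2)
    (α := (dX (compU φ) i.1 - dX (dU (compU φ)) i.1 * i.1.2.2) / dX (compX φ) i.1)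
    (β := dU (compU φ) i.1 / dX (compX φ) i.1) (M := 1) (N := dT (compT φ) i.1 ^ 2)
    (L := dU (compU φ) i.1) (φ := θ.f (jetArg i)) (κ := 0)
    (a₀ := dT (dT (compU φ)) i.1 - dU (dT (dT (compU φ))) i.1 * i.1.2.2
      - rateT φ i.1 * (dT (compU φ) i.1 - dU (dT (compU φ)) i.1 * i.1.2.2))
    (a₁ := dU (dT (dT (compU φ))) i.1 - rateT φ i.1 * dU (dT (compU φ)) i.1) (a₂ := 0)
    (b₀ := dX (dX (compU φ)) i.1 - dU (dX (dX (compU φ))) i.1 * i.1.2.2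
      - rateX φ i.1 * (dX (compU φ) i.1 - dU (dX (compU φ)) i.1 * i.1.2.2))
    (b₁ := dU (dX (dX (compU φ))) i.1 - rateX φ i.1 * dU (dX (compU φ)) i.1)
    (b₂ := 2 * dX (dU (compU φ)) i.1 - rateX φ i.1 * dU (compU φ) i.1)
    hγ one_ne_zero (pow_ne_zero 2 hT) hV (by
      filter_upwards [hq, eX, eV, eTt, eXx, eX0, eXX, eT, eTT, eUx, eUU, eTtt, eXxx,
        c2.eventually F1, (tendsto_u_ux i).eventually hi.eventually_nhds]
        with q hq e1 e2 e3 e4 e5 e6 e7 e8 e9 e10 e11 e12 f1 hq'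
      have e := hq.eqE
      have l := (affine_in_u hq').2
      have ff : θ.f (jetArg ((i.1.1, i.1.2.1, q.1), i.2.1, q.2)) = θ.f (jetArg i) := f1
      simp only [accelU, rateT, rateX] at e l ⊢
      rw [l, ff] at e
      rw [e1, e2, e3, e4, e5, e6, e7, e8, e9, e10, e11, e12, argp,
        show dU (dU (compU φ)) i.1 = 0 from kU.self_of_nhds.2] at e
      rw [← e]
      change _ * (_ * θ.g (jetArg ((i.1.1, i.1.2.1, q.1), i.2.1, q.2)) + _ - _) = _
      ring)
  rw [partialUx_partialUx ((θ.eventually_contDiffAt i0.mem_dom).mono fun _ h => h.2)]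
  rw [mul_zero] at G2
  exact (mul_eq_zero.mp G2).resolve_left hV

end FibreEqs

/-! ## `U_tt - (T_tt / T_t) U_t` depends on `t` only -/

lemma dirDeriv_const_mul {F : J0 → ℝ} {z : J0} (hF : DifferentiableAt ℝ F z) (c : ℝ) (v : J0) :
    dirDeriv v (fun z => c * F z) z = c * dirDeriv v F z := by
  unfold dirDeriv
  rw [fderiv_const_mul hF]
  simp

lemma smooth_rateX {φ : J0 → J0} {z : J0} (hφ : ContDiffAt ℝ ∞ φ z)
    (h : dX (compX φ) z ≠ 0) : ContDiffAt ℝ ∞ (rateX φ) z :=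
  ((((smooth_comps hφ).2.1.dirDeriv _).dirDeriv _).div ((smooth_comps hφ).2.1.dirDeriv _) h)

lemma rateX_killed {φ : J0 → J0} {z v : J0} (hφ : ContDiffAt ℝ ∞ φ z)
    (h0 : dX (compX φ) z ≠ 0) (h : KilledNear v (compX φ) z) : dirDeriv v (rateX φ) z = 0 := by
  have s1 := (smooth_comps hφ).2.1.dirDeriv (0, 1, 0)
  have e : ∀ᶠ y in 𝓝 z, dX (dX (compX φ)) y = rateX φ y * dX (compX φ) y := by
    filter_upwards [s1.continuousAt.eventually_ne h0] with y hy
    exact (div_mul_cancel₀ _ hy).symm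
  have k := dirDeriv_congr e v
  rw [dirDeriv_mul (smooth_rateX hφ h0).diffAt s1.diffAt,
    ((h.dirDeriv _).dirDeriv _).self_of_nhds.2, (h.dirDeriv _).self_of_nhds.2, mul_zero,
    zero_add] at k
  exact (mul_eq_zero.mp k.symm).resolve_right h0

section FibreMap

variable {φ : J0 → J0} {z : J0}

lemma FibreMap.killed_compT (h : FibreMap φ z) :
    KilledNear (0, 1, 0) (compT φ) z ∧ KilledNear (0, 0, 1) (compT φ) z :=
  ⟨h.mono fun _ hy => ⟨(smooth_comps hy.1).1, hy.2.1.1⟩,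
    h.mono fun _ hy => ⟨(smooth_comps hy.1).1, hy.2.1.2⟩⟩

lemma FibreMap.killed_compX (h : FibreMap φ z) :
    KilledNear (1, 0, 0) (compX φ) z ∧ KilledNear (0, 0, 1) (compX φ) z :=
  ⟨h.mono fun _ hy => ⟨(smooth_comps hy.1).2.1, hy.2.2.1⟩,
    h.mono fun _ hy => ⟨(smooth_comps hy.1).2.1, hy.2.2.2⟩⟩

lemma FibreMap.smooth_compU (h : FibreMap φ z) :
    ∀ᶠ y in 𝓝 z, ContDiffAt ℝ ∞ (compU φ) y :=
  h.mono fun _ hy => (smooth_comps hy.1).2.2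

end FibreMap

section FibreEqs

variable {θ θ' : ArbElem} {φ : J0 → J0} {j : J1}

lemma FibreEqs.killed_dU (hθ : θ ∈ waveClass) (hθ' : θ' ∈ waveClass)
    (h : ∀ᶠ i in 𝓝 j, FibreEqs θ θ' φ i) :
    KilledNear (0, 1, 0) (dU (compU φ)) j.1 ∧ KilledNear (0, 0, 1) (dU (compU φ)) j.1 := by
  have s := h.self_of_nhds.fibre.smooth_compU
  constructor
  · have := eventually_base (j := j) (p := fun z => dX (dU (compU φ)) z = 0)
      (h.eventually_nhds.mono fun _ hk => dX_dU_compU hθ hθ' hk)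
    filter_upwards [s, this] with y h1 h2 using ⟨h1.dirDeriv _, h2⟩
  · have := eventually_base (j := j) (p := fun z => dU (dU (compU φ)) z = 0)
      (h.eventually_nhds.mono fun _ hk => (affine_in_u hk).1)
    filter_upwards [s, this] with y h1 h2 using ⟨h1.dirDeriv _, h2⟩

/-- The simplified form of the second determining equation. -/
lemma FibreEqs.eqE' (hθ : θ ∈ waveClass) (hθ' : θ' ∈ waveClass)
    (h : ∀ᶠ i in 𝓝 j, FibreEqs θ θ' φ i) :
    dU (compU φ) j.1 * θ.g (jetArg j) + accelU φ j.1
      - θ.f (jetArg j) * (dX (dX (compU φ)) j.1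
        - rateX φ j.1 * (dX (compU φ) j.1 + j.2.2 * dU (compU φ) j.1))
      = dT (compT φ) j.1 ^ 2 * θ'.g (compX φ j.1,
        (dX (compU φ) j.1 + j.2.2 * dU (compU φ) j.1) / dX (compX φ) j.1) := by
  have e := h.self_of_nhds.eqE
  obtain ⟨a1, a2⟩ := affine_in_u h
  have a3 := dX_dU_compU hθ hθ' h
  rw [← e, a1, a2, a3]
  ring

/-- U_xu = 0 makes U_x, U_xx and ũ_x̃ independent of u, so in `eqE'` nothing except `accelU` could
vary with u. -/
lemma FibreEqs.dU_accelU (hθ : θ ∈ waveClass) (hθ' : θ' ∈ waveClass)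
    (h : ∀ᶠ i in 𝓝 j, FibreEqs θ θ' φ i) : dU (accelU φ) j.1 = 0 := by
  have h0 := h.self_of_nhds
  have hf := h0.fibre
  have s := hf.smooth_compU
  obtain ⟨kx, ku⟩ := killed_dU hθ hθ' h
  have kUx : KilledNear (0, 0, 1) (dX (compU φ)) j.1 := by
    filter_upwards [s, kx] with y h1 h2
    exact ⟨h1.dirDeriv _, (dirDeriv_comm h1 _ _).trans h2.2⟩
  have hd := hasDerivAt_dU (smooth_accelU hf.self_of_nhds.1 h0.Tt).diffAt
  have e : (fun u => accelU φ (j.1.1, j.1.2.1, u)) =ᶠ[𝓝 j.1.2.2] fun _ => accelU φ j.1 := by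
    have kT := hf.killed_compT.2
    have kX := hf.killed_compX.2
    filter_upwards [(tendsto_u j).eventually h.eventually_nhds, ku.const_lineU,
      kUx.const_lineU, (kUx.dirDeriv (0, 1, 0)).const_lineU,
      (kT.dirDeriv (1, 0, 0)).const_lineU, (kX.dirDeriv (0, 1, 0)).const_lineU,
      ((kX.dirDeriv (0, 1, 0)).dirDeriv (0, 1, 0)).const_lineU, kX.const_lineU]
      with u hu e1 e2 e3 e4 e5 e6 e7
    have q := eqE' hθ hθ' hu
    have q0 := eqE' hθ hθ' h
    have arg : jetArg ((j.1.1, j.1.2.1, u), j.2) = jetArg j := rfl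
    dsimp only at q
    unfold rateX at q q0
    rw [arg, e1, e2, e3, e4, e5, e6, e7] at q
    linear_combination q - q0
  rw [← hd.deriv, e.deriv_eq, deriv_const]

/-- Combine U_ttu = `rateT` · U_tu, which is the u-derivative of `accelU`, with the t-derivative of
2 U_tu = `rateT` · U_u. The result says that the Schwarzian derivative of T vanishes. -/
lemma FibreEqs.rate_equations (hθ : θ ∈ waveClass) (hθ' : θ' ∈ waveClass)
    (h : ∀ᶠ i in 𝓝 j, FibreEqs θ θ' φ i) :
    dT (rateT φ) j.1 = rateT φ j.1 ^ 2 / 2 := by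
  have h0 := h.self_of_nhds
  have hf := h0.fibre
  have s := hf.smooth_compU
  have hφ := hf.self_of_nhds.1
  have sU := s.self_of_nhds
  have sw := smooth_rateT hφ h0.Tt
  have a := dU_accelU hθ hθ' h
  have e1 : dU (accelU φ) j.1 = dU (dT (dT (compU φ))) j.1
      - (rateT φ j.1 * dU (dT (compU φ)) j.1 + dU (rateT φ) j.1 * dT (compU φ) j.1) := by
    rw [← dirDeriv_mul sw.diffAt (sU.dirDeriv _).diffAt,
      ← dirDeriv_sub ((sU.dirDeriv _).dirDeriv _).diffAt (sw.mul (sU.dirDeriv _)).diffAt]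
    rfl
  have c1 : ∀ᶠ y in 𝓝 j.1, dU (dT (compU φ)) y = dT (dU (compU φ)) y :=
    s.mono fun y hy => dirDeriv_comm hy _ _
  rw [rateT_killed hφ h0.Tt hf.killed_compT.2, dirDeriv_comm (sU.dirDeriv _),
    dirDeriv_congr c1, c1.self_of_nhds, a] at e1
  have c2 : ∀ᶠ y in 𝓝 j.1, 2 * dT (dU (compU φ)) y = rateT φ y * dU (compU φ) y :=
    eventually_base (h.eventually_nhds.mono fun _ hk => (affine_in_u hk).2)
  have e2 := dirDeriv_congr c2 (1, 0, 0)
  rw [dirDeriv_const_mul ((sU.dirDeriv _).dirDeriv _).diffAt,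
    dirDeriv_mul sw.diffAt (sU.dirDeriv _).diffAt] at e2
  have c20 := c2.self_of_nhds
  refine mul_right_cancel₀ h0.Uu ?_
  linear_combination -2 * e1 - e2 + rateT φ j.1 / 2 * c20

lemma FibreEqs.dX_accelU_eq (h : FibreEqs θ θ' φ j) :
    dX (accelU φ) j.1 = dT (dT (dX (compU φ))) j.1 - rateT φ j.1 * dT (dX (compU φ)) j.1 := by
  have hf := h.fibre
  have s := hf.smooth_compU
  have hφ := hf.self_of_nhds.1
  have sU := s.self_of_nhds
  have sw := smooth_rateT hφ h.Tt
  have e1 : dX (accelU φ) j.1 = dX (dT (dT (compU φ))) j.1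
      - (rateT φ j.1 * dX (dT (compU φ)) j.1 + dX (rateT φ) j.1 * dT (compU φ) j.1) := by
    rw [← dirDeriv_mul sw.diffAt (sU.dirDeriv _).diffAt,
      ← dirDeriv_sub ((sU.dirDeriv _).dirDeriv _).diffAt (sw.mul (sU.dirDeriv _)).diffAt]
    rfl
  have c1 : ∀ᶠ y in 𝓝 j.1, dX (dT (compU φ)) y = dT (dX (compU φ)) y :=
    s.mono fun y hy => dirDeriv_comm hy _ _
  rw [e1, rateT_killed hφ h.Tt hf.killed_compT.1, dirDeriv_comm (sU.dirDeriv _),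
    dirDeriv_congr c1, c1.self_of_nhds]
  ring

/-- The derivative of `ũ_x̃` with respect to `t`. -/
lemma FibreEqs.hasDerivAt_slope_t (h : FibreEqs θ θ' φ j) :
    HasDerivAt (fun s => (dX (compU φ) (s, j.1.2.1, j.1.2.2)
        + j.2.2 * dU (compU φ) (s, j.1.2.1, j.1.2.2)) / dX (compX φ) (s, j.1.2.1, j.1.2.2))
      ((dT (dX (compU φ)) j.1 + j.2.2 * dT (dU (compU φ)) j.1) / dX (compX φ) j.1) j.1.1 := by
  have sU := h.fibre.smooth_compU.self_of_nhds
  have kX := (h.fibre.killed_compX.1.dirDeriv (0, 1, 0)).self_of_nhds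
  have d1 := hasDerivAt_dT (sU.dirDeriv (0, 1, 0)).diffAt
  have d2 := hasDerivAt_dT (sU.dirDeriv (0, 0, 1)).diffAt
  have d3 := hasDerivAt_dT kX.1.diffAt
  rw [kX.2] at d3
  refine ((d1.add (d2.const_mul j.2.2)).div d3 h.Xx).congr_deriv ?_
  have := h.Xx
  field_simp
  ring

/-- The derivative of `ũ_x̃` with respect to `u_x`. -/
lemma hasDerivAt_slope_ux (φ : J0 → J0) (j : J1) (r : ℝ) :
    HasDerivAt (fun r => (dX (compU φ) j.1 + r * dU (compU φ) j.1) / dX (compX φ) j.1)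
      (dU (compU φ) j.1 / dX (compX φ) j.1) r := by
  simpa using (((hasDerivAt_id r).mul_const (dU (compU φ) j.1)).const_add
    (dX (compU φ) j.1)).div_const (dX (compX φ) j.1)

/-- Differentiate `eqF` in t and in `u_x`; both results contain the same partial derivative of f',
which is eliminated. What remains involves f alone. -/
lemma FibreEqs.derived_eqF (h : ∀ᶠ i in 𝓝 j, FibreEqs θ θ' φ i) :
    partialUx θ.f (jetArg j) * (2 * dT (dX (compU φ)) j.1
        + j.2.2 * (rateT φ j.1 * dU (compU φ) j.1))
      + 4 * θ.f (jetArg j) * (rateT φ j.1 * dU (compU φ) j.1) = 0 := by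
  have h0 := h.self_of_nhds
  have hf := h0.fibre
  have hφ := hf.self_of_nhds.1
  obtain ⟨-, a2⟩ := affine_in_u h
  have sf' := (θ'.contDiffAt_f h0.mem_dom').diffAt
  have kX := hf.killed_compX.1
  have sT := (smooth_comps hφ).1
  -- differentiation with respect to `t`
  have dX0 := hasDerivAt_dT kX.self_of_nhds.1.diffAt
  rw [kX.self_of_nhds.2] at dX0
  have dXx := hasDerivAt_dT (kX.dirDeriv (0, 1, 0)).self_of_nhds.1.diffAt
  rw [(kX.dirDeriv (0, 1, 0)).self_of_nhds.2] at dXx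
  have dTt := hasDerivAt_dT (sT.dirDeriv (1, 0, 0)).diffAt
  have D1 := (hasDerivAt_comp_snd (s := j.1.1) sf' dX0 h0.hasDerivAt_slope_t).mul (dTt.pow 2)
  have D2 := (dXx.pow 2).const_mul (θ.f (jetArg j))
  have E1 := D1.unique (D2.congr_of_eventuallyEq (by
    filter_upwards [(tendsto_t j).eventually h] with s hs using hs.eqF))
  -- differentiation with respect to `u_x`
  have D3 := (hasDerivAt_comp_snd (a := fun _ => compX φ j.1) (s := j.2.2) sf'
    (hasDerivAt_const _ _) (hasDerivAt_slope_ux φ j j.2.2)).mul_const (dT (compT φ) j.1 ^ 2)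
  have D4 := (hasDerivAt_snd (θ.contDiffAt_f h0.mem_dom).diffAt).mul_const (dX (compX φ) j.1 ^ 2)
  have E2 := D3.unique (D4.congr_of_eventuallyEq (by
    filter_upwards [(tendsto_ux j).eventually h] with r hr using hr.eqF))
  have E3 := h0.eqF
  have w : dT (dT (compT φ)) j.1 = rateT φ j.1 * dT (compT φ) j.1 :=
    (div_mul_cancel₀ _ h0.Tt).symm
  have hX := h0.Xx
  have hV := h0.Uu
  have hj : ((j.1.1, j.1.2.1, j.1.2.2) : J0) = j.1 := rfl
  simp only [Pi.pow_apply, hj] at E1 E2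
  rw [w] at E1
  norm_num at E1 E2
  field_simp at E1 E2
  refine mul_left_cancel₀ (pow_ne_zero 3 hX) ?_
  linear_combination 2 * dU (compU φ) j.1 * E1
    - 2 * (dT (dX (compU φ)) j.1 + j.2.2 * dT (dU (compU φ)) j.1) * E2
    - 4 * rateT φ j.1 * dU (compU φ) j.1 * dX (compX φ) j.1 * E3
    - partialUx θ.f (jetArg j) * dX (compX φ) j.1 ^ 3 * j.2.2 * a2

/-- One more t-derivative of `derived_eqF`, reduced by `rate_equations`, leaves f_{u_x} times U_ttx
− `rateT` · U_tx, which is the x-derivative of `accelU`. -/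
lemma FibreEqs.dX_accelU_of_partialUx_f (hθ : θ ∈ waveClass) (hθ' : θ' ∈ waveClass)
    (h : ∀ᶠ i in 𝓝 j, FibreEqs θ θ' φ i) (hne : partialUx θ.f (jetArg j) ≠ 0) :
    dX (accelU φ) j.1 = 0 := by
  have h0 := h.self_of_nhds
  have hf := h0.fibre
  have hφ := hf.self_of_nhds.1
  obtain ⟨-, a2⟩ := affine_in_u h
  have sU := hf.smooth_compU.self_of_nhds
  have d1 := hasDerivAt_dT ((sU.dirDeriv (0, 1, 0)).dirDeriv (1, 0, 0)).diffAt
  have d2 := (hasDerivAt_dT (smooth_rateT hφ h0.Tt).diffAt).mul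
    (hasDerivAt_dT (sU.dirDeriv (0, 0, 1)).diffAt)
  have D := (((d1.const_mul 2).add (d2.const_mul j.2.2)).const_mul
    (partialUx θ.f (jetArg j))).add (d2.const_mul (4 * θ.f (jetArg j)))
  have E := D.unique ((hasDerivAt_const j.1.1 (0 : ℝ)).congr_of_eventuallyEq (by
    filter_upwards [(tendsto_t j).eventually h.eventually_nhds] with s hs using derived_eqF hs))
  have R := derived_eqF h
  rw [rate_equations hθ hθ' h] at E
  rw [h0.dX_accelU_eq]
  refine mul_left_cancel₀ hne ?_
  linear_combination E / 2 - rateT φ j.1 / 2 * R - (partialUx θ.f (jetArg j) * j.2.2 / 4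
    + θ.f (jetArg j)) * rateT φ j.1 * a2

/-- The `u_x`-derivative of `eqE'`. It prepares the case f_{u_x} = 0, in which `derived_eqF` says
nothing about U_tx. -/
lemma FibreEqs.derived_eqE (hθ : θ ∈ waveClass) (hθ' : θ' ∈ waveClass)
    (h : ∀ᶠ i in 𝓝 j, FibreEqs θ θ' φ i) (hfu : partialUx θ.f (jetArg j) = 0) :
    dX (compX φ) j.1 * (partialUx θ.g (jetArg j) + θ.f (jetArg j) * rateX φ j.1)
      = dT (compT φ) j.1 ^ 2 * partialUx θ'.g (compX φ j.1,
        (dX (compU φ) j.1 + j.2.2 * dU (compU φ) j.1) / dX (compX φ) j.1) := by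
  have h0 := h.self_of_nhds
  have sg' := (θ'.contDiffAt_g h0.mem_dom').diffAt
  have D1 := (hasDerivAt_comp_snd (a := fun _ => compX φ j.1) (s := j.2.2) sg'
    (hasDerivAt_const _ _) (hasDerivAt_slope_ux φ j j.2.2)).const_mul (dT (compT φ) j.1 ^ 2)
  have df := hasDerivAt_snd (θ.contDiffAt_f h0.mem_dom).diffAt
  have dg := hasDerivAt_snd (θ.contDiffAt_g h0.mem_dom).diffAt
  rw [hfu] at df
  have dl : HasDerivAt (fun r => dX (dX (compU φ)) j.1
      - rateX φ j.1 * (dX (compU φ) j.1 + r * dU (compU φ) j.1))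
      (-(rateX φ j.1 * dU (compU φ) j.1)) j.2.2 := by
    simpa using ((((hasDerivAt_id j.2.2).mul_const (dU (compU φ) j.1)).const_add
      (dX (compU φ) j.1)).const_mul (rateX φ j.1)).const_sub (dX (dX (compU φ)) j.1)
  have D2 := ((dg.const_mul (dU (compU φ) j.1)).add_const (accelU φ j.1)).sub (df.mul dl)
  have E := D1.unique (D2.congr_of_eventuallyEq (by
    filter_upwards [(tendsto_ux j).eventually h.eventually_nhds] with r hr
    exact (eqE' hθ hθ' hr).symm))
  have hX := h0.Xx
  have hV := h0.Uu
  have hj : ((jetArg j).1, (jetArg j).2) = jetArg j := rfl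
  simp only [hj] at E
  set P := partialUx θ'.g (compX φ j.1,
    (dX (compU φ) j.1 + j.2.2 * dU (compU φ) j.1) / dX (compX φ) j.1)
  field_simp at E
  refine mul_left_cancel₀ hV ?_
  linear_combination -E

/-- When f does not depend on `u_x`, `derived_eqF` gives T_tt = 0. Differentiating `derived_eqE` in
t shows U_tx g'_{pp} = 0 with p = ũ_x̃; differentiating it in `u_x` transfers this to g. -/
lemma FibreEqs.second_derived_eqE (hθ : θ ∈ waveClass) (hθ' : θ' ∈ waveClass)
    (h : ∀ᶠ i in 𝓝 j, FibreEqs θ θ' φ i)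
    (hfu : ∀ᶠ i in 𝓝 j, partialUx θ.f (jetArg i) = 0) :
    dT (dX (compU φ)) j.1 * partialUx (partialUx θ.g) (jetArg j) = 0 := by
  have h0 := h.self_of_nhds
  have hf := h0.fibre
  have hφ := hf.self_of_nhds.1
  have hX := h0.Xx
  have hV := h0.Uu
  have hT := h0.Tt
  have sT := (smooth_comps hφ).1
  have sg' := (θ'.contDiffAt_g h0.mem_dom').partialUx.diffAt
  have w0 : rateT φ j.1 = 0 := by
    have R := derived_eqF h
    rw [hfu.self_of_nhds, zero_mul, zero_add, mul_comm] at R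
    have hff := hθ.1 _ h0.mem_dom
    have k := (mul_eq_zero.mp R).resolve_right (by positivity)
    exact (mul_eq_zero.mp k).resolve_right hV
  have a2 := (affine_in_u h).2
  rw [w0, zero_mul] at a2
  have Ttt : dT (dT (compT φ)) j.1 = 0 := by
    have : dT (dT (compT φ)) j.1 = rateT φ j.1 * dT (compT φ) j.1 :=
      (div_mul_cancel₀ _ h0.Tt).symm
    rw [this, w0, zero_mul]
  have kX := hf.killed_compX.1
  have dX0 := hasDerivAt_dT kX.self_of_nhds.1.diffAt
  rw [kX.self_of_nhds.2] at dX0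
  have dXx := hasDerivAt_dT (kX.dirDeriv (0, 1, 0)).self_of_nhds.1.diffAt
  rw [(kX.dirDeriv (0, 1, 0)).self_of_nhds.2] at dXx
  have dw := hasDerivAt_dT (smooth_rateX hφ hX).diffAt
  rw [rateX_killed hφ hX kX] at dw
  have dTt := hasDerivAt_dT (sT.dirDeriv (1, 0, 0)).diffAt
  rw [Ttt] at dTt
  -- differentiation with respect to `t`
  have D1 := (dTt.pow 2).mul (hasDerivAt_comp_snd (s := j.1.1) sg' dX0 h0.hasDerivAt_slope_t)
  have D2 := dXx.mul ((dw.const_mul (θ.f (jetArg j))).const_add (partialUx θ.g (jetArg j)))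
  have E1 := D1.unique (D2.congr_of_eventuallyEq (by
    filter_upwards [(tendsto_t j).eventually h.eventually_nhds,
      (tendsto_t j).eventually hfu] with s h1 h2
    exact (derived_eqE hθ hθ' h1 h2).symm))
  -- differentiation with respect to `u_x`
  have D3 := (hasDerivAt_comp_snd (a := fun _ => compX φ j.1) (s := j.2.2) sg'
    (hasDerivAt_const _ _) (hasDerivAt_slope_ux φ j j.2.2)).const_mul (dT (compT φ) j.1 ^ 2)
  have df := hasDerivAt_snd (θ.contDiffAt_f h0.mem_dom).diffAt
  rw [hfu.self_of_nhds] at df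
  have D4 := ((hasDerivAt_snd (θ.contDiffAt_g h0.mem_dom).partialUx.diffAt).add
    (df.mul_const (rateX φ j.1))).const_mul (dX (compX φ) j.1)
  have E2 := D3.unique (D4.congr_of_eventuallyEq (by
    filter_upwards [(tendsto_ux j).eventually h.eventually_nhds,
      (tendsto_ux j).eventually hfu] with r h1 h2
    exact (derived_eqE hθ hθ' h1 h2).symm))
  have hj : ((j.1.1, j.1.2.1, j.1.2.2) : J0) = j.1 := rfl
  simp only [Pi.pow_apply, hj] at E1 E2
  norm_num at E1 E2
  set P := partialUx (partialUx θ'.g) (compX φ j.1,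
    (dX (compU φ) j.1 + j.2.2 * dU (compU φ) j.1) / dX (compX φ) j.1)
  have a2' : dT (dU (compU φ)) j.1 = 0 := by linarith
  rw [a2'] at E1
  have E3 : dT (dX (compU φ)) j.1 * P = 0 := by
    simp only [hT, hX, mul_zero, add_zero, or_false, false_or] at E1
    rcases E1 with e | e <;> rw [e] <;> simp
  field_simp at E2
  refine mul_left_cancel₀ (pow_ne_zero 2 hX) ?_
  linear_combination dT (compT φ) j.1 ^ 2 * dU (compU φ) j.1 * E3 - dT (dX (compU φ)) j.1 * E2

/-- Were the x-derivative nonzero, it would stay so on an open set. There f_{u_x} = 0 by the first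
case, and then g_{u_x u_x} = 0, since otherwise U_tx would vanish locally. Thus the equation would
be linear on that set. -/
lemma FibreEqs.dX_accelU (hθ : θ ∈ waveClass) (hθ' : θ' ∈ waveClass)
    (h : ∀ᶠ i in 𝓝 j, FibreEqs θ θ' φ i) : dX (accelU φ) j.1 = 0 := by
  by_contra hne
  have h0 := h.self_of_nhds
  have ha := eventually_base_ne ((smooth_accelU h0.fibre.self_of_nhds.1 h0.Tt).dirDeriv _) hne
  have hfu : ∀ᶠ i in 𝓝 j, partialUx θ.f (jetArg i) = 0 := by
    filter_upwards [h.eventually_nhds, ha] with i h1 h2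
    by_contra h3
    exact h2 (dX_accelU_of_partialUx_f hθ hθ' h1 h3)
  refine waveClass_not_linear hθ (j := j) ?_
  filter_upwards [h.eventually_nhds, ha, hfu.eventually_nhds] with i h1 h2 h3
  have i0 := h1.self_of_nhds
  refine ⟨i0.mem_dom, h3.self_of_nhds, ?_⟩
  by_contra h4
  have c : ContinuousAt (fun i => partialUx (partialUx θ.g) (jetArg i)) i :=
    ContinuousAt.comp (g := partialUx (partialUx θ.g))
      (θ.contDiffAt_g i0.mem_dom).partialUx.partialUx.continuousAt continuous_jetArg.continuousAt
  have z : ∀ᶠ y in 𝓝 i.1, dT (dX (compU φ)) y = 0 := by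
    refine eventually_base ?_
    filter_upwards [h1.eventually_nhds, h3.eventually_nhds, c.eventually_ne h4] with k k1 k2 k3
    exact (mul_eq_zero.mp (second_derived_eqE hθ hθ' k1 k2)).resolve_right k3
  apply h2
  rw [i0.dX_accelU_eq, dirDeriv_eq_zero z, z.self_of_nhds]
  ring

end FibreEqs

/-! ## Equivalence transformations of the class -/

/-- The data of `t̃ = c₁ t + c₀`, `x̃ = X(x)`, `ũ = c₂ u + c₄ t² + c₃ t + ψ(x)`. -/
structure EquivData where
  c0 : ℝ
  c1 : ℝ
  c2 : ℝ
  c3 : ℝ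
  c4 : ℝ
  X : PointTransformation ℝ
  ψ : ℝ → ℝ
  smooth_ψ : ContDiffOn ℝ ∞ ψ X.source

namespace EquivData

/-- `X'`. -/
noncomputable def X1 (E : EquivData) : ℝ → ℝ := deriv E.X.toFun

/-- `X''`. -/
noncomputable def X2 (E : EquivData) : ℝ → ℝ := deriv E.X1

/-- `ψ'`. -/
noncomputable def ψ1 (E : EquivData) : ℝ → ℝ := deriv E.ψ

/-- `ψ''`. -/
noncomputable def ψ2 (E : EquivData) : ℝ → ℝ := deriv E.ψ1

/-- The transformation of `(t, x, u)`. -/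
def map (E : EquivData) (z : J0) : J0 :=
  (E.c1 * z.1 + E.c0, E.X.toFun z.2.1,
    E.c2 * z.2.2 + (E.c4 * z.1 ^ 2 + E.c3 * z.1 + E.ψ z.2.1))

/-- The transformation of `(x, u_x)`. -/
noncomputable def argMap (E : EquivData) (b : ℝ × ℝ) : ℝ × ℝ :=
  (E.X.toFun b.1, (E.c2 * b.2 + E.ψ1 b.1) / E.X1 b.1)

/-- The first prolongation. -/
noncomputable def jetMap1 (E : EquivData) (j : J1) : J1 :=
  (E.map j.1, ((E.c2 * j.2.1 + (2 * E.c4 * j.1.1 + E.c3)) / E.c1,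
    (E.c2 * j.2.2 + E.ψ1 j.1.2.1) / E.X1 j.1.2.1))

/-- The second prolongation. -/
noncomputable def jetMap (E : EquivData) (k : J2) : J2 :=
  (E.jetMap1 k.1, ((E.c2 * k.2.1 + 2 * E.c4) / E.c1 ^ 2,
    E.c2 * k.2.2.1 / (E.c1 * E.X1 k.1.1.2.1),
    (E.c2 * k.2.2.2 + E.ψ2 k.1.1.2.1 - E.X2 k.1.1.2.1 / E.X1 k.1.1.2.1
      * (E.c2 * k.1.2.2 + E.ψ1 k.1.1.2.1)) / E.X1 k.1.1.2.1 ^ 2))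

/-- The transformation of the arbitrary elements `(f, g)` over `b = (x, u_x)`. -/
noncomputable def valMap (E : EquivData) (b y : ℝ × ℝ) : ℝ × ℝ :=
  (E.X1 b.1 ^ 2 * y.1 / E.c1 ^ 2,
    (E.c2 * y.2 + 2 * E.c4 - y.1 * (E.ψ2 b.1 - E.X2 b.1 / E.X1 b.1
      * (E.c2 * b.2 + E.ψ1 b.1))) / E.c1 ^ 2)

/-- The transformation of the space of `(t, x, u₍₂₎, f, g)`. -/
noncomputable def bigMap (E : EquivData) (w : J2 × (ℝ × ℝ)) : J2 × (ℝ × ℝ) :=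
  (E.jetMap w.1, E.valMap (jetArg w.1.1) w.2)

/-- `E'` is the inverse of `E`. -/
structure IsInverse (E E' : EquivData) : Prop where
  X_eq : E'.X = E.X.inverse
  h1 : E'.c1 * E.c1 = 1
  h0 : E'.c1 * E.c0 + E'.c0 = 0
  h2 : E'.c2 * E.c2 = 1
  h4 : E'.c2 * E.c4 + E'.c4 * E.c1 ^ 2 = 0
  h3 : E'.c2 * E.c3 + 2 * E'.c4 * E.c1 * E.c0 + E'.c3 * E.c1 = 0
  hψ : ∀ x ∈ E.X.source,
    E'.c2 * E.ψ x + E'.c4 * E.c0 ^ 2 + E'.c3 * E.c0 + E'.ψ (E.X.toFun x) = 0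

variable {E E' : EquivData}

lemma IsInverse.c1_ne (h : IsInverse E E') : E.c1 ≠ 0 := right_ne_zero_of_mul_eq_one h.h1

lemma IsInverse.c2_ne (h : IsInverse E E') : E.c2 ≠ 0 := right_ne_zero_of_mul_eq_one h.h2

lemma IsInverse.coeffs (h : IsInverse E E') : E'.c1 = 1 / E.c1 ∧ E'.c0 = - E.c0 / E.c1 ∧
    E'.c2 = 1 / E.c2 ∧ E'.c4 = - E.c4 / (E.c2 * E.c1 ^ 2) ∧
    E'.c3 = (2 * E.c4 * E.c0 / E.c1 - E.c3) / (E.c2 * E.c1) := by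
  have n1 := h.c1_ne
  have n2 := h.c2_ne
  have e1 : E'.c1 = 1 / E.c1 := eq_div_of_mul_eq n1 h.h1
  have e2 : E'.c2 = 1 / E.c2 := eq_div_of_mul_eq n2 h.h2
  have h0 := h.h0
  have h4 := h.h4
  have h3 := h.h3
  rw [e1] at h0
  rw [e2] at h4 h3
  have e4 : E'.c4 = - E.c4 / (E.c2 * E.c1 ^ 2) := by
    field_simp at h4 ⊢
    linear_combination h4
  rw [e4] at h3
  refine ⟨e1, ?_, e2, e4, ?_⟩
  · field_simp at h0 ⊢
    linear_combination h0
  · field_simp at h3 ⊢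
    linear_combination h3

lemma IsInverse.symm (h : IsInverse E E') : IsInverse E' E := by
  have n1 := h.c1_ne
  have n2 := h.c2_ne
  obtain ⟨e1, e0, e2, e4, e3⟩ := h.coeffs
  refine ⟨?_, ?_, ?_, ?_, ?_, ?_, ?_⟩
  · rw [h.X_eq]; rfl
  · rw [mul_comm]; exact h.h1
  · rw [e0]; field_simp; ring
  · rw [mul_comm]; exact h.h2
  · rw [e4, e1]; field_simp; ring
  · rw [e3, e1, e0]; field_simp; ring
  · intro y hy
    rw [h.X_eq] at hy ⊢
    have hy' : y ∈ E.X.target := hy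
    have hx : E.X.invFun y ∈ E.X.source := E.X.map_target' hy'
    have e : E.X.toFun (E.X.invFun y) = y := E.X.right_inv' hy'
    have k := h.hψ _ hx
    rw [e, e2, e3, e4] at k
    change E.c2 * E'.ψ y + E.c4 * E'.c0 ^ 2 + E.c3 * E'.c0 + E.ψ (E.X.invFun y) = 0
    rw [e0]
    field_simp at k ⊢
    linear_combination k

lemma contDiffAt_X {x : ℝ} (hx : x ∈ E.X.source) :
    ContDiffAt ℝ ∞ E.X.toFun x ∧ ContDiffAt ℝ ∞ E.X1 x ∧ ContDiffAt ℝ ∞ E.X2 x := by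
  have h : ContDiffOn ℝ ∞ E.X.toFun E.X.source := E.X.smooth_toFun
  have h1 : ContDiffOn ℝ ∞ E.X1 E.X.source := h.deriv_of_isOpen E.X.open_source (by norm_cast)
  have h2 : ContDiffOn ℝ ∞ E.X2 E.X.source := h1.deriv_of_isOpen E.X.open_source (by norm_cast)
  have n := E.X.open_source.mem_nhds hx
  exact ⟨h.contDiffAt n, h1.contDiffAt n, h2.contDiffAt n⟩

lemma contDiffAt_ψ {x : ℝ} (hx : x ∈ E.X.source) :
    ContDiffAt ℝ ∞ E.ψ x ∧ ContDiffAt ℝ ∞ E.ψ1 x ∧ ContDiffAt ℝ ∞ E.ψ2 x := by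
  have h : ContDiffOn ℝ ∞ E.ψ E.X.source := E.smooth_ψ
  have h1 : ContDiffOn ℝ ∞ E.ψ1 E.X.source := h.deriv_of_isOpen E.X.open_source (by norm_cast)
  have h2 : ContDiffOn ℝ ∞ E.ψ2 E.X.source := h1.deriv_of_isOpen E.X.open_source (by norm_cast)
  have n := E.X.open_source.mem_nhds hx
  exact ⟨h.contDiffAt n, h1.contDiffAt n, h2.contDiffAt n⟩

lemma hasDerivAt_X {x : ℝ} (hx : x ∈ E.X.source) :
    HasDerivAt E.X.toFun (E.X1 x) x ∧ HasDerivAt E.X1 (E.X2 x) x :=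
  ⟨(contDiffAt_X hx).1.diffAt.hasDerivAt, (contDiffAt_X hx).2.1.diffAt.hasDerivAt⟩

lemma hasDerivAt_ψ {x : ℝ} (hx : x ∈ E.X.source) :
    HasDerivAt E.ψ (E.ψ1 x) x ∧ HasDerivAt E.ψ1 (E.ψ2 x) x :=
  ⟨(contDiffAt_ψ hx).1.diffAt.hasDerivAt, (contDiffAt_ψ hx).2.1.diffAt.hasDerivAt⟩

lemma IsInverse.mem_source (h : IsInverse E E') {x : ℝ} (hx : x ∈ E.X.source) :
    E.X.toFun x ∈ E'.X.source := by
  rw [h.X_eq]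
  exact E.X.map_source' hx

lemma IsInverse.X_left_inv (h : IsInverse E E') {x : ℝ} (hx : x ∈ E.X.source) :
    E'.X.toFun (E.X.toFun x) = x := by
  rw [h.X_eq]
  exact E.X.left_inv' hx

lemma IsInverse.deriv_X (h : IsInverse E E') {x : ℝ} (hx : x ∈ E.X.source) :
    E'.X1 (E.X.toFun x) * E.X1 x = 1 ∧
      E'.X2 (E.X.toFun x) * E.X1 x ^ 2 + E'.X1 (E.X.toFun x) * E.X2 x = 0 := by
  have first : ∀ y ∈ E.X.source, E'.X1 (E.X.toFun y) * E.X1 y = 1 := by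
    intro y hy
    have d := (hasDerivAt_X (h.mem_source hy)).1.comp y (hasDerivAt_X hy).1
    refine d.unique ((hasDerivAt_id y).congr_of_eventuallyEq ?_)
    filter_upwards [E.X.open_source.mem_nhds hy] with s hs using h.X_left_inv hs
  refine ⟨first x hx, ?_⟩
  have d := ((hasDerivAt_X (h.mem_source hx)).2.comp x (hasDerivAt_X hx).1).mul (hasDerivAt_X hx).2
  have e := d.unique ((hasDerivAt_const x (1 : ℝ)).congr_of_eventuallyEq (by
    filter_upwards [E.X.open_source.mem_nhds hx] with s hs using first s hs))
  simp only [Function.comp_apply] at e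
  linear_combination e

lemma IsInverse.deriv_ψ (h : IsInverse E E') {x : ℝ} (hx : x ∈ E.X.source) :
    E'.ψ1 (E.X.toFun x) * E.X1 x = - (E'.c2 * E.ψ1 x) ∧
      E'.ψ2 (E.X.toFun x) * E.X1 x ^ 2 + E'.ψ1 (E.X.toFun x) * E.X2 x = - (E'.c2 * E.ψ2 x) := by
  have first : ∀ y ∈ E.X.source, E'.ψ1 (E.X.toFun y) * E.X1 y = - (E'.c2 * E.ψ1 y) := by
    intro y hy
    have d := (hasDerivAt_ψ (h.mem_source hy)).1.comp y (hasDerivAt_X hy).1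
    refine d.unique ((((hasDerivAt_ψ hy).1.const_mul E'.c2).neg.sub_const
      (E'.c4 * E.c0 ^ 2 + E'.c3 * E.c0)).congr_of_eventuallyEq ?_)
    filter_upwards [E.X.open_source.mem_nhds hy] with s hs
    have := h.hψ s hs
    simp only [Function.comp_apply, Pi.neg_apply]
    linear_combination this
  refine ⟨first x hx, ?_⟩
  have d := ((hasDerivAt_ψ (h.mem_source hx)).2.comp x (hasDerivAt_X hx).1).mul (hasDerivAt_X hx).2
  have e := d.unique (((hasDerivAt_ψ hx).2.const_mul E'.c2).neg.congr_of_eventuallyEq (by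
    filter_upwards [E.X.open_source.mem_nhds hx] with s hs using first s hs))
  simp only [Function.comp_apply] at e
  linear_combination e

lemma IsInverse.X1_ne (h : IsInverse E E') {x : ℝ} (hx : x ∈ E.X.source) : E.X1 x ≠ 0 :=
  right_ne_zero_of_mul_eq_one (h.deriv_X hx).1

lemma IsInverse.derivs (h : IsInverse E E') {x : ℝ} (hx : x ∈ E.X.source) :
    E'.X1 (E.X.toFun x) = 1 / E.X1 x ∧ E'.X2 (E.X.toFun x) = - E.X2 x / E.X1 x ^ 3 ∧
      E'.ψ1 (E.X.toFun x) = - E.ψ1 x / (E.c2 * E.X1 x) ∧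
      E'.ψ2 (E.X.toFun x) = (E.ψ1 x * E.X2 x / E.X1 x - E.ψ2 x) / (E.c2 * E.X1 x ^ 2) := by
  have n := h.X1_ne hx
  have n2 := h.c2_ne
  obtain ⟨a1, a2⟩ := h.deriv_X hx
  obtain ⟨b1, b2⟩ := h.deriv_ψ hx
  have e2 := h.coeffs.2.2.1
  have k1 : E'.X1 (E.X.toFun x) = 1 / E.X1 x := eq_div_of_mul_eq n a1
  rw [k1] at a2
  rw [e2] at b1 b2
  have k3 : E'.ψ1 (E.X.toFun x) = - E.ψ1 x / (E.c2 * E.X1 x) := by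
    field_simp at b1 ⊢
    linear_combination b1
  rw [k3] at b2
  refine ⟨k1, ?_, k3, ?_⟩
  · field_simp at a2 ⊢
    linear_combination a2
  · field_simp at b2 ⊢
    linear_combination b2

/-- The conditions in `IsInverse` are the coefficients of the composed map, compared with the
identity monomial by monomial in t and u; `hψ` absorbs the part depending on x only. -/
lemma IsInverse.map_left_inv (h : IsInverse E E') {z : J0} (hz : z.2.1 ∈ E.X.source) :
    E'.map (E.map z) = z := by
  obtain ⟨t, x, u⟩ := z
  have k := h.hψ x hz
  have n1 := h.c1_ne
  have n2 := h.c2_ne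
  obtain ⟨e1, e0, e2, e4, e3⟩ := h.coeffs
  simp only [map, Prod.mk.injEq]
  refine ⟨?_, h.X_left_inv hz, ?_⟩
  · linear_combination t * h.h1 + h.h0
  · linear_combination u * h.h2 + t ^ 2 * h.h4 + t * h.h3 + k

lemma IsInverse.jetMap1_left_inv (h : IsInverse E E') {j : J1} (hj : j.1.2.1 ∈ E.X.source) :
    E'.jetMap1 (E.jetMap1 j) = j := by
  obtain ⟨⟨t, x, u⟩, ut, ux⟩ := j
  have n1 := h.c1_ne
  have n2 := h.c2_ne
  have n := h.X1_ne hj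
  obtain ⟨e1, e0, e2, e4, e3⟩ := h.coeffs
  obtain ⟨k1, k2, k3, k4⟩ := h.derivs hj
  refine Prod.ext (h.map_left_inv hj) (Prod.ext ?_ ?_)
  · simp only [jetMap1, map]
    rw [e1, e2, e3, e4]
    field_simp
    ring
  · simp only [jetMap1, map] at n k1 k2 k3 k4 ⊢
    rw [e2, k1, k3]
    field_simp
    ring

lemma IsInverse.argMap_left_inv (h : IsInverse E E') {b : ℝ × ℝ} (hb : b.1 ∈ E.X.source) :
    E'.argMap (E.argMap b) = b := by
  have n2 := h.c2_ne
  have n := h.X1_ne hb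
  obtain ⟨k1, k2, k3, k4⟩ := h.derivs hb
  refine Prod.ext (h.X_left_inv hb) ?_
  simp only [argMap]
  rw [h.coeffs.2.2.1, k1, k3]
  field_simp
  ring

lemma IsInverse.valMap_left_inv (h : IsInverse E E') {b : ℝ × ℝ} (hb : b.1 ∈ E.X.source)
    (y : ℝ × ℝ) : E'.valMap (E.argMap b) (E.valMap b y) = y := by
  have n1 := h.c1_ne
  have n2 := h.c2_ne
  have n := h.X1_ne hb
  obtain ⟨e1, e0, e2, e4, e3⟩ := h.coeffs
  obtain ⟨k1, k2, k3, k4⟩ := h.derivs hb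
  refine Prod.ext ?_ ?_
  · simp only [valMap, argMap]
    rw [e1, k1]
    field_simp
  · simp only [valMap, argMap]
    rw [e1, e2, e4, k1, k2, k3, k4]
    field_simp
    ring

lemma IsInverse.bigMap_left_inv (h : IsInverse E E') {w : J2 × (ℝ × ℝ)}
    (hw : w.1.1.1.2.1 ∈ E.X.source) : E'.bigMap (E.bigMap w) = w := by
  have n1 := h.c1_ne
  have n2 := h.c2_ne
  have n := h.X1_ne hw
  obtain ⟨e1, e0, e2, e4, e3⟩ := h.coeffs
  obtain ⟨k1, k2, k3, k4⟩ := h.derivs hw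
  refine Prod.ext (Prod.ext (h.jetMap1_left_inv hw) (Prod.ext ?_ (Prod.ext ?_ ?_)))
    (h.valMap_left_inv (b := jetArg w.1.1) hw w.2)
  · simp only [bigMap, jetMap]
    rw [e1, e2, e4]
    field_simp
    ring
  · simp only [bigMap, jetMap, jetMap1, map]
    rw [e1, e2, k1]
    field_simp
  · simp only [bigMap, jetMap, jetMap1, map]
    rw [e2, k1, k2, k3, k4]
    field_simp
    ring

lemma contDiffAt_map {z : J0} (hz : z.2.1 ∈ E.X.source) : ContDiffAt ℝ ∞ E.map z := by
  have hx : ContDiffAt ℝ ∞ (fun z : J0 => z.2.1) z := by fun_prop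
  have a : ContDiffAt ℝ ∞ (fun z : J0 => E.X.toFun z.2.1) z :=
    ContDiffAt.comp (g := E.X.toFun) z (contDiffAt_X hz).1 hx
  have b : ContDiffAt ℝ ∞ (fun z : J0 => E.ψ z.2.1) z :=
    ContDiffAt.comp (g := E.ψ) z (contDiffAt_ψ hz).1 hx
  have c : ContDiffAt ℝ ∞ (fun z : J0 => E.c1 * z.1 + E.c0) z := by fun_prop
  have d : ContDiffAt ℝ ∞ (fun z : J0 => E.c2 * z.2.2) z := by fun_prop
  have d' : ContDiffAt ℝ ∞ (fun z : J0 => E.c4 * z.1 ^ 2 + E.c3 * z.1) z := by fun_prop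
  exact c.prodMk (a.prodMk (d.add (d'.add b)))

lemma contDiffAt_bigMap {w : J2 × (ℝ × ℝ)} (hw : w.1.1.1.2.1 ∈ E.X.source)
    (n1 : E.c1 ≠ 0) (n : E.X1 w.1.1.1.2.1 ≠ 0) : ContDiffAt ℝ ∞ E.bigMap w := by
  have hx : ContDiffAt ℝ ∞ (fun w : J2 × (ℝ × ℝ) => w.1.1.1.2.1) w := by fun_prop
  have a1 : ContDiffAt ℝ ∞ (fun w : J2 × (ℝ × ℝ) => E.X1 w.1.1.1.2.1) w :=
    ContDiffAt.comp (g := E.X1) w (contDiffAt_X hw).2.1 hx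
  have a2 : ContDiffAt ℝ ∞ (fun w : J2 × (ℝ × ℝ) => E.X2 w.1.1.1.2.1) w :=
    ContDiffAt.comp (g := E.X2) w (contDiffAt_X hw).2.2 hx
  have b1 : ContDiffAt ℝ ∞ (fun w : J2 × (ℝ × ℝ) => E.ψ1 w.1.1.1.2.1) w :=
    ContDiffAt.comp (g := E.ψ1) w (contDiffAt_ψ hw).2.1 hx
  have b2 : ContDiffAt ℝ ∞ (fun w : J2 × (ℝ × ℝ) => E.ψ2 w.1.1.1.2.1) w :=
    ContDiffAt.comp (g := E.ψ2) w (contDiffAt_ψ hw).2.2 hx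
  have m : ContDiffAt ℝ ∞ (fun w : J2 × (ℝ × ℝ) => E.map w.1.1.1) w :=
    ContDiffAt.comp (g := E.map) w (contDiffAt_map hw)
      (by fun_prop : ContDiffAt ℝ ∞ (fun w : J2 × (ℝ × ℝ) => w.1.1.1) w)
  have ut : ContDiffAt ℝ ∞ (fun w : J2 × (ℝ × ℝ) =>
    E.c2 * w.1.1.2.1 + (2 * E.c4 * w.1.1.1.1 + E.c3)) w := by fun_prop
  have ux : ContDiffAt ℝ ∞ (fun w : J2 × (ℝ × ℝ) => E.c2 * w.1.1.2.2) w := by fun_prop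
  have utt : ContDiffAt ℝ ∞ (fun w : J2 × (ℝ × ℝ) => E.c2 * w.1.2.1 + 2 * E.c4) w := by fun_prop
  have utx : ContDiffAt ℝ ∞ (fun w : J2 × (ℝ × ℝ) => E.c2 * w.1.2.2.1) w := by fun_prop
  have uxx : ContDiffAt ℝ ∞ (fun w : J2 × (ℝ × ℝ) => E.c2 * w.1.2.2.2) w := by fun_prop
  have vf : ContDiffAt ℝ ∞ (fun w : J2 × (ℝ × ℝ) => w.2.1) w := by fun_prop
  have vg : ContDiffAt ℝ ∞ (fun w : J2 × (ℝ × ℝ) => E.c2 * w.2.2 + 2 * E.c4) w := by fun_prop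
  have r := (a2.div a1 n).mul (ux.add b1)
  have cc : ContDiffAt ℝ ∞ (fun _ : J2 × (ℝ × ℝ) => E.c1) w := contDiffAt_const
  exact ((m.prodMk ((ut.div cc n1).prodMk ((ux.add b1).div a1 n))).prodMk
    ((utt.div (cc.pow 2) (pow_ne_zero 2 n1)).prodMk ((utx.div (cc.mul a1) (mul_ne_zero n1 n)).prodMk
      (((uxx.add b2).sub r).div (a1.pow 2) (pow_ne_zero 2 n))))).prodMk
    (((((a1.pow 2).mul vf).div (cc.pow 2) (pow_ne_zero 2 n1))).prodMk
      ((vg.sub (vf.mul (b2.sub r))).div (cc.pow 2) (pow_ne_zero 2 n1)))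

/-- The point transformation of the space of `(t, x, u)`. -/
def toPoint (h : IsInverse E E') : PointTransformation J0 where
  toFun := E.map
  invFun := E'.map
  source := {z | z.2.1 ∈ E.X.source}
  target := {z | z.2.1 ∈ E'.X.source}
  map_source' _ hz := h.mem_source hz
  map_target' _ hz := h.symm.mem_source hz
  left_inv' _ hz := h.map_left_inv hz
  right_inv' _ hz := h.symm.map_left_inv hz
  open_source := E.X.open_source.preimage (by fun_prop)
  open_target := E'.X.open_source.preimage (by fun_prop)
  continuousOn_toFun _ hz := (contDiffAt_map hz).continuousAt.continuousWithinAt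
  continuousOn_invFun _ hz := (contDiffAt_map hz).continuousAt.continuousWithinAt
  smooth_toFun _ hz := (contDiffAt_map hz).contDiffWithinAt
  smooth_invFun _ hz := (contDiffAt_map hz).contDiffWithinAt

/-- The point transformation of the space of `(t, x, u₍₂₎, f, g)`. -/
noncomputable def toBig (h : IsInverse E E') : PointTransformation (J2 × (ℝ × ℝ)) where
  toFun := E.bigMap
  invFun := E'.bigMap
  source := {w | w.1.1.1.2.1 ∈ E.X.source}
  target := {w | w.1.1.1.2.1 ∈ E'.X.source}
  map_source' _ hw := h.mem_source hw
  map_target' _ hw := h.symm.mem_source hw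
  left_inv' _ hw := h.bigMap_left_inv hw
  right_inv' _ hw := h.symm.bigMap_left_inv hw
  open_source := E.X.open_source.preimage (by fun_prop)
  open_target := E'.X.open_source.preimage (by fun_prop)
  continuousOn_toFun _ hw :=
    (contDiffAt_bigMap hw h.c1_ne (h.X1_ne hw)).continuousAt.continuousWithinAt
  continuousOn_invFun _ hw :=
    (contDiffAt_bigMap hw h.symm.c1_ne (h.symm.X1_ne hw)).continuousAt.continuousWithinAt
  smooth_toFun _ hw := (contDiffAt_bigMap hw h.c1_ne (h.X1_ne hw)).contDiffWithinAt
  smooth_invFun _ hw := (contDiffAt_bigMap hw h.symm.c1_ne (h.symm.X1_ne hw)).contDiffWithinAt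

end EquivData

/-! ### Prolongations of the explicit transformations and their action on the class. -/

namespace EquivData

variable {E E' : EquivData}

/-- All components of `map`, and their first derivatives, have this separated form, so one formula
serves both the first and the second derivatives. -/
lemma dirDeriv_separated {F : J0 → ℝ} {a b : ℝ → ℝ} {a' b' c : ℝ} {z : J0}
    (hF : ∀ z : J0, F z = a z.1 + b z.2.1 + c * z.2.2) (ha : HasDerivAt a a' z.1)
    (hb : HasDerivAt b b' z.2.1) (v : J0) :
    dirDeriv v F z = v.1 * a' + v.2.1 * b' + v.2.2 * c := by
  have h1 : HasFDerivAt (fun z : J0 => a z.1) (a' • ContinuousLinearMap.fst ℝ ℝ (ℝ × ℝ)) z :=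
    HasDerivAt.comp_hasFDerivAt (h₂ := a) (f := fun z : J0 => z.1) z ha hasFDerivAt_fst
  have h2 : HasFDerivAt (fun z : J0 => b z.2.1) (b' • (ContinuousLinearMap.fst ℝ ℝ ℝ).comp
      (ContinuousLinearMap.snd ℝ ℝ (ℝ × ℝ))) z :=
    HasDerivAt.comp_hasFDerivAt (h₂ := b) (f := fun z : J0 => z.2.1) z hb
      ((ContinuousLinearMap.fst ℝ ℝ ℝ).comp (ContinuousLinearMap.snd ℝ ℝ (ℝ × ℝ))).hasFDerivAt
  have h3 : HasFDerivAt (fun z : J0 => c * z.2.2) (c • (ContinuousLinearMap.snd ℝ ℝ ℝ).comp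
      (ContinuousLinearMap.snd ℝ ℝ (ℝ × ℝ))) z :=
    ((ContinuousLinearMap.snd ℝ ℝ ℝ).comp
      (ContinuousLinearMap.snd ℝ ℝ (ℝ × ℝ))).hasFDerivAt.const_mul c
  unfold dirDeriv
  rw [(((h1.add h2).add h3).congr_of_eventuallyEq (.of_forall hF)).fderiv]
  simp
  ring

lemma dirDeriv_compT (E : EquivData) (v z : J0) : dirDeriv v (compT E.map) z = v.1 * E.c1 := by
  have := dirDeriv_separated (F := compT E.map) (a := fun t => E.c1 * t + E.c0)
    (b := fun _ => 0) (c := 0) (z := z) (fun z => by simp [compT, map])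
    (((hasDerivAt_id z.1).const_mul E.c1).add_const E.c0) (hasDerivAt_const _ _) v
  simpa using this

lemma dirDeriv_compX {z : J0} (hz : z.2.1 ∈ E.X.source) (v : J0) :
    dirDeriv v (compX E.map) z = v.2.1 * E.X1 z.2.1 := by
  have := dirDeriv_separated (F := compX E.map) (a := fun _ => 0)
    (b := E.X.toFun) (c := 0) (z := z) (fun z => by simp [compX, map])
    (hasDerivAt_const _ _) (hasDerivAt_X hz).1 v
  simpa using this

lemma dirDeriv_compU {z : J0} (hz : z.2.1 ∈ E.X.source) (v : J0) :
    dirDeriv v (compU E.map) z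
      = v.1 * (2 * E.c4 * z.1 + E.c3) + v.2.1 * E.ψ1 z.2.1 + v.2.2 * E.c2 := by
  have d : HasDerivAt (fun t => E.c4 * t ^ 2 + E.c3 * t) (2 * E.c4 * z.1 + E.c3) z.1 := by
    have := (((hasDerivAt_pow 2 z.1).const_mul E.c4).add ((hasDerivAt_id z.1).const_mul E.c3))
    refine this.congr_deriv ?_
    simp
    ring
  exact dirDeriv_separated (F := compU E.map) (c := E.c2) (z := z)
    (fun z => by simp only [compU, map]; ring) d (hasDerivAt_ψ hz).1 v

lemma eventually_mem {z : J0} (hz : z.2.1 ∈ E.X.source) : ∀ᶠ y in 𝓝 z, y.2.1 ∈ E.X.source :=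
  (E.X.open_source.preimage (by fun_prop : Continuous fun z : J0 => z.2.1)).mem_nhds hz

lemma hess_compT (z v w : J0) : dirDeriv v (dirDeriv w (compT E.map)) z = 0 := by
  have e : ∀ᶠ y in 𝓝 z, dirDeriv w (compT E.map) y = (fun _ : J0 => w.1 * E.c1) y :=
    .of_forall fun y => E.dirDeriv_compT w y
  rw [dirDeriv_congr e]
  simp [dirDeriv]

lemma hess_compX {z : J0} (hz : z.2.1 ∈ E.X.source) (v w : J0) :
    dirDeriv v (dirDeriv w (compX E.map)) z = v.2.1 * w.2.1 * E.X2 z.2.1 := by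
  have e : ∀ᶠ y in 𝓝 z, dirDeriv w (compX E.map) y = (fun y : J0 => w.2.1 * E.X1 y.2.1) y :=
    (eventually_mem hz).mono fun y hy => dirDeriv_compX hy w
  rw [dirDeriv_congr e, dirDeriv_separated (a := fun _ => 0) (b := fun x => w.2.1 * E.X1 x)
    (c := 0) (fun z => by ring) (hasDerivAt_const _ _) ((hasDerivAt_X hz).2.const_mul w.2.1)]
  ring

lemma hess_compU {z : J0} (hz : z.2.1 ∈ E.X.source) (v w : J0) :
    dirDeriv v (dirDeriv w (compU E.map)) z
      = v.1 * w.1 * (2 * E.c4) + v.2.1 * w.2.1 * E.ψ2 z.2.1 := by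
  have e : ∀ᶠ y in 𝓝 z, dirDeriv w (compU E.map) y = (fun y : J0 =>
      w.1 * (2 * E.c4 * y.1 + E.c3) + w.2.1 * E.ψ1 y.2.1 + w.2.2 * E.c2) y :=
    (eventually_mem hz).mono fun y hy => dirDeriv_compU hy w
  have d : HasDerivAt (fun t => w.1 * (2 * E.c4 * t + E.c3)) (w.1 * (2 * E.c4)) z.1 := by
    simpa using (((hasDerivAt_id z.1).const_mul (2 * E.c4)).add_const E.c3).const_mul w.1
  rw [dirDeriv_congr e, dirDeriv_separated (a := fun t => w.1 * (2 * E.c4 * t + E.c3))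
    (b := fun x => w.2.1 * E.ψ1 x + w.2.2 * E.c2)
    (c := 0) (fun z => by ring) d (((hasDerivAt_ψ hz).2.const_mul w.2.1).add_const _)]
  ring

lemma fibreMap {z : J0} (hz : z.2.1 ∈ E.X.source) : FibreMap E.map z := by
  filter_upwards [eventually_mem hz] with y hy
  refine ⟨contDiffAt_map hy, ⟨?_, ?_⟩, ?_, ?_⟩
  · simp [dirDeriv_compT]
  · simp [dirDeriv_compT]
  · simp [dirDeriv_compX hy]
  · simp [dirDeriv_compX hy]

lemma totalJac_map {j : J1} (hj : j.1.2.1 ∈ E.X.source) :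
    totalJac E.map j = E.c1 * E.X1 j.1.2.1 := by
  rw [(fibreMap hj).totalJac_eq, dirDeriv_compT, dirDeriv_compX hj]
  simp

lemma IsInverse.totalJac_ne (h : IsInverse E E') {j : J1} (hj : j.1.2.1 ∈ E.X.source) :
    totalJac E.map j ≠ 0 := by
  rw [totalJac_map hj]
  exact mul_ne_zero h.c1_ne (h.X1_ne hj)

lemma IsInverse.prolong1_map (h : IsInverse E E') {j : J1} (hj : j.1.2.1 ∈ E.X.source) :
    prolong1 E.map j = E.jetMap1 j := by
  obtain ⟨n1, n2⟩ := (fibreMap hj).newU_eq (h.totalJac_ne hj)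
  unfold prolong1 jetMap1
  rw [n1, n2, dirDeriv_compT, dirDeriv_compX hj, dirDeriv_compU hj, dirDeriv_compU hj,
    dirDeriv_compU hj]
  simp only [Prod.mk.injEq, true_and]
  constructor <;> congr 1 <;> ring

lemma IsInverse.prolong2_map (h : IsInverse E E') {k : J2} (hk : k.1.1.2.1 ∈ E.X.source) :
    prolong2 E.map k = E.jetMap k := by
  have hφ := contDiffAt_map hk
  obtain ⟨sT, sX, sU⟩ := smooth_comps hφ
  obtain ⟨p1, p2, p3⟩ := (fibreMap hk).prolong2_eq (h.totalJac_ne hk)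
  obtain ⟨n1, n2⟩ := (fibreMap hk).newU_eq (h.totalJac_ne hk)
  unfold contactHess at p1 p2 p3
  simp only [hess_eq sT, hess_eq sX, hess_eq sU, hess_compT, hess_compX hk, hess_compU hk,
    dirDeriv_compT, dirDeriv_compX hk, dirDeriv_compU hk, n2, horT, horX] at p1 p2 p3
  have c1 := h.c1_ne
  have c2 := h.X1_ne hk
  refine Prod.ext (h.prolong1_map hk) (Prod.ext ?_ (Prod.ext ?_ ?_))
  · rw [p1]
    simp only [jetMap]
    field_simp
    ring
  · rw [p2]
    simp only [jetMap]
    field_simp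
    ring
  · rw [p3]
    simp only [jetMap]
    field_simp
    ring

lemma contDiffAt_argMap {b : ℝ × ℝ} (h : IsInverse E E') (hb : b.1 ∈ E.X.source) :
    ContDiffAt ℝ ∞ E.argMap b := by
  have hx : ContDiffAt ℝ ∞ (fun b : ℝ × ℝ => b.1) b := by fun_prop
  have a0 : ContDiffAt ℝ ∞ (fun b : ℝ × ℝ => E.X.toFun b.1) b :=
    ContDiffAt.comp (g := E.X.toFun) b (contDiffAt_X hb).1 hx
  have a1 : ContDiffAt ℝ ∞ (fun b : ℝ × ℝ => E.X1 b.1) b :=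
    ContDiffAt.comp (g := E.X1) b (contDiffAt_X hb).2.1 hx
  have b1 : ContDiffAt ℝ ∞ (fun b : ℝ × ℝ => E.ψ1 b.1) b :=
    ContDiffAt.comp (g := E.ψ1) b (contDiffAt_ψ hb).2.1 hx
  have c : ContDiffAt ℝ ∞ (fun b : ℝ × ℝ => E.c2 * b.2) b := by fun_prop
  exact a0.prodMk ((c.add b1).div a1 (h.X1_ne hb))

lemma contDiffAt_valMap {b : ℝ × ℝ} {f g : ℝ × ℝ → ℝ} (h : IsInverse E E')
    (hb : b.1 ∈ E.X.source) (hf : ContDiffAt ℝ ∞ f b) (hg : ContDiffAt ℝ ∞ g b) :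
    ContDiffAt ℝ ∞ (fun b => E.valMap b (f b, g b)) b := by
  have hx : ContDiffAt ℝ ∞ (fun b : ℝ × ℝ => b.1) b := by fun_prop
  have a1 : ContDiffAt ℝ ∞ (fun b : ℝ × ℝ => E.X1 b.1) b :=
    ContDiffAt.comp (g := E.X1) b (contDiffAt_X hb).2.1 hx
  have a2 : ContDiffAt ℝ ∞ (fun b : ℝ × ℝ => E.X2 b.1) b :=
    ContDiffAt.comp (g := E.X2) b (contDiffAt_X hb).2.2 hx
  have b1 : ContDiffAt ℝ ∞ (fun b : ℝ × ℝ => E.ψ1 b.1) b :=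
    ContDiffAt.comp (g := E.ψ1) b (contDiffAt_ψ hb).2.1 hx
  have b2 : ContDiffAt ℝ ∞ (fun b : ℝ × ℝ => E.ψ2 b.1) b :=
    ContDiffAt.comp (g := E.ψ2) b (contDiffAt_ψ hb).2.2 hx
  have c : ContDiffAt ℝ ∞ (fun b : ℝ × ℝ => E.c2 * b.2) b := by fun_prop
  have cc : ContDiffAt ℝ ∞ (fun _ : ℝ × ℝ => E.c1) b := contDiffAt_const
  have n1 := pow_ne_zero 2 h.c1_ne
  exact (((a1.pow 2).mul hf).div (cc.pow 2) n1).prodMk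
    ((((contDiffAt_const.mul hg).add contDiffAt_const).sub (hf.mul (b2.sub
      ((a2.div a1 (h.X1_ne hb)).mul (c.add b1))))).div (cc.pow 2) n1)

/-- The image of the arbitrary elements `θ`. -/
noncomputable def pushforward (h : IsInverse E E') (θ : ArbElem) : ArbElem where
  dom := {b | b.1 ∈ E'.X.source ∧ E'.argMap b ∈ θ.dom}
  isOpen_dom := by
    have hc : ContinuousOn E'.argMap {b | b.1 ∈ E'.X.source} := fun b hb =>
      (contDiffAt_argMap h.symm hb).continuousAt.continuousWithinAt
    exact hc.isOpen_inter_preimage (E'.X.open_source.preimage continuous_fst) θ.isOpen_dom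
  f b := (E.valMap (E'.argMap b) (θ.f (E'.argMap b), θ.g (E'.argMap b))).1
  g b := (E.valMap (E'.argMap b) (θ.f (E'.argMap b), θ.g (E'.argMap b))).2
  smooth_f b hb := by
    have := ContDiffAt.comp (g := fun b => E.valMap b (θ.f b, θ.g b)) b
      (contDiffAt_valMap h (h.symm.mem_source hb.1) (θ.contDiffAt_f hb.2) (θ.contDiffAt_g hb.2))
      (contDiffAt_argMap h.symm hb.1)
    exact this.fst.contDiffWithinAt
  smooth_g b hb := by
    have := ContDiffAt.comp (g := fun b => E.valMap b (θ.f b, θ.g b)) b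
      (contDiffAt_valMap h (h.symm.mem_source hb.1) (θ.contDiffAt_f hb.2) (θ.contDiffAt_g hb.2))
      (contDiffAt_argMap h.symm hb.1)
    exact this.snd.contDiffWithinAt

lemma pushforward_argMap (h : IsInverse E E') (θ : ArbElem) {b : ℝ × ℝ}
    (hb : b.1 ∈ E.X.source) :
    (E.argMap b ∈ (pushforward h θ).dom ↔ b ∈ θ.dom) ∧
      ((pushforward h θ).f (E.argMap b), (pushforward h θ).g (E.argMap b))
        = E.valMap b (θ.f b, θ.g b) := by
  have e := h.argMap_left_inv hb
  constructor
  · change (E.argMap b).1 ∈ E'.X.source ∧ E'.argMap (E.argMap b) ∈ θ.dom ↔ _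
    rw [e]
    exact and_iff_right (h.mem_source hb)
  · simp only [pushforward, e]

/-- Linearity is invariant: the new slope is affine in `u_x` with nonzero coefficient, so if the
image were linear on an open set, θ would be linear on its preimage. -/
lemma pushforward_mem (h : IsInverse E E') {θ : ArbElem} (hθ : θ ∈ waveClass) :
    pushforward h θ ∈ waveClass := by
  refine ⟨?_, ?_⟩
  · intro b hb
    have hb' := h.symm.mem_source hb.1
    exact div_ne_zero (mul_ne_zero (pow_ne_zero 2 (h.X1_ne hb')) (hθ.1 _ hb.2))
      (pow_ne_zero 2 h.c1_ne)
  · intro V hV hne hsub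
    by_contra hcon
    push Not at hcon
    set θ' := pushforward h θ with hθ'
    let W : Set (ℝ × ℝ) := {b | b.1 ∈ E.X.source} ∩ E.argMap ⁻¹' V
    have hW : IsOpen W := by
      have hc : ContinuousOn E.argMap {b | b.1 ∈ E.X.source} := fun b hb =>
        (contDiffAt_argMap h hb).continuousAt.continuousWithinAt
      exact hc.isOpen_inter_preimage (E.X.open_source.preimage continuous_fst) hV
    obtain ⟨v, hv⟩ := hne
    have hv1 := (hsub hv).1
    have hWne : W.Nonempty := ⟨E'.argMap v, h.symm.mem_source hv1, by
      change E.argMap (E'.argMap v) ∈ V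
      rwa [h.symm.argMap_left_inv hv1]⟩
    have hWdom : W ⊆ θ.dom := fun b hb =>
      (pushforward_argMap h θ hb.1).1.1 (hsub hb.2)
    have hp : ∀ b ∈ W, HasDerivAt (fun r => (E.c2 * r + E.ψ1 b.1) / E.X1 b.1)
        (E.c2 / E.X1 b.1) b.2 := fun b _ => by
      simpa using (((hasDerivAt_id b.2).const_mul E.c2).add_const (E.ψ1 b.1)).div_const (E.X1 b.1)
    have hev : ∀ b ∈ W, ∀ᶠ r in 𝓝 b.2, (b.1, r) ∈ W := fun b hb =>
      ((by fun_prop : Continuous fun r : ℝ => ((b.1, r) : ℝ × ℝ)).tendsto b.2).eventually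
        (hW.mem_nhds hb)
    have hval : ∀ b ∈ W, θ'.f (E.argMap b) = E.X1 b.1 ^ 2 * θ.f b / E.c1 ^ 2 ∧
        θ'.g (E.argMap b) = (E.c2 * θ.g b + 2 * E.c4 - θ.f b * (E.ψ2 b.1 - E.X2 b.1 / E.X1 b.1
          * (E.c2 * b.2 + E.ψ1 b.1))) / E.c1 ^ 2 := fun b hb => by
      have := (pushforward_argMap h θ hb.1).2
      exact ⟨congrArg Prod.fst this, congrArg Prod.snd this⟩
    have n1 := h.c1_ne
    have n2 := h.c2_ne
    have hzero : ∀ b ∈ W, partialUx θ'.f (E.argMap b) = 0 ∧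
        partialUx (partialUx θ'.g) (E.argMap b) = 0 := fun b hb => by
      have := hcon _ hb.2
      exact ⟨congrArg Prod.fst this, congrArg Prod.snd this⟩
    have hfu : ∀ b ∈ W, partialUx θ.f b = 0 := by
      intro b hb
      have nX := h.X1_ne hb.1
      have d1 := hasDerivAt_comp_snd (F := θ'.f) (a := fun _ => E.X.toFun b.1)
        (p := fun r => (E.c2 * r + E.ψ1 b.1) / E.X1 b.1) (s := b.2)
        (θ'.contDiffAt_f (hsub hb.2)).diffAt (hasDerivAt_const _ _) (hp b hb)
      have d2 := ((hasDerivAt_snd (θ.contDiffAt_f (hWdom hb)).diffAt).const_mul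
        (E.X1 b.1 ^ 2)).div_const (E.c1 ^ 2)
      have e := d1.unique (d2.congr_of_eventuallyEq (by
        filter_upwards [hev b hb] with r hr using (hval _ hr).1))
      have z : partialUx θ'.f (E.X.toFun b.1, (E.c2 * b.2 + E.ψ1 b.1) / E.X1 b.1) = 0 :=
        (hzero b hb).1
      rw [z, mul_zero] at e
      field_simp at e
      rw [zero_mul] at e
      rcases mul_eq_zero.mp e.symm with e | e
      · exact absurd e (pow_ne_zero 2 nX)
      · exact e
    -- With f_{u_x} = 0 on `W`, the f-terms contribute only a function of x and f; a second
    -- `u_x`-derivative then kills them.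
    have hgu : ∀ b ∈ W, E.c2 * partialUx θ.g b
        = E.c1 ^ 2 * (E.c2 / E.X1 b.1 * partialUx θ'.g (E.argMap b))
          - θ.f b * (E.X2 b.1 / E.X1 b.1 * E.c2) := by
      intro b hb
      have d1 := hasDerivAt_comp_snd (F := θ'.g) (a := fun _ => E.X.toFun b.1)
        (p := fun r => (E.c2 * r + E.ψ1 b.1) / E.X1 b.1) (s := b.2)
        (θ'.contDiffAt_g (hsub hb.2)).diffAt (hasDerivAt_const _ _) (hp b hb)
      have df := hasDerivAt_snd (θ.contDiffAt_f (hWdom hb)).diffAt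
      rw [hfu b hb] at df
      have dl : HasDerivAt (fun r => E.ψ2 b.1 - E.X2 b.1 / E.X1 b.1 * (E.c2 * r + E.ψ1 b.1))
          (-(E.X2 b.1 / E.X1 b.1 * E.c2)) b.2 := by
        simpa using ((((hasDerivAt_id b.2).const_mul E.c2).add_const (E.ψ1 b.1)).const_mul
          (E.X2 b.1 / E.X1 b.1)).const_sub (E.ψ2 b.1)
      have d2 := ((((hasDerivAt_snd (θ.contDiffAt_g (hWdom hb)).diffAt).const_mul E.c2).add_const
        (2 * E.c4)).sub (df.mul dl)).div_const (E.c1 ^ 2)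
      have e := d1.unique (d2.congr_of_eventuallyEq (by
        filter_upwards [hev b hb] with r hr using (hval _ hr).2))
      change _ * partialUx θ'.g (E.argMap b) = _ at e
      rw [e, mul_div_cancel₀ _ (pow_ne_zero 2 n1)]
      ring
    obtain ⟨b, hb, hbne⟩ := hθ.2 W hW hWne hWdom
    apply hbne
    refine Prod.ext (hfu b hb) ?_
    have d1 := hasDerivAt_comp_snd (F := partialUx θ'.g) (a := fun _ => E.X.toFun b.1)
        (p := fun r => (E.c2 * r + E.ψ1 b.1) / E.X1 b.1) (s := b.2)
      (θ'.contDiffAt_g (hsub hb.2)).partialUx.diffAt (hasDerivAt_const _ _) (hp b hb)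
    have df := hasDerivAt_snd (θ.contDiffAt_f (hWdom hb)).diffAt
    rw [hfu b hb] at df
    have d2 := (hasDerivAt_snd (θ.contDiffAt_g (hWdom hb)).partialUx.diffAt).const_mul E.c2
    have d3 := ((d1.const_mul (E.c2 / E.X1 b.1)).const_mul (E.c1 ^ 2)).sub
      (df.mul_const (E.X2 b.1 / E.X1 b.1 * E.c2))
    have e := d2.unique (d3.congr_of_eventuallyEq (by
      filter_upwards [hev b hb] with r hr using hgu _ hr))
    have z : partialUx (partialUx θ'.g)
      (E.X.toFun b.1, (E.c2 * b.2 + E.ψ1 b.1) / E.X1 b.1) = 0 := (hzero b hb).2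
    rw [z] at e
    simp only [mul_zero, zero_mul, sub_zero] at e
    exact (mul_eq_zero.mp e).resolve_left n2

lemma jetArg_jetMap1 (E : EquivData) (j : J1) : jetArg (E.jetMap1 j) = E.argMap (jetArg j) := rfl

/-- A transformation of the above form is admissible as soon as it maps arbitrary elements to
arbitrary elements. -/
lemma IsInverse.admissibleAt (h : IsInverse E E') {θ θ' : ArbElem} {j : J1}
    {φ : PointTransformation J0} (hφ : φ.toFun = E.map) (hs : j.1 ∈ φ.source)
    (hx : j.1.2.1 ∈ E.X.source) (hd : jetArg j ∈ θ.dom)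
    (hv : ∀ᶠ i in 𝓝 j, E.argMap (jetArg i) ∈ θ'.dom ∧
      (θ'.f (E.argMap (jetArg i)), θ'.g (E.argMap (jetArg i)))
        = E.valMap (jetArg i) (θ.f (jetArg i), θ.g (jetArg i))) :
    AdmissibleAt θ θ' φ j := by
  refine ⟨hs, hd, hφ ▸ h.totalJac_ne hx, ?_⟩
  have hx' : ∀ᶠ i : J1 in 𝓝 j, i.1.2.1 ∈ E.X.source :=
    (continuousAt_fst (p := j)).eventually (eventually_mem hx)
  have hd' : ∀ᶠ i in 𝓝 j, jetArg i ∈ θ.dom :=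
    continuous_jetArg.continuousAt.eventually (θ.isOpen_dom.mem_nhds hd)
  have t : Filter.Tendsto (fun k : J2 => k.1) (nearJet j) (𝓝 j) := Filter.tendsto_comap
  filter_upwards [t.eventually hv, t.eventually hx', t.eventually hd'] with k ⟨v1, v2⟩ k2 k3
  rw [hφ, h.prolong2_map k2]
  have e1 := congrArg Prod.fst v2
  have e2 := congrArg Prod.snd v2
  simp only [valMap] at e1 e2
  have c1 := h.c1_ne
  have c2 := h.c2_ne
  have n : E.X1 (jetArg k.1).1 ≠ 0 := h.X1_ne k2
  change _ ∧ _ ↔ jetArg (E.jetMap1 k.1) ∈ _ ∧ (E.c2 * k.2.1 + 2 * E.c4) / E.c1 ^ 2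
    = θ'.f (jetArg (E.jetMap1 k.1)) * ((E.c2 * k.2.2.2 + E.ψ2 (jetArg k.1).1
      - E.X2 (jetArg k.1).1 / E.X1 (jetArg k.1).1 * (E.c2 * (jetArg k.1).2
      + E.ψ1 (jetArg k.1).1)) / E.X1 (jetArg k.1).1 ^ 2) + θ'.g (jetArg (E.jetMap1 k.1))
  rw [jetArg_jetMap1, e1, e2]
  refine and_congr (iff_of_true k3 v1) ⟨fun q => ?_, fun q => ?_⟩
  · rw [q]
    field_simp
    ring
  · field_simp at q
    refine mul_left_cancel₀ (mul_ne_zero c2 n) ?_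
    linear_combination q

/-- The image equation is `pushforward`. The maps and sources are described by equations so that the
statement applies both to `toBig` and, with the roles of E and E' exchanged, to its inverse. -/
lemma IsInverse.preservesClass (h : IsInverse E E') {Φ : PointTransformation (J2 × (ℝ × ℝ))}
    {φ : PointTransformation J0} (hΦ : Φ.toFun = E.bigMap) (hφ : φ.toFun = E.map)
    (hΦs : Φ.source = {w | w.1.1.1.2.1 ∈ E.X.source})
    (hφs : φ.source = {z | z.2.1 ∈ E.X.source}) : PreservesClass waveClass Φ φ := by
  intro θ hθ k hk hs
  rw [hΦs] at hs
  have hx : k.1.1.2.1 ∈ E.X.source := hs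
  have hx' : ∀ᶠ i : J1 in 𝓝 k.1, i.1.2.1 ∈ E.X.source :=
    (continuousAt_fst (p := k.1)).eventually (eventually_mem hx)
  have hd' : ∀ᶠ i in 𝓝 k.1, jetArg i ∈ θ.dom :=
    continuous_jetArg.continuousAt.eventually (θ.isOpen_dom.mem_nhds hk)
  refine ⟨pushforward h θ, pushforward_mem h hθ, ?_, ?_⟩
  · have t : Filter.Tendsto (fun k : J2 => k.1) (𝓝 k) (𝓝 k.1) := continuousAt_fst
    filter_upwards [t.eventually hx', t.eventually hd'] with i i1 i2
    obtain ⟨p1, p2⟩ := pushforward_argMap h θ (b := jetArg i.1) i1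
    rw [hΦs, hφ, hΦ, h.prolong1_map i1, jetArg_jetMap1, h.prolong2_map i1]
    refine ⟨i1, p1.2 i2, ?_⟩
    refine Prod.ext rfl ?_
    exact p2.symm
  · refine h.admissibleAt hφ (by rw [hφs]; exact hx) hx hk ?_
    filter_upwards [hx', hd'] with i i1 i2
    obtain ⟨p1, p2⟩ := pushforward_argMap h θ (b := jetArg i) i1
    exact ⟨p1.2 i2, p2⟩

lemma IsInverse.isEquivTransformation (h : IsInverse E E') :
    IsEquivTransformation waveClass (toBig h) (toPoint h) where
  prolongs _ hw := ⟨hw, h.totalJac_ne hw, (h.prolong2_map hw).symm⟩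
  preserves := h.preservesClass rfl rfl rfl rfl
  preserves_inverse := h.symm.preservesClass rfl rfl rfl rfl

end EquivData

/-! ## Semi-normalization -/

/-- A smooth function of one variable with nonzero derivative restricts to a point
transformation. -/
lemma exists_pointTransformation {a : ℝ → ℝ} {x₀ : ℝ} {p : ℝ → Prop}
    (ha : ∀ᶠ x in 𝓝 x₀, ContDiffAt ℝ ∞ a x) (h0 : deriv a x₀ ≠ 0) (hp : ∀ᶠ x in 𝓝 x₀, p x) :
    ∃ X : PointTransformation ℝ, x₀ ∈ X.source ∧ X.toFun = a ∧ ∀ x ∈ X.source, p x := by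
  have ha0 := ha.self_of_nhds
  have hd : ContDiffAt ℝ ∞ (deriv a) x₀ := ha0.derivWithin (by norm_cast)
  obtain ⟨W, hW, hWo, hxW⟩ := eventually_nhds_iff.mp
    ((ha.and (hd.continuousAt.eventually_ne h0)).and hp)
  have hs := (ha0.hasStrictDerivAt infty_ne_zero).hasStrictFDerivAt_equiv h0
  let Y := (hs.toOpenPartialHomeomorph a).restrOpen W hWo
  refine ⟨⟨Y, fun x hx => ?_, fun y hy => ?_⟩, ⟨hs.mem_toOpenPartialHomeomorph_source, hxW⟩,
    rfl, fun x hx => (hW x hx.2).2⟩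
  · exact (hW x hx.2).1.1.contDiffWithinAt
  · have hx : Y.symm y ∈ W := (Y.map_target hy).2
    obtain ⟨⟨h1, h2⟩, -⟩ := hW _ hx
    exact (Y.contDiffAt_symm_deriv h2 hy h1.diffAt.hasDerivAt h1).contDiffWithinAt

lemma KilledNear.const_lineX {F : J0 → ℝ} {z : J0} (h : KilledNear (0, 1, 0) F z) :
    ∀ᶠ x in 𝓝 z.2.1, F (z.1, x, z.2.2) = F z := by
  refine eventually_const_of_deriv (g := fun x => F (z.1, x, z.2.2)) ?_
  filter_upwards [(tendsto_lineX z).eventually h] with x hx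
  exact hx.2 ▸ hasDerivAt_dX hx.1.diffAt

lemma deriv_lineX {F : J0 → ℝ} {z : J0} (hF : ∀ᶠ y in 𝓝 z, ContDiffAt ℝ ∞ F y) :
    ∀ᶠ x in 𝓝 z.2.1, deriv (fun x => F (z.1, x, z.2.2)) x = dX F (z.1, x, z.2.2) ∧
      deriv (deriv fun x => F (z.1, x, z.2.2)) x = dX (dX F) (z.1, x, z.2.2) := by
  have first : ∀ {F : J0 → ℝ}, (∀ᶠ y in 𝓝 z, ContDiffAt ℝ ∞ F y) →
      ∀ᶠ x in 𝓝 z.2.1, deriv (fun x => F (z.1, x, z.2.2)) x = dX F (z.1, x, z.2.2) := by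
    intro F hF
    filter_upwards [(tendsto_lineX z).eventually hF] with x hx
    exact (hasDerivAt_dX hx.diffAt).deriv
  filter_upwards [(first hF).eventually_nhds,
    first (hF.mono fun _ hy => hy.dirDeriv (0, 1, 0))] with x h1 h2
  exact ⟨h1.self_of_nhds, (Filter.EventuallyEq.deriv_eq h1).trans h2⟩

/-! ### Construction of the equivalence transformation attached to an admissible one. -/

namespace EquivData

lemma exists_isInverse (E : EquivData) (n1 : E.c1 ≠ 0) (n2 : E.c2 ≠ 0) :
    ∃ E', IsInverse E E' := by
  -- These constants are forced by `IsInverse.coeffs`, and the last function is `hψ` solved for the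
  -- inverse's ψ.
  refine ⟨⟨- E.c0 / E.c1, 1 / E.c1, 1 / E.c2, (2 * E.c4 * E.c0 / E.c1 - E.c3) / (E.c2 * E.c1),
    - E.c4 / (E.c2 * E.c1 ^ 2), E.X.inverse, fun y => -(1 / E.c2 * E.ψ (E.X.invFun y)
      + - E.c4 / (E.c2 * E.c1 ^ 2) * E.c0 ^ 2
      + (2 * E.c4 * E.c0 / E.c1 - E.c3) / (E.c2 * E.c1) * E.c0), ?_⟩, rfl, ?_, ?_, ?_, ?_, ?_, ?_⟩
  · have h : ContDiffOn ℝ ∞ (fun y => E.ψ (E.X.invFun y)) E.X.target :=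
      ContDiffOn.comp (g := E.ψ) E.smooth_ψ E.X.smooth_invFun fun y hy => E.X.map_target' hy
    exact (((contDiffOn_const.mul h).add contDiffOn_const).add contDiffOn_const).neg
  · field_simp
  · field_simp
    ring
  · field_simp
  · field_simp
    ring
  · field_simp
    ring
  · intro x hx
    have e : E.X.invFun (E.X.toFun x) = x := E.X.left_inv' hx
    simp only [e]
    ring

variable {θ θ' : ArbElem} {φ : PointTransformation J0} {j : J1}

/-- The arbitrary elements `θ` are mapped to `θ'` near the first-order jet `j`. -/
def MapsElem (E : EquivData) (θ θ' : ArbElem) (j : J1) : Prop :=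
  ∀ᶠ i in 𝓝 j, E.argMap (jetArg i) ∈ θ'.dom ∧
    (θ'.f (E.argMap (jetArg i)), θ'.g (E.argMap (jetArg i)))
      = E.valMap (jetArg i) (θ.f (jetArg i), θ.g (jetArg i))

/-- At fixed t and u, `eqF` and `eqE'` involve φ only through X, U_x, U_xx and the numbers T_t, U_u,
`accelU`, which do not depend on x. Replacing T by its first-order Taylor polynomial in t, and U by
the corresponding expression quadratic in t and affine in u, leaves both equations intact. -/
lemma exists_equivData (hθ : θ ∈ waveClass) (hθ' : θ' ∈ waveClass)
    (hadm : AdmissibleAt θ θ' φ j) :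
    ∃ E E' : EquivData, IsInverse E E' ∧ j.1.2.1 ∈ E.X.source ∧
      prolong1 E.map j = prolong1 φ.toFun j ∧ E.MapsElem θ θ' j := by
  set F := φ.toFun with hF
  have hd := hadm.determiningEqs
  have h : ∀ᶠ i in 𝓝 j, FibreEqs θ θ' F i :=
    hd.eventually_nhds.mono fun _ hk => fibreEqs_of_determiningEqs hθ hθ' hk
  have h0 := h.self_of_nhds
  have hf := h0.fibre
  have sX : ∀ᶠ y in 𝓝 j.1, ContDiffAt ℝ ∞ (compX F) y :=
    hf.mono fun _ hy => (smooth_comps hy.1).2.1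
  have sU := hf.smooth_compU
  have lX := deriv_lineX sX
  have lU := deriv_lineX sU
  have ca : ∀ᶠ x in 𝓝 j.1.2.1, ContDiffAt ℝ ∞ (fun x => compX F (j.1.1, x, j.1.2.2)) x :=
    ((tendsto_lineX j.1).eventually sX).mono fun x hx =>
      ContDiffAt.comp (g := compX F) x hx (by fun_prop)
  have cb : ∀ᶠ x in 𝓝 j.1.2.1, ContDiffAt ℝ ∞ (fun x => compU F (j.1.1, x, j.1.2.2)) x :=
    ((tendsto_lineX j.1).eventually sU).mono fun x hx =>
      ContDiffAt.comp (g := compU F) x hx (by fun_prop)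
  obtain ⟨X, hXs, hXa, hXp⟩ := exists_pointTransformation ca
    (by rw [lX.self_of_nhds.1]; exact h0.Xx) cb
  -- For affine T the quantity `accelU` reduces to U_tt = 2c₄. Then `c3` matches U_t at the base
  -- point, and ψ is the restriction of U to the x-line, shifted by a constant so that U itself is
  -- matched.
  let c4 := accelU F j.1 / 2
  let c3 := dT (compU F) j.1 - 2 * c4 * j.1.1
  let E : EquivData :=
    { c0 := compT F j.1 - dT (compT F) j.1 * j.1.1
      c1 := dT (compT F) j.1
      c2 := dU (compU F) j.1
      c3 := c3
      c4 := c4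
      X := X
      ψ := fun x => compU F (j.1.1, x, j.1.2.2)
        - (dU (compU F) j.1 * j.1.2.2 + c4 * j.1.1 ^ 2 + c3 * j.1.1)
      smooth_ψ := fun x hx => ((hXp x hx).sub contDiffAt_const).contDiffWithinAt }
  obtain ⟨E', hE⟩ := E.exists_isInverse h0.Tt h0.Uu
  have eX1 : E.X1 = deriv fun x => compX F (j.1.1, x, j.1.2.2) := congrArg deriv hXa
  have eX2 : E.X2 = deriv (deriv fun x => compX F (j.1.1, x, j.1.2.2)) := congrArg deriv eX1
  have eψ1 : E.ψ1 = deriv fun x => compU F (j.1.1, x, j.1.2.2) :=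
    funext fun x => deriv_sub_const _
  have eψ2 : E.ψ2 = deriv (deriv fun x => compU F (j.1.1, x, j.1.2.2)) := congrArg deriv eψ1
  have eX : ∀ x, E.X.toFun x = compX F (j.1.1, x, j.1.2.2) := fun x => congrFun hXa x
  refine ⟨E, E', hE, hXs, ?_, ?_⟩
  · rw [hE.prolong1_map hXs]
    obtain ⟨n1, n2⟩ := hf.newU_eq hadm.2.2.1
    unfold prolong1
    rw [n1, n2]
    refine Prod.ext (Prod.ext ?_ (Prod.ext (eX _) ?_)) (Prod.ext ?_ ?_)
    · change _ * _ + (compT F j.1 - _) = compT F j.1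
      ring
    · change dU (compU F) j.1 * _ + (c4 * _ + c3 * _ + (compU F j.1 - _)) = compU F j.1
      ring
    · change (dU (compU F) j.1 * _ + (2 * c4 * _ + (_ - _))) / dT (compT F) j.1 = _
      congr 1
      ring
    · change (dU (compU F) j.1 * _ + E.ψ1 _) / E.X1 _ = _
      rw [eψ1, eX1, lX.self_of_nhds.1, lU.self_of_nhds.1]
      congr 1
      ring
  -- A single constant c₄ must serve every nearby x; this is where the x-independence of `accelU` is
  -- needed.
  · have kA : KilledNear (0, 1, 0) (accelU F) j.1 := by
      have := eventually_base (j := j) (p := fun z => ContDiffAt ℝ ∞ (accelU F) z ∧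
        dX (accelU F) z = 0) (h.eventually_nhds.mono fun i hi =>
          ⟨smooth_accelU hi.self_of_nhds.fibre.self_of_nhds.1 hi.self_of_nhds.Tt,
            FibreEqs.dX_accelU hθ hθ' hi⟩)
      exact this
    have cx : Filter.Tendsto (fun i : J1 => i.1.2.1) (𝓝 j) (𝓝 j.1.2.1) :=
      (by fun_prop : Continuous fun i : J1 => i.1.2.1).tendsto j
    -- The claim concerns only (x, u_x), so t, u and `u_t` may be frozen at their values in j before
    -- the determining equations are applied.
    have cl : Filter.Tendsto (fun i : J1 => (((j.1.1, i.1.2.1, j.1.2.2), (j.2.1, i.2.2)) : J1))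
        (𝓝 j) (𝓝 j) :=
      (by fun_prop : Continuous fun i : J1 =>
        (((j.1.1, i.1.2.1, j.1.2.2), (j.2.1, i.2.2)) : J1)).tendsto j
    filter_upwards [cl.eventually h.eventually_nhds, cx.eventually lX, cx.eventually lU,
      cx.eventually kA.const_lineX, cx.eventually (FibreEqs.killed_dU hθ hθ' h).1.const_lineX,
      cx.eventually (hf.killed_compT.1.dirDeriv (1, 0, 0)).const_lineX]
      with i hi ⟨x1, x2⟩ ⟨u1, u2⟩ eA eU eT
    have i0 := hi.self_of_nhds
    have q := FibreEqs.eqE' hθ hθ' hi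
    have qF := i0.eqF
    have qd := i0.mem_dom'
    have nT := h0.Tt
    have nX := i0.Xx
    dsimp only at q qF qd nX
    have arg : E.argMap (jetArg i) = (compX F (j.1.1, i.1.2.1, j.1.2.2),
        (dX (compU F) (j.1.1, i.1.2.1, j.1.2.2)
          + i.2.2 * dU (compU F) (j.1.1, i.1.2.1, j.1.2.2))
          / dX (compX F) (j.1.1, i.1.2.1, j.1.2.2)) := by
      refine Prod.ext (eX _) ?_
      change (dU (compU F) j.1 * i.2.2 + E.ψ1 i.1.2.1) / E.X1 i.1.2.1 = _
      rw [eψ1, eX1, x1, u1, eU]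
      congr 1
      ring
    have ja : jetArg ((j.1.1, i.1.2.1, j.1.2.2), (j.2.1, i.2.2)) = jetArg i := rfl
    rw [← arg, ja, eT] at qF
    rw [← arg, ja, eT, eA] at q
    rw [← arg] at qd
    refine ⟨qd, Prod.ext ?_ ?_⟩
    · change _ = E.X1 i.1.2.1 ^ 2 * θ.f (jetArg i) / dT (compT F) j.1 ^ 2
      rw [eX1, x1, eq_div_iff (pow_ne_zero 2 nT), qF]
      ring
    · change _ = (dU (compU F) j.1 * θ.g (jetArg i) + 2 * (accelU F j.1 / 2)
        - θ.f (jetArg i) * (E.ψ2 i.1.2.1 - E.X2 i.1.2.1 / E.X1 i.1.2.1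
        * (dU (compU F) j.1 * i.2.2 + E.ψ1 i.1.2.1))) / dT (compT F) j.1 ^ 2
      rw [eX1, eX2, eψ1, eψ2, x1, x2, u1, u2, eq_div_iff (pow_ne_zero 2 nT), mul_comm, ← q, eU]
      unfold rateX
      ring

variable {E E' : EquivData}

lemma IsInverse.transforms (h : IsInverse E E') (hx : j.1.2.1 ∈ E.X.source)
    (hv : E.MapsElem θ θ' j) : Transforms (toBig h) (toPoint h) θ θ' (nearJet j) := by
  have hx' : ∀ᶠ i : J1 in 𝓝 j, i.1.2.1 ∈ E.X.source :=
    (continuousAt_fst (p := j)).eventually (eventually_mem hx)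
  have t : Filter.Tendsto (fun k : J2 => k.1) (nearJet j) (𝓝 j) := Filter.tendsto_comap
  filter_upwards [t.eventually hv, t.eventually hx'] with k ⟨v1, v2⟩ k1
  refine ⟨k1, ?_, ?_⟩
  · change jetArg (prolong1 E.map k.1) ∈ _
    rwa [h.prolong1_map k1]
  · change E.bigMap _ = (prolong2 E.map k, θ'.val (prolong1 E.map k.1))
    rw [h.prolong1_map k1, h.prolong2_map k1]
    exact Prod.ext rfl v2.symm

end EquivData

/-- The composition of point transformations. -/
noncomputable def PointTransformation.trans {V : Type} [NormedAddCommGroup V] [NormedSpace ℝ V]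
    (φ ψ : PointTransformation V) : PointTransformation V where
  toOpenPartialHomeomorph := φ.toOpenPartialHomeomorph.trans ψ.toOpenPartialHomeomorph
  smooth_toFun := ContDiffOn.comp (g := ψ.toFun) (f := φ.toFun) (t := ψ.source) ψ.smooth_toFun
    (φ.smooth_toFun.mono fun _ hz => hz.1) fun _ hz => hz.2
  smooth_invFun := ContDiffOn.comp (g := φ.invFun) (f := ψ.invFun) (t := φ.target) φ.smooth_invFun
    (ψ.smooth_invFun.mono fun _ hz => hz.1) fun _ hz => hz.2

/-! ### Factoring an admissible transformation through the equivalence pseudogroup. -/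

section Factorization

variable {θ θ' : ArbElem} {φ : PointTransformation J0} {j : J1} {E E' : EquivData}

open EquivData

/-- If the admissible transformation `φ` and an equivalence transformation act in the same way on
a first-order jet and on the arbitrary elements, then they differ by a symmetry. -/
lemma AdmissibleAt.symmetry (hadm : AdmissibleAt θ θ' φ j) (h : IsInverse E E')
    (hx : j.1.2.1 ∈ E.X.source) (hp : prolong1 E.map j = prolong1 φ.toFun j)
    (hv : E.MapsElem θ θ' j) :
    prolong1 (φ.trans (toPoint h).inverse).toFun j = j ∧
      AdmissibleAt θ θ (φ.trans (toPoint h).inverse) j ∧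
      ∀ᶠ z in 𝓝 j.1, φ.toFun z = E.map ((φ.trans (toPoint h).inverse).toFun z) := by
  have hE : AdmissibleAt θ θ' (toPoint h) j :=
    h.admissibleAt rfl hx hx hadm.2.1 hv
  set σ := φ.trans (toPoint h).inverse with hσ
  have σeq : σ.toFun = E'.map ∘ φ.toFun := rfl
  have hz : E.map j.1 = φ.toFun j.1 := congrArg Prod.fst hp
  have hy : (φ.toFun j.1).2.1 ∈ E'.X.source := by
    rw [← hz]
    exact h.mem_source hx
  have hs : j.1 ∈ σ.source := ⟨hadm.1, hy⟩
  have hsn : ∀ᶠ z in 𝓝 j.1, z ∈ σ.source := σ.open_source.mem_nhds hs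
  have key : ∀ z ∈ σ.source, (σ.toFun z).2.1 ∈ E.X.source ∧ φ.toFun z = E.map (σ.toFun z) :=
    fun z hz => ⟨h.symm.mem_source hz.2, (h.symm.map_left_inv hz.2).symm⟩
  have hφ := φ.contDiffAt hadm.1
  have pj : prolong1 σ.toFun j = j := by
    rw [σeq, prolong1_comp hφ (contDiffAt_map hy) hadm.2.2.1, ← hp, h.prolong1_map hx,
      h.symm.prolong1_map (h.mem_source hx), h.jetMap1_left_inv hx]
  have hJ : totalJac σ.toFun j ≠ 0 := by
    rw [σeq, totalJac_comp hφ (contDiffAt_map hy) hadm.2.2.1]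
    exact mul_ne_zero (h.symm.totalJac_ne hy) hadm.2.2.1
  refine ⟨pj, ⟨hs, hadm.2.1, hJ, ?_⟩, hsn.mono fun z hz => (key z hz).2⟩
  have t : Filter.Tendsto (fun k : J2 => k.1) (nearJet j) (𝓝 j) := Filter.tendsto_comap
  have t0 : Filter.Tendsto (fun k : J2 => k.1.1) (nearJet j) (𝓝 j.1) :=
    (continuous_fst.tendsto j).comp t
  -- Because σ fixes the jet j, the criterion for the equivalence transformation near j can be
  -- evaluated at images under `prolong2 σ.toFun`.
  have tσ : Filter.Tendsto (prolong2 σ.toFun) (nearJet j) (nearJet j) := by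
    refine Filter.tendsto_comap_iff.2 ?_
    have c := (differentiableAt_prolong1 (σ.contDiffAt hs) hJ).continuousAt.tendsto
    rw [pj] at c
    exact c.comp t
  filter_upwards [hadm.2.2.2, tσ.eventually hE.2.2.2, t0.eventually hsn.eventually_nhds,
    t.eventually ((differentiableAt_totalJac (σ.contDiffAt hs)).continuousAt.eventually_ne hJ)]
    with k k1 k2 k3 k4
  have k30 := (key _ k3.self_of_nhds).1
  have e : prolong2 φ.toFun k = prolong2 E.map (prolong2 σ.toFun k) := by
    rw [← prolong2_comp (k3.mono fun z hz => σ.contDiffAt hz)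
      ((eventually_mem k30).mono fun z hz => contDiffAt_map hz) k4 (h.totalJac_ne k30)]
    exact prolong2_congr (k3.mono fun z hz => (key z hz).2)
  rw [k1, e]
  exact k2.symm

lemma semiNormalized_waveClass : SemiNormalized waveClass := by
  intro θ hθ θ' hθ' φ j hadm
  obtain ⟨E, E', h, hx, hp, hv⟩ := exists_equivData hθ hθ' hadm
  obtain ⟨pj, hσ, he⟩ := hadm.symmetry h hx hp hv
  refine ⟨toBig h, toPoint h, φ.trans (toPoint h).inverse, h.isEquivTransformation, hσ, ?_, he⟩
  rw [pj]
  exact h.transforms hx hv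

end Factorization

/-- An equivalence transformation mapping `θ` to `θ'` is an admissible transformation. -/
lemma IsEquivTransformation.admissibleAt {S : Set ArbElem}
    {Φ : PointTransformation (J2 × (ℝ × ℝ))} {φ : PointTransformation J0} {θ θ' : ArbElem} {j : J1}
    (h : IsEquivTransformation S Φ φ) (hθ : θ ∈ S) (hj : jetArg j ∈ θ.dom)
    (ht : Transforms Φ φ θ θ' (nearJet j)) : AdmissibleAt θ θ' φ j := by
  have ht' := tendsto_nearJet ht
  -- `PreservesClass` asks for a second-order jet; any one over j will do, here with zero second
  -- derivatives. It supplies some image θ'' that need not be θ', so the two are compared below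
  -- through the (f, g)-component of Φ; agreement of values suffices.
  obtain ⟨θ'', -, h1, a1, a2, a3, a4⟩ :=
    h.preserves θ hθ (j, 0) hj (ht'.self_of_nhds 0).1
  refine ⟨a1, a2, a3, ?_⟩
  have t : Filter.Tendsto (fun k : J2 => k.1) (nearJet j) (𝓝 j) := Filter.tendsto_comap
  have c : Filter.Tendsto (fun i : J1 => ((i, 0) : J2)) (𝓝 j) (𝓝 (j, 0)) :=
    (by fun_prop : Continuous fun i : J1 => ((i, 0) : J2)).tendsto j
  filter_upwards [a4, t.eventually (c.eventually h1), t.eventually ht'] with k k1 ⟨_, k2, k3⟩ k4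
  obtain ⟨-, k5, k6⟩ := k4 0
  have e : θ''.val (prolong1 φ.toFun k.1) = θ'.val (prolong1 φ.toFun k.1) :=
    congrArg Prod.snd (k3.symm.trans k6)
  rw [k1]
  change _ ∈ _ ∧ _ = (θ''.val (prolong1 φ.toFun k.1)).1 * _ + (θ''.val (prolong1 φ.toFun k.1)).2 ↔
    _ ∈ _ ∧ _ = (θ'.val (prolong1 φ.toFun k.1)).1 * _ + (θ'.val (prolong1 φ.toFun k.1)).2
  rw [e]
  exact and_congr_left fun _ => iff_of_true k2 k5

/-- The map from `exists_equivData` has the same first-order jet image as the given point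
transformation, so it already realizes the equivalence without a symmetry factor. -/
lemma groupEquiv_iff_pointEquiv (a b : LocalElem waveClass) :
    GroupEquiv a b ↔ PointEquiv a b := by
  constructor
  · rintro ⟨Φ, φ, h, ht, hp⟩
    exact ⟨φ, h.admissibleAt a.mem a.jet_mem ht, hp⟩
  · rintro ⟨φ, hadm, hp⟩
    obtain ⟨E, E', h, hx, hp', hv⟩ := EquivData.exists_equivData a.mem b.mem hadm
    exact ⟨EquivData.toBig h, EquivData.toPoint h, h.isEquivTransformation, h.transforms hx hv,
      hp'.trans hp⟩

theorem mainTheorem4 :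
    SemiNormalized waveClass ∧
    (∀ a b : LocalElem waveClass, GroupEquiv a b ↔ PointEquiv a b) ∧
    (∀ {Γ : Type*} (𝒮 : Γ → Set (LocalElem waveClass)),
      IsClassificationList GroupEquiv 𝒮 ↔ IsClassificationList PointEquiv 𝒮) :=
  ⟨semiNormalized_waveClass, groupEquiv_iff_pointEquiv, fun 𝒮 => by
    rw [show (GroupEquiv : LocalElem waveClass → LocalElem waveClass → Prop) = PointEquiv from
      funext fun a => funext fun b => propext (groupEquiv_iff_pointEquiv a b)]⟩
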